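/- For a measurable real-valued function $u_0$ on $\mathbb{R}^d$ define the heat flow maximal function $$u^*(x)=\sup_{t>0}\,(|u_0|*K_t)(x)\in[0,\infty],\qquad K_t(x)=\frac{1}{(4\pi t)^{d/2}}\,e^{-|x|^2/4t}.$$ Write $W^{1,p}$ for the space of functions in $L^p$ whose weak gradient is in $L^p$; $\|\nabla f\|_p$ is the $L^p$-norm of the Euclidean length $|\nabla f|$ of the weak gradient, and for $f:\mathbb{R}\to\mathbb{R}$, $V(f)$ is the total (pointwise) variation of $f$ on $\mathbb{R}$. The following hold. (i) Let $1<p\le\infty$ and $u_0\in W^{1,p}(\mathbb{R})$. Then $u^*\in W^{1,p}(\mathbb{R})$ and $\|(u^*)'\|_p\le\|u_0'\|_p$. (ii) Let $u_0\in W^{1,1}(\mathbb{R})$. Then $u^*\in L^\infty(\mathbb{R})$, and $u^*$ has a weak derivative $(u^*)'$, which satisfies $\|(u^*)'\|_1\le\|u_0'\|_1$. (iii) Let $u_0$ be of bounded variation on $\mathbb{R}$, i.e. $V(u_0)<\infty$. Then $u^*$ is finite everywhere and of bounded variation on $\mathbb{R}$, and $V(u^*)\le V(u_0)$. (iv) Let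 $d>1$ and $u_0\in W^{1,p}(\mathbb{R}^d)$, where $p=2$ or $p=\infty$. Then $u^*\in W^{1,p}(\mathbb{R}^d)$ and $\|\nabla u^*\|_p\le\|\nabla u_0\|_p$. In (i), (ii) and (iv) the function $u^*$ is in particular finite almost everywhere. -/

import Mathlib

open MeasureTheory
open scoped ENNReal ContDiff

noncomputable section HeatMaximal

variable {E : Type*} [NormedAddCommGroup E] [InnerProductSpace ℝ E] [MeasureSpace E]

/-- The heat kernel `K_t(x) = (4πt)^{-d/2} exp(-|x|²/(4t))` on a Euclidean space `E` of
dimension `d`. -/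
def heatKernel (t : ℝ) (x : E) : ℝ :=
  1 / (4 * Real.pi * t) ^ ((Module.finrank ℝ E : ℝ) / 2) * Real.exp (-‖x‖ ^ 2 / (4 * t))

/-- The heat flow maximal function `u*(x) = sup_{t > 0} (|u| * K_t)(x)`, with values
in `[0, ∞]`. -/
def heatMaximal (u : E → ℝ) (x : E) : ℝ≥0∞ :=
  ⨆ (t : ℝ) (_ : 0 < t), ∫⁻ y, ENNReal.ofReal |u y| * ENNReal.ofReal (heatKernel t (x - y))

/-- `g` is a weak gradient of `u`: both are locally integrable and
`∫ u ∂_v φ = - ∫ (g · v) φ` for all directions `v` and all smooth compactly supported `φ`.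
For `E = ℝ` this says that `g` is a weak derivative of `u`. -/
def IsWeakGradient (u : E → ℝ) (g : E → E) : Prop :=
  LocallyIntegrable u ∧ LocallyIntegrable g ∧
    ∀ φ : E → ℝ, ContDiff ℝ ∞ φ → HasCompactSupport φ → ∀ v : E,
      ∫ x, u x * fderiv ℝ φ x v = -∫ x, inner ℝ (g x) v * φ x

/-- The Sobolev space `W^{1,p}(E)`, `1 ≤ p ≤ ∞`: functions in `L^p` with a weak gradient
in `L^p`. -/
def MemW1 (p : ℝ≥0∞) (u : E → ℝ) : Prop :=
  MemLp u p ∧ ∃ g : E → E, IsWeakGradient u g ∧ MemLp g p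

end HeatMaximal

/-! Put `f = |u₀|` and let `P_t` be the heat semigroup, so that `u* = sup_{t>0} P_t f`.
Heuristically `u* ≥ f`, and `u*` is subharmonic where `u* > f`, since there the supremum is governed
by positive times. Passing from `f` to such a majorant lowers the energy: with `w = u* - f ≥ 0`, the
square energy of `f` is that of `u*`, plus that of `w`, plus a positive multiple of `∫ w Δu*`, which
is nonnegative because at each point `w = 0` or `Δu* ≥ 0`. Two discretizations make this rigorous.

For `p = 2`, in every dimension, time is discretized. The maximum `S` of `f` and of all `P_{kε} f`,
`k ≥ 1`, satisfies `S ≤ P_ε S` where `S > f`, and reversibility of Gaussian jumps gives `E_ε(S) ≤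
E_ε(f)` for the energy `E_ε(v) = ∫∫ |v(x+y) - v(x)|² K_ε(y)` (`heatEnergy_le_of_subsolution`). On
one side `E_ε(f) ≤ 2ε ‖∇u₀‖₂²`; on the other `2ε ‖∇P_ε S‖₂² ≤ E_ε(S)`, as `∇P_ε S(x)` is the mean of
`(S(x+y) - S(x)) y / 2ε`. The factors `2ε` cancel, `P_ε S → u*` in `L²` as `ε = 2⁻ⁿ → 0`, and a weak
limit of the gradients is the gradient sought.

For `p = ∞` it is enough that averages and suprema preserve the bound `L|y|` on increments.

On the line, subharmonic means convex, and space is discretized instead. For bounded continuous `f`,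
a parabolic maximum principle (`heatFlow_le_affine`) shows that an affine function above `f` on `[a,
b]` and above `u*` at `a` and `b` is above `u*` on `[a, b]`. Hence `u*` lies below its chords on
intervals free of contact points `f = u*`. Given finitely many points, add the nearest contact
points and sum by parts: for every convex `Φ` with minimum `Φ(0) = 0`, a polygonal `Φ`-energy of
`u*` is at most some polygonal `Φ`-energy of `f`
(`ObstacleMaximumPrinciple.exists_polygonalEnergy_le`). The choice `Φ(s) = |s|` gives the total
variation, `Φ(s) = |s|^p` the norm of the derivative, and `Φ(s) = (|s| - k)₊^p` with `k → ∞` the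
uniform integrability of difference quotients, which makes the pointwise derivative of `u*` its weak
derivative even for `p = 1`. Data of bounded variation are first smoothed by the flow.

Membership of `u*` in `L^p`, `1 < p < ∞`, rests on Hopf's maximal ergodic inequality for `P_ε`, in
place of a covering lemma, and the layer cake formula. -/

set_option linter.unusedSectionVars false

/-- The Lebesgue measure of `E` is normalized so that heat kernels have mass one. -/
class HeatNormalized (E : Type*) [NormedAddCommGroup E] [InnerProductSpace ℝ E]
    [MeasureSpace E] : Prop where
  lintegral_heatKernel : ∀ t : ℝ, 0 < t → ∫⁻ x : E, ENNReal.ofReal (heatKernel t x) = 1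

/-! ### The heat kernel: products of Gaussians, comparison of times -/

section HeatKernel

variable {E : Type*} [NormedAddCommGroup E] [InnerProductSpace ℝ E]

theorem heatKernel_pos {t : ℝ} (ht : 0 < t) (x : E) : 0 < heatKernel t x := by
  unfold heatKernel
  positivity

theorem heatKernel_neg (t : ℝ) (x : E) : heatKernel t (-x) = heatKernel t x := by
  simp [heatKernel]

theorem heatKernel_sub_comm (t : ℝ) (x y : E) : heatKernel t (x - y) = heatKernel t (y - x) := by
  rw [← heatKernel_neg, neg_sub]

theorem continuous_heatKernel (t : ℝ) : Continuous (heatKernel t : E → ℝ) := by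
  unfold heatKernel
  fun_prop

theorem continuousAt_heatKernel_time {t : ℝ} (ht : 0 < t) (x : E) :
    ContinuousAt (fun s => heatKernel s x) t := by
  unfold heatKernel
  refine ContinuousAt.mul (ContinuousAt.div continuousAt_const ?_ (by positivity)) ?_
  · exact ContinuousAt.rpow_const (by fun_prop) (Or.inl (by positivity))
  · refine Real.continuous_exp.continuousAt.comp ?_
    exact ContinuousAt.div continuousAt_const (by fun_prop) (by positivity)

theorem measurable_heatKernel [MeasurableSpace E] [BorelSpace E] (t : ℝ) : Measurable (heatKernel t : E → ℝ) :=
  (continuous_heatKernel t).measurable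

/-- Completing the square: in `y` the product is a Gaussian of time `st/(s+t)` centred at
`tx/(s+t)`. Integrating it out leaves `K_{s+t}`, which is the semigroup law. -/
theorem heatKernel_mul_heatKernel {s t : ℝ} (hs : 0 < s) (ht : 0 < t) (x y : E) :
    heatKernel s (x - y) * heatKernel t y =
      heatKernel (s + t) x * heatKernel (s * t / (s + t)) (y - (t / (s + t)) • x) := by
  unfold heatKernel
  have hst : 0 < s + t := by positivity
  have h1 : ((4 * Real.pi * s) ^ ((Module.finrank ℝ E : ℝ) / 2)) *
      ((4 * Real.pi * t) ^ ((Module.finrank ℝ E : ℝ) / 2)) =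
      ((4 * Real.pi * (s + t)) ^ ((Module.finrank ℝ E : ℝ) / 2)) *
      ((4 * Real.pi * (s * t / (s + t))) ^ ((Module.finrank ℝ E : ℝ) / 2)) := by
    rw [← Real.mul_rpow (by positivity) (by positivity),
      ← Real.mul_rpow (by positivity) (by positivity)]
    congr 1
    field_simp
  have h2 : -‖x - y‖ ^ 2 / (4 * s) + -‖y‖ ^ 2 / (4 * t) =
      -‖x‖ ^ 2 / (4 * (s + t)) + -‖y - (t / (s + t)) • x‖ ^ 2 / (4 * (s * t / (s + t))) := by
    rw [norm_sub_sq_real, norm_sub_sq_real, inner_smul_right, norm_smul, real_inner_comm x y,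
      Real.norm_of_nonneg (by positivity)]
    field_simp
    ring
  have h3 := congrArg Real.exp h2
  rw [Real.exp_add, Real.exp_add] at h3
  calc _ = (1 / (((4 * Real.pi * s) ^ ((Module.finrank ℝ E : ℝ) / 2)) *
      ((4 * Real.pi * t) ^ ((Module.finrank ℝ E : ℝ) / 2)))) *
      (Real.exp (-‖x - y‖ ^ 2 / (4 * s)) * Real.exp (-‖y‖ ^ 2 / (4 * t))) := by
        field_simp
    _ = _ := by
        rw [h1, h3]
        field_simp

/-- A longer time only raises the exponential, and the normalizing factor drops by at most `2^(d/2)`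
if the time is at most doubled. This lets later times dominate an earlier one. -/
theorem heatKernel_le_of_le {s t : ℝ} (ht : 0 < t) (hts : t ≤ s) (hst : s ≤ 2 * t) (x : E) :
    heatKernel t x ≤ 2 ^ ((Module.finrank ℝ E : ℝ) / 2) * heatKernel s x := by
  unfold heatKernel
  have hs : 0 < s := ht.trans_le hts
  rw [← mul_assoc]
  refine mul_le_mul ?_ (Real.exp_le_exp.2 ?_) (Real.exp_nonneg _) (by positivity)
  · rw [mul_one_div, div_le_div_iff₀ (by positivity) (by positivity),
      ← Real.mul_rpow (by positivity) (by positivity), one_mul]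
    refine Real.rpow_le_rpow (by positivity) ?_ (by positivity)
    nlinarith [Real.pi_pos]
  · rw [div_le_div_iff₀ (by positivity) (by positivity)]
    nlinarith [sq_nonneg ‖x‖]

variable [MeasureSpace E]

theorem lintegral_heatKernel [HeatNormalized E] {t : ℝ} (ht : 0 < t) :
    ∫⁻ x : E, ENNReal.ofReal (heatKernel t x) = 1 :=
  HeatNormalized.lintegral_heatKernel t ht

variable [BorelSpace E]

end HeatKernel

/-! ### Total mass of the kernel -/

section Normalized

theorem lintegral_heatKernel_of_inner {V : Type*} [NormedAddCommGroup V] [InnerProductSpace ℝ V]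
    [FiniteDimensional ℝ V] [MeasurableSpace V] [BorelSpace V] {t : ℝ} (ht : 0 < t) :
    ∫⁻ x : V, ENNReal.ofReal (heatKernel t x) = 1 := by
  have hb : 0 < 1 / (4 * t) := by positivity
  have h0 : (fun x : V => heatKernel t x) = fun x : V =>
      1 / (4 * Real.pi * t) ^ ((Module.finrank ℝ V : ℝ) / 2) *
        Real.exp (-(1 / (4 * t)) * ‖x‖ ^ 2) := by
    ext x
    rw [heatKernel]
    congr 2
    ring
  have h1 : ∫ x : V, heatKernel t x = 1 := by
    rw [h0, integral_const_mul, GaussianFourier.integral_rexp_neg_mul_sq_norm hb]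
    rw [show Real.pi / (1 / (4 * t)) = 4 * Real.pi * t by field_simp]
    exact one_div_mul_cancel (by positivity)
  -- A non-integrable function has integral `0` by convention, so the value `1` already forces
  -- integrability.
  have h2 : Integrable (fun x : V => heatKernel t x) := by
    by_contra h
    rw [integral_undef h] at h1
    exact zero_ne_one h1
  rw [← ofReal_integral_eq_lintegral_ofReal h2
    (Filter.Eventually.of_forall fun x => (heatKernel_pos ht x).le), h1, ENNReal.ofReal_one]

instance : HeatNormalized ℝ := ⟨fun _ ht => lintegral_heatKernel_of_inner ht⟩

instance (d : ℕ) : HeatNormalized (EuclideanSpace ℝ (Fin d)) :=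
  ⟨fun _ ht => lintegral_heatKernel_of_inner ht⟩

end Normalized

/-! ### The heat semigroup on functions with values in `[0, ∞]` -/

/-- The heat semigroup acting on functions with values in `[0, ∞]`. -/
noncomputable def heatConv {E : Type*} [NormedAddCommGroup E] [InnerProductSpace ℝ E]
    [MeasureSpace E] (t : ℝ) (f : E → ℝ≥0∞) (x : E) : ℝ≥0∞ :=
  ∫⁻ y, f y * ENNReal.ofReal (heatKernel t (x - y))

section HeatConv

variable {E : Type*} [NormedAddCommGroup E] [InnerProductSpace ℝ E] [MeasureSpace E]

theorem heatMaximal_eq (u : E → ℝ) (x : E) :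
    heatMaximal u x = ⨆ (t : ℝ) (_ : 0 < t), heatConv t (fun y => ENNReal.ofReal |u y|) x := rfl

theorem heatConv_mono (t : ℝ) {f g : E → ℝ≥0∞} (h : ∀ y, f y ≤ g y) (x : E) :
    heatConv t f x ≤ heatConv t g x :=
  lintegral_mono fun y => mul_le_mul_left (h y) _

theorem heatConv_congr (t : ℝ) {f g : E → ℝ≥0∞} (h : f =ᵐ[volume] g) (x : E) :
    heatConv t f x = heatConv t g x :=
  lintegral_congr_ae <| by filter_upwards [h] with y hy; rw [hy]

theorem heatMaximal_congr {u v : E → ℝ} (h : u =ᵐ[volume] v) (x : E) :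
    heatMaximal u x = heatMaximal v x := by
  rw [heatMaximal_eq, heatMaximal_eq]
  refine iSup_congr fun t => iSup_congr fun _ => ?_
  exact heatConv_congr t (h.fun_comp fun r => ENNReal.ofReal |r|) x

theorem heatConv_le_of_le {s t : ℝ} (ht : 0 < t) (hts : t ≤ s) (hst : s ≤ 2 * t) (f : E → ℝ≥0∞)
    (x : E) :
    heatConv t f x ≤ ENNReal.ofReal (2 ^ ((Module.finrank ℝ E : ℝ) / 2)) * heatConv s f x := by
  unfold heatConv
  rw [← lintegral_const_mul' _ _ ENNReal.ofReal_ne_top]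
  refine lintegral_mono fun y => ?_
  rw [mul_left_comm, ← ENNReal.ofReal_mul (by positivity)]
  exact mul_le_mul_right (ENNReal.ofReal_le_ofReal (heatKernel_le_of_le ht hts hst _)) _

variable [BorelSpace E] [FiniteDimensional ℝ E]

theorem measurable_ofReal_heatKernel_sub (t : ℝ) :
    Measurable fun p : E × E => ENNReal.ofReal (heatKernel t (p.1 - p.2)) :=
  ((measurable_heatKernel t).comp (measurable_fst.sub measurable_snd)).ennreal_ofReal

theorem measurable_heatConv [SFinite (volume : Measure E)]
    (t : ℝ) {f : E → ℝ≥0∞} (hf : Measurable f) : Measurable (heatConv t f) := by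
  refine Measurable.lintegral_prod_right' (f := fun p : E × E =>
    f p.2 * ENNReal.ofReal (heatKernel t (p.1 - p.2))) ?_
  exact (hf.comp measurable_snd).mul (measurable_ofReal_heatKernel_sub t)

/-- Fatou's lemma. Lower semicontinuity in time is all that is needed to replace the supremum over
all times by one over countable grids. -/
theorem heatConv_le_liminf {t : ℝ} (ht : 0 < t) {f : E → ℝ≥0∞} (hf : Measurable f) (x : E)
    {s : ℕ → ℝ} (hs : Filter.Tendsto s Filter.atTop (nhds t)) :
    heatConv t f x ≤ Filter.liminf (fun n => heatConv (s n) f x) Filter.atTop := by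
  unfold heatConv
  refine le_trans (lintegral_mono fun y => ?_) (lintegral_liminf_le fun n => ?_)
  · have h : Filter.Tendsto (fun n => f y * ENNReal.ofReal (heatKernel (s n) (x - y)))
        Filter.atTop (nhds (f y * ENNReal.ofReal (heatKernel t (x - y)))) := by
      refine ENNReal.Tendsto.const_mul (ENNReal.tendsto_ofReal
        ((continuousAt_heatKernel_time ht (x - y)).tendsto.comp hs)) (Or.inl ?_)
      simpa using heatKernel_pos ht (x - y)
    exact h.liminf_eq.ge
  · exact hf.mul ((measurable_heatKernel _).comp (measurable_const.sub measurable_id)).ennreal_ofReal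

variable [(volume : Measure E).IsAddHaarMeasure] [HeatNormalized E]

theorem lintegral_heatKernel_sub_right {t : ℝ} (ht : 0 < t) (x : E) :
    ∫⁻ y : E, ENNReal.ofReal (heatKernel t (x - y)) = 1 := by
  rw [lintegral_sub_left_eq_self (fun y => ENNReal.ofReal (heatKernel t y)) x,
    lintegral_heatKernel ht]

theorem heatConv_const {t : ℝ} (ht : 0 < t) (c : ℝ≥0∞) (x : E) :
    heatConv t (fun _ => c) x = c := by
  unfold heatConv
  rw [lintegral_const_mul, lintegral_heatKernel_sub_right ht, mul_one]
  exact ((measurable_heatKernel _).comp (measurable_const.sub measurable_id)).ennreal_ofReal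

theorem heatConv_eq_lintegral_translate (t : ℝ) (f : E → ℝ≥0∞) (x : E) :
    heatConv t f x = ∫⁻ y, f (x + y) * ENNReal.ofReal (heatKernel t y) := by
  unfold heatConv
  rw [← lintegral_add_left_eq_self _ x]
  refine lintegral_congr fun y => ?_
  rw [sub_add_cancel_left, heatKernel_neg]

theorem heatConv_add (t : ℝ) {f : E → ℝ≥0∞} (hf : Measurable f) (g : E → ℝ≥0∞) (x : E) :
    heatConv t (fun y => f y + g y) x = heatConv t f x + heatConv t g x := by
  unfold heatConv
  simp only [add_mul]
  refine lintegral_add_left (hf.mul ?_) _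
  exact ((measurable_heatKernel _).comp (measurable_const.sub measurable_id)).ennreal_ofReal

theorem lintegral_heatConv {t : ℝ} (ht : 0 < t) {f : E → ℝ≥0∞} (hf : Measurable f) :
    ∫⁻ x, heatConv t f x = ∫⁻ x, f x := by
  unfold heatConv
  rw [lintegral_lintegral_swap
    ((hf.comp measurable_snd).mul (measurable_ofReal_heatKernel_sub t)).aemeasurable]
  refine lintegral_congr fun y => ?_
  rw [lintegral_const_mul]
  · have h (x : E) : heatKernel t (x - y) = heatKernel t (y - x) := heatKernel_sub_comm t x y
    simp only [h]
    rw [lintegral_heatKernel_sub_right ht, mul_one]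
  · exact ((measurable_heatKernel _).comp (measurable_id.sub measurable_const)).ennreal_ofReal

theorem heatConv_heatConv {s t : ℝ} (hs : 0 < s) (ht : 0 < t) {f : E → ℝ≥0∞} (hf : Measurable f)
    (x : E) : heatConv s (heatConv t f) x = heatConv (s + t) f x := by
  unfold heatConv
  have hm (r : ℝ) (z : E) : Measurable fun y : E => ENNReal.ofReal (heatKernel r (z - y)) :=
    ((measurable_heatKernel _).comp (measurable_const.sub measurable_id)).ennreal_ofReal
  have h1 (y : E) : (∫⁻ z, f z * ENNReal.ofReal (heatKernel t (y - z))) *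
      ENNReal.ofReal (heatKernel s (x - y)) = ∫⁻ z, f z * ENNReal.ofReal (heatKernel t (y - z)) *
      ENNReal.ofReal (heatKernel s (x - y)) :=
    (lintegral_mul_const _ (hf.mul (hm t y))).symm
  simp only [h1]
  rw [lintegral_lintegral_swap]
  · refine lintegral_congr fun z => ?_
    simp only [mul_assoc]
    have h2 (y : E) : ENNReal.ofReal (heatKernel t (y - z)) * ENNReal.ofReal (heatKernel s (x - y)) =
        ENNReal.ofReal (heatKernel (s + t) (x - z)) * ENNReal.ofReal (heatKernel (s * t / (s + t))
          (y - (z + (t / (s + t)) • (x - z)))) := by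
      rw [← ENNReal.ofReal_mul (heatKernel_pos ht _).le,
        ← ENNReal.ofReal_mul (heatKernel_pos (add_pos hs ht) _).le, mul_comm (heatKernel t _)]
      have := heatKernel_mul_heatKernel hs ht (x - z) (y - z)
      rw [sub_sub_sub_cancel_right] at this
      rw [this, sub_sub]
    simp only [h2]
    rw [lintegral_const_mul, lintegral_const_mul]
    · congr 1
      simp only [fun y : E => heatKernel_sub_comm (s * t / (s + t)) y
        (z + (t / (s + t)) • (x - z))]
      rw [lintegral_heatKernel_sub_right (by positivity), mul_one]
    · exact ((measurable_heatKernel _).comp (measurable_id.sub measurable_const)).ennreal_ofReal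
    · exact (((measurable_heatKernel _).comp
        (measurable_id.sub measurable_const)).ennreal_ofReal).const_mul _
  · refine Measurable.aemeasurable ?_
    refine Measurable.mul ((hf.comp measurable_snd).mul ?_) ?_
    · exact measurable_ofReal_heatKernel_sub t
    · exact ((hm s x).comp measurable_fst)

end HeatConv

/-! ### Maximal inequalities: dyadic time grids, Hopf's inequality, `L^p` bounds -/

section Maximal

variable {E : Type*} [NormedAddCommGroup E] [InnerProductSpace ℝ E] [MeasureSpace E]
  [BorelSpace E] [FiniteDimensional ℝ E]

/-- The supremum of the heat flow over the positive multiples of `ε`. -/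
noncomputable def gridMaximal (ε : ℝ) (f : E → ℝ≥0∞) (x : E) : ℝ≥0∞ :=
  ⨆ k : ℕ, heatConv ((k + 1) * ε) f x

/-- The dyadic time step `2⁻ⁿ`. -/
noncomputable def dyadicStep (n : ℕ) : ℝ := (1 / 2) ^ n

theorem dyadicStep_pos (n : ℕ) : 0 < dyadicStep n := by
  unfold dyadicStep; positivity

theorem tendsto_dyadicStep : Filter.Tendsto dyadicStep Filter.atTop (nhds 0) :=
  tendsto_pow_atTop_nhds_zero_of_lt_one (by norm_num) (by norm_num)

theorem iSup_heatConv_eq_iSup_gridMaximal {f : E → ℝ≥0∞} (hf : Measurable f) (x : E) :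
    ⨆ (t : ℝ) (_ : 0 < t), heatConv t f x = ⨆ n, gridMaximal (dyadicStep n) f x := by
  refine le_antisymm (iSup₂_le fun t ht => ?_) (iSup_le fun n => iSup_le fun k => ?_)
  -- The first multiple of the step strictly above `t`: a positive grid time, within one step of
  -- `t`.
  · set s : ℕ → ℝ := fun n => (⌊t / dyadicStep n⌋₊ + 1) * dyadicStep n with hs
    have hlim : Filter.Tendsto s Filter.atTop (nhds t) := by
      have h1 (n : ℕ) : t ≤ s n := by
        have := (Nat.lt_floor_add_one (t / dyadicStep n)).le
        rwa [div_le_iff₀ (dyadicStep_pos n)] at this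
      have h2 (n : ℕ) : s n ≤ t + dyadicStep n := by
        have := Nat.floor_le (a := t / dyadicStep n) (by have := dyadicStep_pos n; positivity)
        rw [le_div_iff₀ (dyadicStep_pos n)] at this
        simp only [hs, add_mul, one_mul]
        linarith
      refine tendsto_of_tendsto_of_tendsto_of_le_of_le tendsto_const_nhds ?_ h1 h2
      simpa using tendsto_dyadicStep.const_add t
    refine (heatConv_le_liminf ht hf x hlim).trans ?_
    refine Filter.liminf_le_of_le (by isBoundedDefault) fun b hb => ?_
    obtain ⟨n, hn⟩ := hb.exists
    exact hn.trans ((le_iSup (fun k : ℕ => heatConv ((k + 1) * dyadicStep n) f x) _).trans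
      (le_iSup (fun n => gridMaximal (dyadicStep n) f x) n))
  · exact le_iSup₂ (f := fun (t : ℝ) (_ : 0 < t) => heatConv t f x) _
      (mul_pos (by positivity) (dyadicStep_pos n))

theorem monotone_gridMaximal_dyadicStep (f : E → ℝ≥0∞) (x : E) :
    Monotone fun n => gridMaximal (dyadicStep n) f x := by
  refine monotone_nat_of_le_succ fun n => iSup_le fun k => ?_
  have h : ((k : ℝ) + 1) * dyadicStep n = (((2 * k + 1 : ℕ) : ℝ) + 1) * dyadicStep (n + 1) := by
    unfold dyadicStep
    push_cast
    ring
  rw [h]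
  exact le_iSup (fun k : ℕ => heatConv ((k + 1) * dyadicStep (n + 1)) f x) (2 * k + 1)

theorem heatMaximal_eq_iSup_gridMaximal {u : E → ℝ} (hu : Measurable u) (x : E) :
    heatMaximal u x = ⨆ n, gridMaximal (dyadicStep n) (fun y => ENNReal.ofReal |u y|) x :=
  iSup_heatConv_eq_iSup_gridMaximal (hu.abs.ennreal_ofReal) x

/-- Excess over level `a` of the best partial sum of length at most `n` of the heat flow with time
step `ε`. -/
noncomputable def hopfExcess (ε : ℝ) (f : E → ℝ≥0∞) (a : ℝ≥0∞) : ℕ → E → ℝ≥0∞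
  | 0, _ => 0
  | n + 1, x => (f x + heatConv ε (hopfExcess ε f a n) x) - a

/-- Partial sums `∑_{k < n} P^k f` of the heat flow with time step `ε`. -/
noncomputable def heatSum (ε : ℝ) (f : E → ℝ≥0∞) : ℕ → E → ℝ≥0∞
  | 0, _ => 0
  | n + 1, x => f x + heatConv ε (heatSum ε f n) x

theorem monotone_hopfExcess (ε : ℝ) (f : E → ℝ≥0∞) (a : ℝ≥0∞) (x : E) :
    Monotone fun n => hopfExcess ε f a n x := by
  refine monotone_nat_of_le_succ fun n => ?_
  induction n generalizing x with
  | zero => exact bot_le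
  | succ n ih => exact tsub_le_tsub_right (add_le_add_right (heatConv_mono ε ih x) _) _

variable [(volume : Measure E).IsAddHaarMeasure] [HeatNormalized E]

theorem measurable_gridMaximal (ε : ℝ) {f : E → ℝ≥0∞} (hf : Measurable f) :
    Measurable (gridMaximal ε f) :=
  Measurable.iSup fun _ => measurable_heatConv _ hf

theorem measurable_heatMaximal {u : E → ℝ} (hu : Measurable u) : Measurable (heatMaximal u) := by
  rw [show heatMaximal u = fun x => ⨆ n, gridMaximal (dyadicStep n)
    (fun y => ENNReal.ofReal |u y|) x from funext (heatMaximal_eq_iSup_gridMaximal hu)]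
  exact Measurable.iSup fun n => measurable_gridMaximal _ hu.abs.ennreal_ofReal

theorem measurable_hopfExcess (ε : ℝ) {f : E → ℝ≥0∞} (hf : Measurable f) (a : ℝ≥0∞) (n : ℕ) :
    Measurable (hopfExcess ε f a n) := by
  induction n with
  | zero => exact measurable_const
  | succ n ih => exact (hf.add (measurable_heatConv ε ih)).sub measurable_const

/-- Heat means fix constants, so each step of the recursion pulls out one more copy of `a`. Where
the excess vanishes, averages of `n` terms are thus at most `a`. -/
theorem heatSum_le_hopfExcess_add {ε : ℝ} (hε : 0 < ε) {f : E → ℝ≥0∞} (hf : Measurable f)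
    (a : ℝ≥0∞) (n : ℕ) (x : E) : heatSum ε f n x ≤ hopfExcess ε f a n x + n * a := by
  induction n generalizing x with
  | zero => simp [heatSum, hopfExcess]
  | succ n ih =>
    calc heatSum ε f (n + 1) x ≤ f x + heatConv ε (fun y => hopfExcess ε f a n y + n * a) x :=
          add_le_add_right (heatConv_mono ε ih x) _
      _ = (f x + heatConv ε (hopfExcess ε f a n) x) + n * a := by
          rw [heatConv_add ε (measurable_hopfExcess ε hf a n), heatConv_const hε, add_assoc]
      _ ≤ (hopfExcess ε f a (n + 1) x + a) + n * a := by
          refine add_le_add_left ?_ _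
          exact le_tsub_add (α := ℝ≥0∞)
      _ = _ := by push_cast; ring

theorem heatSum_succ_eq {ε : ℝ} (hε : 0 < ε) {f : E → ℝ≥0∞} (hf : Measurable f) (n : ℕ) (x : E) :
    heatSum ε f (n + 1) x = f x + ∑ k ∈ Finset.range n, heatConv ((k + 1) * ε) f x := by
  have hsum : ∀ (m : ℕ) (x : E),
      heatConv ε (fun y => ∑ k ∈ Finset.range m, heatConv ((k + 1) * ε) f y) x =
        ∑ k ∈ Finset.range m, heatConv ((k + 1 + 1) * ε) f x := by
    intro m x
    induction m with
    | zero => simp [heatConv]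
    | succ m ih =>
      simp only [Finset.sum_range_succ]
      rw [heatConv_add ε (Finset.measurable_fun_sum _ fun k _ => measurable_heatConv _ hf), ih,
        heatConv_heatConv hε (by positivity) hf, show ε + ((m : ℝ) + 1) * ε = ((m : ℝ) + 1 + 1) * ε by ring]
  induction n generalizing x with
  | zero => simp [heatSum, heatConv]
  | succ n ih =>
    rw [heatSum, funext ih, heatConv_add ε hf, hsum, Finset.sum_range_succ']
    push_cast
    rw [add_comm (heatConv ε f x)]
    simp

/-- Hopf's maximal ergodic inequality, by Garsia's argument. On the set `A` where the excess `H` is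
positive, the recursion and monotonicity in `n` give `H + a ≤ f + PH`; integrate over `A`, use that
`P` preserves integrals, and cancel the finite quantity `∫ H`. -/
theorem mul_measure_hopfExcess_le {ε : ℝ} (hε : 0 < ε) {f : E → ℝ≥0∞} (hf : Measurable f)
    (hfi : ∫⁻ x, f x ≠ ⊤) (a : ℝ≥0∞) (n : ℕ) :
    a * volume {x | 0 < hopfExcess ε f a n x} ≤ ∫⁻ x, f x := by
  have hfin (n : ℕ) : ∫⁻ x, hopfExcess ε f a n x ≠ ⊤ := by
    induction n with
    | zero => simp [hopfExcess]
    | succ n ih =>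
      have h : ∫⁻ x, hopfExcess ε f a (n + 1) x ≤
          ∫⁻ x, (f x + heatConv ε (hopfExcess ε f a n) x) :=
        lintegral_mono fun x => tsub_le_self
      rw [lintegral_add_left hf, lintegral_heatConv hε (measurable_hopfExcess ε hf a n)] at h
      exact ne_top_of_le_ne_top (ENNReal.add_ne_top.2 ⟨hfi, ih⟩) h
  cases n with
  | zero => simp [hopfExcess]
  | succ n =>
    set H := hopfExcess ε f a (n + 1) with hH
    have hHm : Measurable H := measurable_hopfExcess ε hf a _
    set A := {x | 0 < H x} with hA
    have hAm : MeasurableSet A := measurableSet_lt measurable_const hHm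
    have hint : ∫⁻ x in A, H x = ∫⁻ x, H x := by
      rw [← lintegral_indicator hAm]
      refine lintegral_congr fun x => ?_
      by_cases hx : x ∈ A
      · simp [hx]
      · have : H x = 0 := by simpa [hA] using hx
        simp [hx, this]
    have hpt : ∀ x ∈ A, H x + a ≤ f x + heatConv ε H x := by
      intro x hx
      have hx' : 0 < (f x + heatConv ε (hopfExcess ε f a n) x) - a := hx
      have hle : a ≤ f x + heatConv ε (hopfExcess ε f a n) x := (tsub_pos_iff_lt.1 hx').le
      calc H x + a = f x + heatConv ε (hopfExcess ε f a n) x := tsub_add_cancel_of_le hle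
        _ ≤ _ := add_le_add_right (heatConv_mono ε
            (fun y => monotone_hopfExcess ε f a y n.le_succ) x) _
    have h1 : ∫⁻ x in A, (H x + a) ≤ ∫⁻ x in A, (f x + heatConv ε H x) :=
      setLIntegral_mono (hf.add (measurable_heatConv ε hHm)) hpt
    rw [lintegral_add_left hHm, lintegral_add_left hf, setLIntegral_const, hint] at h1
    have h2 : ∫⁻ x in A, heatConv ε H x ≤ ∫⁻ x, H x :=
      (setLIntegral_le_lintegral _ _).trans (lintegral_heatConv hε hHm).le
    have h3 : ∫⁻ x in A, f x ≤ ∫⁻ x, f x := setLIntegral_le_lintegral _ _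
    have h4 : (∫⁻ x, H x) + a * volume A ≤ (∫⁻ x, H x) + ∫⁻ x, f x :=
      h1.trans (by rw [add_comm]; exact add_le_add h2 h3)
    exact (ENNReal.add_le_add_iff_left (hfin (n + 1))).1 h4

/-- The constant in the weak type estimate for the heat maximal function in dimension `d`. -/
noncomputable def weakConst (E : Type*) [NormedAddCommGroup E] [InnerProductSpace ℝ E] : ℝ :=
  2 * 2 ^ ((Module.finrank ℝ E : ℝ) / 2) + 1

theorem weakConst_pos : 0 < weakConst E := by unfold weakConst; positivity

/-- The `k + 1` times from `(k+1)ε` to `(2k+1)ε` are at most twice `(k+1)ε`, so each of their heat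
means dominates the one at `(k+1)ε` up to `2^(d/2)`. A single mean is thereby controlled by a Cesàro
average. -/
theorem heatConv_mul_le_heatSum {ε : ℝ} (hε : 0 < ε) {f : E → ℝ≥0∞} (hf : Measurable f) (k : ℕ)
    (x : E) : ((k + 1 : ℕ) : ℝ≥0∞) * heatConv ((k + 1) * ε) f x ≤
      ENNReal.ofReal (2 ^ ((Module.finrank ℝ E : ℝ) / 2)) * heatSum ε f (2 * (k + 1)) x := by
  have h1 : ((k + 1 : ℕ) : ℝ≥0∞) * heatConv ((k + 1) * ε) f x =
      ∑ j ∈ Finset.range (k + 1), heatConv ((k + 1) * ε) f x := by simp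
  rw [h1, show 2 * (k + 1) = (2 * k + 1) + 1 by ring, heatSum_succ_eq hε hf]
  refine (Finset.sum_le_sum (g := fun j => ENNReal.ofReal (2 ^ ((Module.finrank ℝ E : ℝ) / 2)) *
    heatConv (((k + j : ℕ) + 1) * ε) f x) fun j hj => ?_).trans ?_
  · have hj' : (j : ℝ) ≤ k := by
      have := Finset.mem_range.1 hj
      exact_mod_cast Nat.lt_succ_iff.1 this
    refine heatConv_le_of_le (by positivity) ?_ ?_ f x
    · push_cast
      gcongr
      linarith [(Nat.cast_nonneg j : (0 : ℝ) ≤ j)]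
    · push_cast
      rw [← mul_assoc]
      gcongr
      linarith
  · rw [← Finset.mul_sum]
    gcongr
    refine le_trans ?_ (le_add_self (α := ℝ≥0∞))
    rw [show 2 * k + 1 = k + (k + 1) by ring, Finset.sum_range_add _ k (k + 1)]
    refine le_trans (le_of_eq ?_) (le_add_self (α := ℝ≥0∞))
    rfl

/-- Hopf's inequality is applied to the part `g` of `f` above level `a`, which localizes the
right-hand side. Where all excesses of `g` vanish, the heat means of `g` are at most `2 · 2^(d/2)
a`, and the rest of `f` contributes at most `a`; this is the origin of `weakConst`. -/
theorem mul_measure_gridMaximal_le {ε : ℝ} (hε : 0 < ε) {f : E → ℝ≥0∞} (hf : Measurable f)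
    (a : ℝ≥0∞) :
    a * volume {x | ENNReal.ofReal (weakConst E) * a < gridMaximal ε f x} ≤
      ∫⁻ x in {x | a < f x}, f x := by
  by_cases hfin : ∫⁻ x in {x | a < f x}, f x = ⊤
  · rw [hfin]; exact le_top
  have hm : MeasurableSet {x | a < f x} := measurableSet_lt measurable_const hf
  set g : E → ℝ≥0∞ := {x | a < f x}.indicator f with hg
  have hgm : Measurable g := hf.indicator hm
  have hgi : ∫⁻ x, g x = ∫⁻ x in {x | a < f x}, f x := lintegral_indicator hm _
  have hfg : ∀ x, f x ≤ g x + a := by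
    intro x
    by_cases hx : a < f x
    · rw [hg, Set.indicator_of_mem (by exact hx)]
      exact le_self_add
    · exact (not_lt.1 hx).trans le_add_self
  have hsub : {x | ENNReal.ofReal (weakConst E) * a < gridMaximal ε f x} ⊆
      ⋃ n, {x | 0 < hopfExcess ε g a n x} := by
    intro x hx
    have hx' : ENNReal.ofReal (weakConst E) * a <
        ⨆ k : ℕ, heatConv (((k : ℝ) + 1) * ε) f x := hx
    obtain ⟨k, hk⟩ := lt_iSup_iff.1 hx'
    by_contra hcon
    simp only [Set.mem_iUnion, not_exists, Set.mem_ofPred_eq, not_lt, nonpos_iff_eq_zero] at hcon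
    refine absurd hk (not_lt.2 ?_)
    have h1 : heatConv ((k + 1) * ε) f x ≤ heatConv ((k + 1) * ε) g x + a := by
      refine (heatConv_mono _ hfg x).trans ?_
      rw [heatConv_add _ hgm, heatConv_const (by positivity)]
    have h2 := heatSum_le_hopfExcess_add hε hgm a (2 * (k + 1)) x
    rw [hcon, zero_add] at h2
    have h3 := (heatConv_mul_le_heatSum hε hgm k x).trans (mul_le_mul_right h2 _)
    have h4 : heatConv ((k + 1) * ε) g x ≤
        2 * ENNReal.ofReal (2 ^ ((Module.finrank ℝ E : ℝ) / 2)) * a := by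
      have hne : ((k + 1 : ℕ) : ℝ≥0∞) ≠ 0 := by simp
      refine (ENNReal.mul_le_mul_iff_right hne (ENNReal.natCast_ne_top _)).1 (h3.trans (le_of_eq ?_))
      push_cast
      ring
    refine h1.trans ((add_le_add_left h4 a).trans (le_of_eq ?_))
    rw [weakConst, ENNReal.ofReal_add (by positivity) zero_le_one, ENNReal.ofReal_mul zero_le_two]
    simp [add_mul]
  refine (mul_le_mul_right (measure_mono hsub) a).trans ?_
  have hmono : Monotone fun n => {x | 0 < hopfExcess ε g a n x} := fun m n hmn x hx =>
    lt_of_lt_of_le (show 0 < hopfExcess ε g a m x from hx) (monotone_hopfExcess ε g a x hmn)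
  rw [hmono.measure_iUnion, ENNReal.mul_iSup]
  exact iSup_le fun n => hgi ▸ mul_measure_hopfExcess_le hε hgm (hgi ▸ hfin) a n

theorem mul_measure_heatMaximal_le {u : E → ℝ} (hu : Measurable u) (a : ℝ≥0∞) :
    a * volume {x | ENNReal.ofReal (weakConst E) * a < heatMaximal u x} ≤
      ∫⁻ x in {x | a < ENNReal.ofReal |u x|}, ENNReal.ofReal |u x| := by
  have h : {x | ENNReal.ofReal (weakConst E) * a < heatMaximal u x} = ⋃ n,
      {x | ENNReal.ofReal (weakConst E) * a <
        gridMaximal (dyadicStep n) (fun y => ENNReal.ofReal |u y|) x} := by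
    ext x
    simp [heatMaximal_eq_iSup_gridMaximal hu, lt_iSup_iff]
  have hmono : Monotone fun n => {x | ENNReal.ofReal (weakConst E) * a <
      gridMaximal (dyadicStep n) (fun y => ENNReal.ofReal |u y|) x} := fun m n hmn x hx =>
    lt_of_lt_of_le (show _ < gridMaximal (dyadicStep m) _ x from hx)
      (monotone_gridMaximal_dyadicStep _ x hmn)
  rw [h, hmono.measure_iUnion, ENNReal.mul_iSup]
  exact iSup_le fun n => mul_measure_gridMaximal_le (dyadicStep_pos n) hu.abs.ennreal_ofReal a

theorem heatMaximal_lt_top_ae {u : E → ℝ} (hu : Measurable u) {p : ℝ} (hp : 1 < p)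
    (hup : ∫⁻ x, ENNReal.ofReal (|u x| ^ p) ≠ ⊤) : ∀ᵐ x, heatMaximal u x < ⊤ := by
  have hz : volume {x : E | heatMaximal u x = ⊤} = 0 := by
    by_contra hne
    obtain ⟨n, hn⟩ := ENNReal.exists_nat_mul_gt hne hup
    refine absurd hn (not_lt.2 ?_)
    rcases Nat.eq_zero_or_pos n with rfl | hn0
    · simp
    have hn1 : (1 : ℝ) ≤ n := by exact_mod_cast hn0
    -- The weak type bound at level `n` is uniform in `n`, since `|u| ≤ |u|^p` where `|u| > n ≥ 1`.
    -- A set of positive measure would violate it for large `n`.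
    have h1 : (n : ℝ≥0∞) * volume {x : E | heatMaximal u x = ⊤} ≤
        ∫⁻ x in {x | (n : ℝ≥0∞) < ENNReal.ofReal |u x|}, ENNReal.ofReal |u x| := by
      refine le_trans ?_ (mul_measure_heatMaximal_le hu n)
      refine mul_le_mul_right (measure_mono fun x (hx : _ = ⊤) => ?_) _
      rw [Set.mem_ofPred_eq, hx]
      exact ENNReal.mul_lt_top ENNReal.ofReal_lt_top (ENNReal.natCast_lt_top n)
    refine h1.trans (le_trans (setLIntegral_mono ?_ fun x hx => ?_)
      (setLIntegral_le_lintegral _ _))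
    · exact (hu.abs.pow_const p).ennreal_ofReal
    · refine ENNReal.ofReal_le_ofReal ?_
      have h2 : (n : ℝ) < |u x| := by
        rw [Set.mem_ofPred_eq, ← ENNReal.ofReal_natCast] at hx
        exact (ENNReal.ofReal_lt_ofReal_iff_of_nonneg (by positivity)).1 hx
      exact Real.self_le_rpow_of_one_le (hn1.trans h2.le) hp.le
  rw [ae_iff]
  simpa using hz

/-- Marcinkiewicz interpolation against the measure `ν = |u| dx`: for `v = u*/C` the weak type bound
reads `t |{v > t}| ≤ ν{|u| > t}`, and multiplying by `t^(p-2)` and integrating turns both sides into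
`p`-th moments by the layer cake formula. -/
theorem lintegral_heatMaximal_rpow_lt_top {u : E → ℝ} (hu : Measurable u) {p : ℝ} (hp : 1 < p)
    (hup : ∫⁻ x, ENNReal.ofReal (|u x| ^ p) ≠ ⊤) :
    ∫⁻ x, ENNReal.ofReal ((heatMaximal u x).toReal ^ p) < ⊤ := by
  have hC := weakConst_pos (E := E)
  set C := weakConst E
  set v : E → ℝ := fun x => (heatMaximal u x).toReal / C with hv
  have hvm : Measurable v := (measurable_heatMaximal hu).ennreal_toReal.div_const C
  have hv0 : ∀ x, 0 ≤ v x := fun x => by positivity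
  set ν : Measure E := volume.withDensity fun x => ENNReal.ofReal |u x| with hν
  have hum : Measurable fun x => ENNReal.ofReal |u x| := hu.abs.ennreal_ofReal
  have hweak : ∀ t : ℝ, 0 < t → ENNReal.ofReal t * volume {x | t < v x} ≤ ν {x | t < |u x|} := by
    intro t ht
    rw [hν, withDensity_apply _ (measurableSet_lt measurable_const hu.abs)]
    have h1 := mul_measure_heatMaximal_le hu (ENNReal.ofReal t)
    simp only [ENNReal.ofReal_lt_ofReal_iff_of_nonneg ht.le] at h1
    refine le_trans (mul_le_mul_right (measure_mono fun x (hx : t < v x) => ?_) _) h1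
    rw [Set.mem_ofPred_eq, ← ENNReal.ofReal_mul hC.le]
    rw [hv, lt_div_iff₀ hC, mul_comm] at hx
    -- Points with `u* = ∞` have real value `0` by convention, hence do not lie above the level `t >
    -- 0`.
    exact (ENNReal.ofReal_lt_iff_lt_toReal (by positivity) (fun h => by
      rw [h, ENNReal.toReal_top] at hx; exact absurd hx (not_lt.2 (by positivity)))).2 hx
  have hlayer := lintegral_rpow_eq_lintegral_meas_lt_mul volume
    (Filter.Eventually.of_forall hv0) hvm.aemeasurable (zero_lt_one.trans hp)
  have hlayer' := lintegral_rpow_eq_lintegral_meas_lt_mul ν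
    (Filter.Eventually.of_forall fun x => abs_nonneg (u x)) hu.abs.aemeasurable (sub_pos.2 hp)
  have hνint : ∫⁻ x, ENNReal.ofReal (|u x| ^ (p - 1)) ∂ν = ∫⁻ x, ENNReal.ofReal (|u x| ^ p) := by
    rw [hν, lintegral_withDensity_eq_lintegral_mul _ hum (hu.abs.pow_const _).ennreal_ofReal]
    refine lintegral_congr fun x => ?_
    rw [Pi.mul_apply, ← ENNReal.ofReal_mul (abs_nonneg _)]
    congr 1
    rw [← Real.rpow_one_add' (abs_nonneg _) (by linarith)]
    congr 1
    ring
  have hI : ∫⁻ t in Set.Ioi (0 : ℝ), ν {x | t < |u x|} * ENNReal.ofReal (t ^ (p - 1 - 1)) ≠ ⊤ := by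
    intro h
    rw [h, ENNReal.mul_top (by simpa using hp), hνint] at hlayer'
    exact hup hlayer'
  have hvfin : ∫⁻ x, ENNReal.ofReal (v x ^ p) < ⊤ := by
    rw [hlayer]
    refine ENNReal.mul_lt_top ENNReal.ofReal_lt_top (lt_of_le_of_lt ?_ hI.lt_top)
    refine setLIntegral_mono' measurableSet_Ioi fun t (ht : 0 < t) => ?_
    have h1 : ENNReal.ofReal (t ^ (p - 1)) = ENNReal.ofReal t * ENNReal.ofReal (t ^ (p - 1 - 1)) := by
      rw [← ENNReal.ofReal_mul ht.le]
      congr 1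
      rw [← Real.rpow_one_add' ht.le (by linarith)]
      congr 1
      ring
    rw [h1, ← mul_assoc, mul_comm (volume _)]
    exact mul_le_mul_left (hweak t ht) _
  have hscale : ∀ x, ENNReal.ofReal ((heatMaximal u x).toReal ^ p) =
      ENNReal.ofReal (C ^ p) * ENNReal.ofReal (v x ^ p) := by
    intro x
    rw [← ENNReal.ofReal_mul (by positivity), ← Real.mul_rpow hC.le (hv0 x)]
    congr 2
    rw [hv]
    field_simp
  simp only [hscale]
  rw [lintegral_const_mul _ (hvm.pow_const p).ennreal_ofReal]
  exact ENNReal.mul_lt_top ENNReal.ofReal_lt_top hvfin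

end Maximal

/-! ### Weak gradients, segment averages and the Lipschitz case -/

section WeakGradient

variable {E : Type*} [NormedAddCommGroup E] [InnerProductSpace ℝ E] [MeasureSpace E]

theorem IsWeakGradient.congr {u u' : E → ℝ} {g g' : E → E} (h : IsWeakGradient u g)
    (hu : u =ᵐ[volume] u') (hg : g =ᵐ[volume] g') : IsWeakGradient u' g' := by
  refine ⟨h.1.congr hu, h.2.1.congr hg, fun φ hφ hc v => ?_⟩
  have h1 : ∫ x, u' x * fderiv ℝ φ x v = ∫ x, u x * fderiv ℝ φ x v :=
    integral_congr_ae (by filter_upwards [hu] with x hx; rw [hx])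
  have h2 : ∫ x, inner ℝ (g' x) v * φ x = ∫ x, inner ℝ (g x) v * φ x :=
    integral_congr_ae (by filter_upwards [hg] with x hx; rw [hx])
  rw [h1, h2, h.2.2 φ hφ hc v]

variable [BorelSpace E] [FiniteDimensional ℝ E]

theorem IsWeakGradient.ae_unique {u : E → ℝ} {g g' : E → E} (h : IsWeakGradient u g)
    (h' : IsWeakGradient u g') : g =ᵐ[volume] g' := by
  refine ae_eq_of_integral_contDiff_smul_eq h.2.1 h'.2.1 fun φ hφ hc => ?_
  refine ext_inner_right ℝ fun v => ?_
  have key (g : E → E) (hg : LocallyIntegrable g) :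
      inner ℝ (∫ x, φ x • g x) v = ∫ x, inner ℝ (g x) v * φ x := by
    rw [real_inner_comm, ← integral_inner
      (hg.integrable_smul_left_of_hasCompactSupport hφ.continuous hc)]
    refine integral_congr_ae (Filter.Eventually.of_forall fun x => ?_)
    simp only [inner_smul_right, real_inner_comm v (g x)]
    ring
  rw [key g h.2.1, key g' h'.2.1]
  have h1 := h.2.2 φ hφ hc v
  rw [h'.2.2 φ hφ hc v] at h1
  linarith

variable [(volume : Measure E).IsAddHaarMeasure]

theorem _root_.LipschitzWith.isWeakGradient_gradient {L : NNReal} {u : E → ℝ}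
    (hu : LipschitzWith L u) : IsWeakGradient u (gradient u) := by
  have hnorm (x : E) : ‖gradient u x‖ ≤ L := by
    rw [gradient, LinearIsometryEquiv.norm_map]
    exact norm_fderiv_le_of_lipschitz ℝ hu
  have hmeas : AEStronglyMeasurable (gradient u) := by
    refine Continuous.comp_aestronglyMeasurable
      (g := fun z => (InnerProductSpace.toDual ℝ E).symm z) ?_ ?_
    · exact LinearIsometryEquiv.continuous _
    · exact (measurable_fderiv ℝ u).stronglyMeasurable.aestronglyMeasurable
  have hmem : MemLp (gradient u) ⊤ := memLp_top_of_bound hmeas L (Filter.Eventually.of_forall hnorm)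
  refine ⟨hu.continuous.locallyIntegrable, hmem.locallyIntegrable le_top, fun φ hφ hc v => ?_⟩
  obtain ⟨D, hD⟩ := hφ.lipschitzWith_of_hasCompactSupport hc (by simp)
  have h1 := hu.integral_lineDeriv_mul_eq (μ := volume) hD hc v
  have h2 : ∫ x, lineDeriv ℝ u x v * φ x = ∫ x, inner ℝ (gradient u x) v * φ x := by
    refine integral_congr_ae ?_
    filter_upwards [hu.ae_differentiableAt (μ := volume)] with x hx
    rw [hx.lineDeriv_eq_fderiv, gradient, InnerProductSpace.toDual_symm_apply]
  have h3 : ∫ x, lineDeriv ℝ φ x (-v) * u x = - ∫ x, u x * fderiv ℝ φ x v := by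
    rw [← integral_neg]
    refine integral_congr_ae (Filter.Eventually.of_forall fun x => ?_)
    simp only
    rw [(hφ.differentiable (by simp)).differentiableAt.lineDeriv_eq_fderiv, map_neg]
    ring
  rw [h2, h3] at h1
  linarith

theorem _root_.LipschitzWith.norm_gradient_le {L : NNReal} {u : E → ℝ} (hu : LipschitzWith L u)
    (x : E) : ‖gradient u x‖ ≤ L := by
  rw [gradient, LinearIsometryEquiv.norm_map]
  exact norm_fderiv_le_of_lipschitz ℝ hu

/-- The shear `(s, x) ↦ x + s y` preserves measure when restricted to unit time. -/
theorem measurePreserving_shear (y : E) :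
    MeasurePreserving (fun p : ℝ × E => (p.1, p.2 + p.1 • y))
      ((volume.restrict (Set.Ioc (0 : ℝ) 1)).prod volume)
      ((volume.restrict (Set.Ioc (0 : ℝ) 1)).prod volume) := by
  refine MeasurePreserving.skew_product (g := fun (s : ℝ) (x : E) => x + s • y)
    (MeasurePreserving.id _) ?_ (Filter.Eventually.of_forall fun s => ?_)
  · exact measurable_snd.add (measurable_fst.smul_const y)
  · exact (measurePreserving_add_right volume (s • y)).map_eq

theorem Integrable.comp_shear {F : Type*} [NormedAddCommGroup F] {h : E → F} (hh : Integrable h)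
    (y : E) : Integrable (fun p : ℝ × E => h (p.2 + p.1 • y))
      ((volume.restrict (Set.Ioc (0 : ℝ) 1)).prod volume) :=
  (measurePreserving_shear y).integrable_comp_of_integrable (hh.comp_snd _)

theorem isCompact_shear_image {K : Set E} (hK : IsCompact K) (y : E) :
    IsCompact ((fun p : ℝ × E => p.2 + p.1 • y) '' (Set.Icc (0 : ℝ) 1 ×ˢ K)) :=
  (isCompact_Icc.prod hK).image (by fun_prop)

theorem mem_shear_image {K : Set E} (y : E) {x : E} (hx : x ∈ K) {s : ℝ}
    (hs : s ∈ Set.Ioc (0 : ℝ) 1) :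
    x + s • y ∈ (fun p : ℝ × E => p.2 + p.1 • y) '' (Set.Icc (0 : ℝ) 1 ×ˢ K) :=
  ⟨(s, x), ⟨⟨hs.1.le, hs.2⟩, hx⟩, rfl⟩

theorem ae_shear {P : E → Prop} (h : ∀ᵐ x, P x) (y : E) :
    ∀ᵐ x : E, ∀ᵐ s ∂(volume.restrict (Set.Ioc (0 : ℝ) 1)), P (x + s • y) := by
  have h1 : ∀ᵐ p : ℝ × E ∂((volume.restrict (Set.Ioc (0 : ℝ) 1)).prod volume), P p.2 :=
    Measure.quasiMeasurePreserving_snd.ae h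
  have h2 := (measurePreserving_shear y).quasiMeasurePreserving.ae h1
  have h3 := (Measure.measurePreserving_swap (μ := (volume : Measure E))
    (ν := volume.restrict (Set.Ioc (0 : ℝ) 1))).quasiMeasurePreserving.ae h2
  exact Measure.ae_ae_of_ae_prod h3

theorem LocallyIntegrable.comp_add_right {F : Type*} [NormedAddCommGroup F] {u : E → F}
    (hu : LocallyIntegrable u) (y : E) : LocallyIntegrable fun x => u (x + y) := by
  rw [locallyIntegrable_iff] at hu ⊢
  intro K hK
  have h1 := hu _ (hK.image (Homeomorph.addRight y).continuous)
  have h2 := (measurePreserving_add_right (volume : Measure E) y).integrableOn_comp_preimage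
    (Homeomorph.addRight y).measurableEmbedding (f := u) (s := Homeomorph.addRight y '' K)
  have h3 : (fun x => x + y) ⁻¹' (Homeomorph.addRight y '' K) = K :=
    Set.preimage_image_eq K (Homeomorph.addRight y).injective
  rw [h3] at h2
  exact h2.2 h1

theorem locallyIntegrable_segment_average {g : E → E} (hg : LocallyIntegrable g) (y : E) :
    LocallyIntegrable fun x => ∫ s in Set.Ioc (0 : ℝ) 1, inner ℝ (g (x + s • y)) y := by
  rw [locallyIntegrable_iff] at hg ⊢
  intro K hK
  have hK' := isCompact_shear_image hK y
  set K' := (fun p : ℝ × E => p.2 + p.1 • y) '' (Set.Icc (0 : ℝ) 1 ×ˢ K)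
  have hi : Integrable (fun x => inner ℝ (K'.indicator g x) y) :=
    ((hg _ hK').integrable_indicator hK'.measurableSet).inner_const y
  have h1 := (Integrable.comp_shear hi y).integral_prod_right
  refine h1.integrableOn.congr_fun (fun x hx => ?_) hK.measurableSet
  refine setIntegral_congr_fun measurableSet_Ioc fun s hs => ?_
  simp only
  rw [Set.indicator_of_mem (mem_shear_image y hx hs)]

/-- Tested against `φ`: the shift moves from `u` to `φ`, the increment of `φ` is a segment integral
of its derivative, and the weak gradient identity is applied to each translate of `φ`. This controls
increments of `u` without mollification. -/
theorem IsWeakGradient.sub_eq_segment_integral {u : E → ℝ} {g : E → E} (h : IsWeakGradient u g)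
    (y : E) : ∀ᵐ x, u (x + y) - u x = ∫ s in Set.Ioc (0 : ℝ) 1, inner ℝ (g (x + s • y)) y := by
  obtain ⟨hu, hg, hug⟩ := h
  refine ae_eq_of_integral_contDiff_smul_eq (μ := volume)
    ((LocallyIntegrable.comp_add_right hu y).sub hu) (locallyIntegrable_segment_average hg y)
    fun φ hφ hc => ?_
  simp only [smul_eq_mul]
  have hφd : Differentiable ℝ φ := hφ.differentiable (by simp)
  have hcd : Continuous fun x => fderiv ℝ φ x y :=
    (hφ.continuous_fderiv (by simp)).clm_apply continuous_const
  set K := tsupport φ with hKdef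
  have hK : IsCompact K := hc
  have hK' := isCompact_shear_image hK y
  set K' := (fun p : ℝ × E => p.2 + p.1 • y) '' (Set.Icc (0 : ℝ) 1 ×ˢ K)
  have hφ0 (x : E) (hx : x ∉ K) : φ x = 0 := image_eq_zero_of_notMem_tsupport hx
  have hφ0' (x : E) (hx : x ∉ K) : fderiv ℝ φ x y = 0 := by
    rw [image_eq_zero_of_notMem_tsupport (fun h => hx (tsupport_fderiv_subset ℝ h))]
    rfl
  have hiu : Integrable (fun x => u (x + y) * φ x) := by
    simpa [mul_comm] using (LocallyIntegrable.comp_add_right hu y).integrable_smul_left_of_hasCompactSupport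
      hφ.continuous hc
  have hiu0 : Integrable (fun x => u x * φ x) := by
    simpa [mul_comm] using hu.integrable_smul_left_of_hasCompactSupport hφ.continuous hc
  have hcs : HasCompactSupport fun x => φ (x - y) :=
    hc.comp_homeomorph (Homeomorph.subRight y)
  have hiu1 : Integrable (fun x => u x * φ (x - y)) := by
    simpa [mul_comm] using hu.integrable_smul_left_of_hasCompactSupport
      (hφ.continuous.comp (continuous_sub_right y)) hcs
  have hline (x : E) : φ (x - y) - φ x =
      - ∫ s in Set.Ioc (0 : ℝ) 1, fderiv ℝ φ (x - s • y) y := by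
    have hder (s : ℝ) : HasDerivAt (fun s : ℝ => φ (x - s • y)) (-(fderiv ℝ φ (x - s • y) y)) s := by
      have h1 : HasDerivAt (fun s : ℝ => x - s • y) (-y) s := by
        simpa using ((hasDerivAt_id s).smul_const y).const_sub x
      have h2 := (hφd (x - s • y)).hasFDerivAt.comp_hasDerivAt s h1
      rw [map_neg] at h2
      exact h2
    have hcont : Continuous fun s : ℝ => -(fderiv ℝ φ (x - s • y) y) :=
      (hcd.comp (by fun_prop : Continuous fun s : ℝ => x - s • y)).neg
    have h2 := intervalIntegral.integral_eq_sub_of_hasDerivAt (fun s _ => hder s)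
      (hcont.intervalIntegrable 0 1)
    rw [intervalIntegral.integral_of_le zero_le_one, integral_neg] at h2
    simpa using h2.symm
  obtain ⟨C, hC⟩ := (hc.fderiv (𝕜 := ℝ)).exists_bound_of_continuous (hφ.continuous_fderiv (by simp))
  obtain ⟨C₀, hC₀⟩ := hc.exists_bound_of_continuous hφ.continuous
  -- The second factor vanishes unless `p.2` lies in the compact set `K'`, so `u` may be cut off
  -- there and becomes integrable.
  have hfub1 : Integrable (fun p : ℝ × E => u p.2 * fderiv ℝ φ (p.2 - p.1 • y) y)
      ((volume.restrict (Set.Ioc (0 : ℝ) 1)).prod volume) := by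
    have h1 : Integrable (K'.indicator u) :=
      ((locallyIntegrable_iff.1 hu) _ hK').integrable_indicator hK'.measurableSet
    have h2 := (h1.comp_snd (volume.restrict (Set.Ioc (0 : ℝ) 1))).mul_bdd (c := C * ‖y‖)
      (g := fun p : ℝ × E => fderiv ℝ φ (p.2 - p.1 • y) y) ?_ ?_
    · refine h2.congr ?_
      have h3 : ∀ᵐ p : ℝ × E ∂((volume.restrict (Set.Ioc (0 : ℝ) 1)).prod volume),
          p.1 ∈ Set.Ioc (0 : ℝ) 1 :=
        Measure.quasiMeasurePreserving_fst.ae (ae_restrict_mem measurableSet_Ioc)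
      filter_upwards [h3] with p hp
      by_cases hx : p.2 - p.1 • y ∈ K
      · have := mem_shear_image y hx hp
        rw [sub_add_cancel] at this
        rw [Set.indicator_of_mem this]
      · rw [hφ0' _ hx, mul_zero, mul_zero]
    · exact (hcd.comp (by fun_prop : Continuous fun p : ℝ × E => p.2 - p.1 • y)).aestronglyMeasurable
    · exact Filter.Eventually.of_forall fun p => (ContinuousLinearMap.le_opNorm _ _).trans
        (mul_le_mul_of_nonneg_right (hC _) (norm_nonneg _))
  have hfub2 : Integrable (fun p : ℝ × E => inner ℝ (g (p.2 + p.1 • y)) y * φ p.2)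
      ((volume.restrict (Set.Ioc (0 : ℝ) 1)).prod volume) := by
    have h1 : Integrable (fun x => inner ℝ (K'.indicator g x) y) :=
      (((locallyIntegrable_iff.1 hg) _ hK').integrable_indicator hK'.measurableSet).inner_const y
    have h2 := (Integrable.comp_shear h1 y).mul_bdd (c := C₀)
      (g := fun p : ℝ × E => φ p.2)
      (hφ.continuous.comp continuous_snd).aestronglyMeasurable
      (Filter.Eventually.of_forall fun p => hC₀ _)
    refine h2.congr ?_
    have h3 : ∀ᵐ p : ℝ × E ∂((volume.restrict (Set.Ioc (0 : ℝ) 1)).prod volume),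
        p.1 ∈ Set.Ioc (0 : ℝ) 1 :=
      Measure.quasiMeasurePreserving_fst.ae (ae_restrict_mem measurableSet_Ioc)
    filter_upwards [h3] with p hp
    by_cases hx : p.2 ∈ K
    · rw [Set.indicator_of_mem (mem_shear_image y hx hp)]
    · rw [hφ0 _ hx, mul_zero, mul_zero]
  calc ∫ x, φ x * (u (x + y) - u x) = ∫ x, (u (x + y) * φ x - u x * φ x) := by
        congr 1; ext x; ring
    _ = (∫ x, u (x + y) * φ x) - ∫ x, u x * φ x := integral_sub hiu hiu0
    _ = (∫ x, u x * φ (x - y)) - ∫ x, u x * φ x := by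
        congr 1
        rw [← integral_add_right_eq_self (fun x => u x * φ (x - y)) y]
        simp
    _ = ∫ x, u x * (φ (x - y) - φ x) := by
        rw [← integral_sub hiu1 hiu0]
        congr 1; ext x; ring
    _ = - ∫ x, ∫ s in Set.Ioc (0 : ℝ) 1, u x * fderiv ℝ φ (x - s • y) y := by
        rw [← integral_neg]
        congr 1; ext x
        rw [hline, integral_const_mul]
        ring
    _ = - ∫ s in Set.Ioc (0 : ℝ) 1, ∫ x, u x * fderiv ℝ φ (x - s • y) y := by
        rw [integral_integral_swap]
        exact hfub1.swap
    _ = ∫ s in Set.Ioc (0 : ℝ) 1, ∫ x, inner ℝ (g (x + s • y)) y * φ x := by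
        rw [← integral_neg]
        congr 1; ext s
        have h1 := hug (fun x => φ (x - s • y)) (hφ.comp (contDiff_id.sub contDiff_const))
          (hc.comp_homeomorph (Homeomorph.subRight (s • y))) y
        simp only [fderiv_comp_sub] at h1
        rw [h1, neg_neg, ← integral_add_right_eq_self _ (s • y)]
        simp
    _ = ∫ x, ∫ s in Set.Ioc (0 : ℝ) 1, inner ℝ (g (x + s • y)) y * φ x :=
        integral_integral_swap hfub2
    _ = _ := by
        congr 1; ext x
        rw [integral_mul_const, mul_comm]

theorem IsWeakGradient.abs_sub_le {u : E → ℝ} {g : E → E} (h : IsWeakGradient u g) {L : ℝ}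
    (hL : ∀ᵐ x, ‖g x‖ ≤ L) (y : E) : ∀ᵐ x, |u (x + y) - u x| ≤ L * ‖y‖ := by
  filter_upwards [h.sub_eq_segment_integral y, ae_shear hL y] with x hx hx'
  rw [hx, ← Real.norm_eq_abs]
  have := norm_integral_le_of_norm_le_const (μ := volume.restrict (Set.Ioc (0 : ℝ) 1))
    (f := fun s => inner ℝ (g (x + s • y)) y) (C := L * ‖y‖) ?_
  · simpa using this
  · filter_upwards [hx'] with s hs
    exact (norm_inner_le_norm _ _).trans (mul_le_mul_of_nonneg_right hs (norm_nonneg _))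

variable [HeatNormalized E]

theorem heatMaximal_le_of_ae_le {u : E → ℝ} {B : ℝ} (hB : ∀ᵐ x, |u x| ≤ B) (x : E) :
    heatMaximal u x ≤ ENNReal.ofReal B := by
  rw [heatMaximal_eq]
  refine iSup₂_le fun t ht => ?_
  have h1 : heatConv t (fun y => ENNReal.ofReal |u y|) x ≤ heatConv t (fun _ => ENNReal.ofReal B) x := by
    unfold heatConv
    refine lintegral_mono_ae ?_
    filter_upwards [hB] with y hy
    exact mul_le_mul_left (ENNReal.ofReal_le_ofReal hy) _
  rwa [heatConv_const ht] at h1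

/-- Heat means commute with translations and fix constants, so the additive error `L‖y‖` passes
through every mean and through the supremum. -/
theorem heatMaximal_add_le {u : E → ℝ} {L : ℝ} (hL : 0 ≤ L)
    (h : ∀ y, ∀ᵐ x, |u (x + y) - u x| ≤ L * ‖y‖) (x y : E) :
    heatMaximal u (x + y) ≤ heatMaximal u x + ENNReal.ofReal (L * ‖y‖) := by
  rw [heatMaximal_eq, heatMaximal_eq]
  refine iSup₂_le fun t ht => ?_
  refine le_trans ?_ (add_le_add_left (le_iSup₂ (f := fun (t : ℝ) (_ : 0 < t) =>
    heatConv t (fun y => ENNReal.ofReal |u y|) x) t ht) _)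
  have hm : Measurable fun z : E => ENNReal.ofReal (heatKernel t (x - z)) :=
    ((measurable_heatKernel _).comp (measurable_const.sub measurable_id)).ennreal_ofReal
  have h1 : heatConv t (fun y => ENNReal.ofReal |u y|) (x + y) =
      heatConv t (fun z => ENNReal.ofReal |u (z + y)|) x := by
    unfold heatConv
    rw [← lintegral_add_right_eq_self _ y]
    simp
  have h2 : heatConv t (fun z => ENNReal.ofReal |u (z + y)|) x ≤
      heatConv t (fun z => ENNReal.ofReal (L * ‖y‖) + ENNReal.ofReal |u z|) x := by
    unfold heatConv
    refine lintegral_mono_ae ?_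
    filter_upwards [h y] with z hz
    refine mul_le_mul_left ?_ _
    rw [← ENNReal.ofReal_add (by positivity) (abs_nonneg _)]
    refine ENNReal.ofReal_le_ofReal ?_
    have := abs_sub_abs_le_abs_sub (u (z + y)) (u z)
    linarith
  rw [h1]
  refine h2.trans (le_of_eq ?_)
  rw [heatConv_add t measurable_const, heatConv_const ht, add_comm]

theorem ae_norm_le_toReal_eLpNorm_top {α F : Type*} [MeasurableSpace α] {μ : Measure α}
    [NormedAddCommGroup F] {v : α → F} (hv : MemLp v ⊤ μ) :
    ∀ᵐ x ∂μ, ‖v x‖ ≤ (eLpNorm v ⊤ μ).toReal := by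
  filter_upwards [ae_le_eLpNormEssSup (f := v) (μ := μ)] with x hx
  rw [← eLpNorm_exponent_top] at hx
  simpa using ENNReal.toReal_mono hv.2.ne hx

/-- The Lipschitz case of the regularity theorem, valid in all dimensions. -/
theorem heatMaximal_memW1_top {u : E → ℝ} (hu : MemW1 ⊤ u) :
    (∀ x, heatMaximal u x < ⊤) ∧ MemW1 ⊤ (fun x => (heatMaximal u x).toReal) ∧
      ∀ g₀ g : E → E, IsWeakGradient u g₀ →
        IsWeakGradient (fun x => (heatMaximal u x).toReal) g →
        eLpNorm g ⊤ volume ≤ eLpNorm g₀ ⊤ volume := by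
  obtain ⟨hup, g₁, hg₁, hgp⟩ := hu
  set B := (eLpNorm u ⊤ volume).toReal
  set L := (eLpNorm g₁ ⊤ volume).toReal with hL
  have hL0 : 0 ≤ L := ENNReal.toReal_nonneg
  have hle := heatMaximal_le_of_ae_le (u := u) (B := B) (ae_norm_le_toReal_eLpNorm_top hup)
  have hfin (x : E) : heatMaximal u x < ⊤ := (hle x).trans_lt ENNReal.ofReal_lt_top
  have hlip : LipschitzWith ⟨L, hL0⟩ fun x => (heatMaximal u x).toReal := by
    refine LipschitzWith.of_le_add_mul _ fun x y => ?_
    have h1 := heatMaximal_add_le hL0 (hg₁.abs_sub_le (ae_norm_le_toReal_eLpNorm_top hgp)) y (x - y)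
    rw [add_sub_cancel] at h1
    have h2 := ENNReal.toReal_mono (ENNReal.add_ne_top.2 ⟨(hfin y).ne, ENNReal.ofReal_ne_top⟩) h1
    rw [ENNReal.toReal_add (hfin y).ne ENNReal.ofReal_ne_top,
      ENNReal.toReal_ofReal (by positivity)] at h2
    rw [dist_eq_norm]
    exact h2
  have hw := hlip.isWeakGradient_gradient
  have hgrad : eLpNorm (gradient fun x => (heatMaximal u x).toReal) ⊤ volume ≤
      eLpNorm g₁ ⊤ volume := by
    refine (eLpNorm_le_of_ae_bound (Filter.Eventually.of_forall hlip.norm_gradient_le)).trans ?_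
    rw [ENNReal.toReal_top, inv_zero, ENNReal.rpow_zero, one_mul]
    exact ENNReal.ofReal_toReal_le
  refine ⟨hfin, ⟨?_, _, hw, ?_, hgrad.trans_lt hgp.2⟩, fun g₀ g hg₀ hg => ?_⟩
  · refine memLp_top_of_bound hlip.continuous.aestronglyMeasurable B
      (Filter.Eventually.of_forall fun x => ?_)
    rw [Real.norm_of_nonneg ENNReal.toReal_nonneg]
    exact ENNReal.toReal_le_of_le_ofReal ENNReal.toReal_nonneg (hle x)
  · exact hw.2.1.aestronglyMeasurable
  · rw [eLpNorm_congr_ae (hg.ae_unique hw), eLpNorm_congr_ae (hg₀.ae_unique hg₁)]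
    exact hgrad

end WeakGradient

/-! ### Elementary inequalities -/

section CauchySchwarz

theorem ENNReal.sq_lintegral_mul_le {α : Type*} [MeasurableSpace α] {μ : Measure α}
    {a b : α → ℝ≥0∞} (ha : AEMeasurable a μ) (hb : AEMeasurable b μ) :
    (∫⁻ x, a x * b x ∂μ) ^ 2 ≤ (∫⁻ x, a x ^ 2 ∂μ) * ∫⁻ x, b x ^ 2 ∂μ := by
  have h := ENNReal.lintegral_mul_le_Lp_mul_Lq μ Real.HolderConjugate.two_two ha hb
  simp only [Pi.mul_apply, ENNReal.rpow_two] at h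
  calc (∫⁻ x, a x * b x ∂μ) ^ 2
      ≤ ((∫⁻ x, a x ^ 2 ∂μ) ^ (1 / 2 : ℝ) * (∫⁻ x, b x ^ 2 ∂μ) ^ (1 / 2 : ℝ)) ^ 2 := by gcongr
    _ = _ := by
      rw [mul_pow, ← ENNReal.rpow_natCast, ← ENNReal.rpow_natCast, ← ENNReal.rpow_mul,
        ← ENNReal.rpow_mul]
      norm_num

theorem enorm_integral_sq_le {α F : Type*} [MeasurableSpace α] {μ : Measure α}
    [IsProbabilityMeasure μ] [NormedAddCommGroup F] [NormedSpace ℝ F] {a : α → F}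
    (ha : AEStronglyMeasurable a μ) : ‖∫ x, a x ∂μ‖ₑ ^ 2 ≤ ∫⁻ x, ‖a x‖ₑ ^ 2 ∂μ := by
  have h := ENNReal.sq_lintegral_mul_le (b := fun _ => 1) ha.enorm aemeasurable_const
  simp only [mul_one, one_pow, lintegral_const, measure_univ] at h
  refine le_trans ?_ h
  gcongr
  exact enorm_integral_le_lintegral_enorm _

end CauchySchwarz

/-- From `cosh x = 1 + 2 sinh² (x/2)`. It serves to bound Gaussian second moments by exponential
moments. -/
theorem one_add_sq_div_two_le_cosh (x : ℝ) : 1 + x ^ 2 / 2 ≤ Real.cosh x := by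
  have h1 : Real.cosh x = 1 + 2 * Real.sinh (x / 2) ^ 2 := by
    have h := Real.cosh_two_mul (x / 2)
    rw [mul_div_cancel₀ x two_ne_zero, Real.cosh_sq] at h
    linarith
  have h2 : |x / 2| ≤ |Real.sinh (x / 2)| := by
    rcases le_total 0 (x / 2) with h | h
    · rw [abs_of_nonneg h, abs_of_nonneg (Real.sinh_nonneg_iff.2 h)]
      exact Real.self_le_sinh_iff.2 h
    · rw [abs_of_nonpos h, abs_of_nonpos (Real.sinh_nonpos_iff.2 h)]
      exact neg_le_neg (Real.sinh_le_self_iff.2 h)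
  have h3 := sq_le_sq.2 h2
  rw [h1]
  nlinarith

/-! ### Gaussian measures: reversibility and moments -/

section HeatMeasure

variable {E : Type*} [NormedAddCommGroup E] [InnerProductSpace ℝ E] [MeasureSpace E]

/-- The Gaussian measure with density the heat kernel. -/
noncomputable def heatMeasure (E : Type*) [NormedAddCommGroup E] [InnerProductSpace ℝ E]
    [MeasureSpace E] (t : ℝ) : Measure E :=
  volume.withDensity fun y => ENNReal.ofReal (heatKernel t y)

variable [BorelSpace E] [FiniteDimensional ℝ E] [(volume : Measure E).IsAddHaarMeasure]
  [HeatNormalized E]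

theorem isProbabilityMeasure_heatMeasure {t : ℝ} (ht : 0 < t) :
    IsProbabilityMeasure (heatMeasure E t) := by
  constructor
  rw [heatMeasure, withDensity_apply _ MeasurableSet.univ, Measure.restrict_univ,
    lintegral_heatKernel ht]

instance (t : ℝ) : SFinite (heatMeasure E t) := by unfold heatMeasure; infer_instance

theorem lintegral_heatMeasure (t : ℝ) {f : E → ℝ≥0∞} (hf : Measurable f) :
    ∫⁻ y, f y ∂(heatMeasure E t) = ∫⁻ y, f y * ENNReal.ofReal (heatKernel t y) := by
  rw [heatMeasure, lintegral_withDensity_eq_lintegral_mul _ (measurable_heatKernel t).ennreal_ofReal hf]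
  exact lintegral_congr fun y => mul_comm _ _

theorem heatConv_eq_lintegral_heatMeasure (t : ℝ) {f : E → ℝ≥0∞} (hf : Measurable f) (x : E) :
    heatConv t f x = ∫⁻ y, f (x + y) ∂(heatMeasure E t) := by
  rw [heatConv_eq_lintegral_translate,
    lintegral_heatMeasure t (f := fun y => f (x + y)) (hf.comp (measurable_const_add x))]

theorem integral_heatMeasure {F : Type*} [NormedAddCommGroup F] [NormedSpace ℝ F] {t : ℝ}
    (ht : 0 < t) (f : E → F) :
    ∫ y, f y ∂(heatMeasure E t) = ∫ y, heatKernel t y • f y := by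
  rw [heatMeasure, integral_withDensity_eq_integral_toReal_smul
    (measurable_heatKernel t).ennreal_ofReal (Filter.Eventually.of_forall fun _ => ENNReal.ofReal_lt_top)]
  simp [ENNReal.toReal_ofReal (heatKernel_pos ht _).le]

theorem integrable_heatMeasure_iff {F : Type*} [NormedAddCommGroup F] [NormedSpace ℝ F] {t : ℝ}
    (ht : 0 < t) (f : E → F) :
    Integrable f (heatMeasure E t) ↔ Integrable fun y => heatKernel t y • f y := by
  rw [heatMeasure, integrable_withDensity_iff_integrable_smul'
    (measurable_heatKernel t).ennreal_ofReal (Filter.Eventually.of_forall fun _ => ENNReal.ofReal_lt_top)]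
  simp [ENNReal.toReal_ofReal (heatKernel_pos ht _).le]

theorem heatMeasure_absolutelyContinuous (t : ℝ) : heatMeasure E t ≪ volume :=
  withDensity_absolutelyContinuous _ _

theorem measurePreserving_neg_heatMeasure (t : ℝ) :
    MeasurePreserving (fun y : E => -y) (heatMeasure E t) (heatMeasure E t) := by
  refine ⟨measurable_neg, Measure.ext fun s hs => ?_⟩
  rw [Measure.map_apply measurable_neg hs, heatMeasure, withDensity_apply _ hs,
    withDensity_apply _ (measurable_neg hs), ← lintegral_indicator hs,
    ← lintegral_indicator (measurable_neg hs), ← lintegral_neg_eq_self]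
  refine lintegral_congr fun y => ?_
  by_cases hy : y ∈ s <;> simp [Set.indicator, hy, heatKernel_neg]

theorem measurePreserving_heat_shear (t : ℝ) :
    MeasurePreserving (fun p : E × E => (p.1, p.2 + p.1))
      ((heatMeasure E t).prod volume) ((heatMeasure E t).prod volume) :=
  MeasurePreserving.skew_product (g := fun (y : E) (x : E) => x + y)
    (MeasurePreserving.id _) (measurable_snd.add measurable_fst)
    (Filter.Eventually.of_forall fun y => (measurePreserving_add_right volume y).map_eq)

theorem measurePreserving_heat_add {t : ℝ} (ht : 0 < t) :
    MeasurePreserving (fun p : E × E => p.1 + p.2) (volume.prod (heatMeasure E t)) volume := by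
  have := isProbabilityMeasure_heatMeasure (E := E) ht
  exact (measurePreserving_snd.comp (measurePreserving_heat_shear t)).comp
    Measure.measurePreserving_swap

/-- Reversing a heat jump preserves the joint law of start and jump. -/
theorem measurePreserving_heat_reverse (t : ℝ) :
    MeasurePreserving (fun p : E × E => (p.1 + p.2, -p.2))
      (volume.prod (heatMeasure E t)) (volume.prod (heatMeasure E t)) := by
  have h1 : MeasurePreserving (fun p : E × E => (-p.1, p.2 + p.1))
      ((heatMeasure E t).prod volume) ((heatMeasure E t).prod volume) :=
    MeasurePreserving.skew_product (g := fun (y : E) (x : E) => x + y)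
      (measurePreserving_neg_heatMeasure t) (measurable_snd.add measurable_fst)
      (Filter.Eventually.of_forall fun y => (measurePreserving_add_right volume y).map_eq)
  exact (Measure.measurePreserving_swap.comp h1).comp Measure.measurePreserving_swap

theorem integral_heat_reverse (t : ℝ) (h : E × E → ℝ) :
    ∫ p, h (p.1 + p.2, -p.2) ∂(volume.prod (heatMeasure E t)) =
      ∫ p, h p ∂(volume.prod (heatMeasure E t)) := by
  refine (measurePreserving_heat_reverse t).integral_comp ?_ h
  refine MeasurableEquiv.measurableEmbedding
    { toFun := fun p : E × E => (p.1 + p.2, -p.2)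
      invFun := fun p : E × E => (p.1 + p.2, -p.2)
      left_inv := fun p => by simp
      right_inv := fun p => by simp
      measurable_toFun := by simp only [Equiv.coe_fn_mk]; fun_prop
      measurable_invFun := by simp only [Equiv.coe_fn_symm_mk]; fun_prop }

/-- Completing the square: up to a constant, the tilted Gaussian is the Gaussian recentred at `2ts
v`. -/
theorem lintegral_exp_inner_heatMeasure {t : ℝ} (ht : 0 < t) (v : E) (s : ℝ) :
    ∫⁻ y, ENNReal.ofReal (Real.exp (s * inner ℝ v y)) ∂(heatMeasure E t) =
      ENNReal.ofReal (Real.exp (t * s ^ 2 * ‖v‖ ^ 2)) := by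
  rw [lintegral_heatMeasure t (by fun_prop)]
  have h (y : E) : ENNReal.ofReal (Real.exp (s * inner ℝ v y)) * ENNReal.ofReal (heatKernel t y) =
      ENNReal.ofReal (Real.exp (t * s ^ 2 * ‖v‖ ^ 2)) *
        ENNReal.ofReal (heatKernel t ((2 * t * s) • v - y)) := by
    rw [← ENNReal.ofReal_mul (Real.exp_nonneg _), ← ENNReal.ofReal_mul (Real.exp_nonneg _)]
    congr 1
    unfold heatKernel
    rw [mul_left_comm, mul_left_comm (Real.exp (t * s ^ 2 * ‖v‖ ^ 2)), ← Real.exp_add,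
      ← Real.exp_add]
    congr 2
    rw [norm_sub_sq_real, norm_smul, inner_smul_left, Real.norm_eq_abs, mul_pow, sq_abs]
    simp only [conj_trivial]
    field_simp
    ring
  simp only [h]
  rw [lintegral_const_mul' _ _ ENNReal.ofReal_ne_top, lintegral_heatKernel_sub_right ht, mul_one]

/-- Averaging the exponential moments at `±√r` and bounding `cosh` from below gives `1 + rm/2 ≤ exp
(t‖v‖² r)`; comparing slopes at `r = 0` bounds `m`. -/
theorem lintegral_inner_sq_heatMeasure_le {t : ℝ} (ht : 0 < t) (v : E) :
    ∫⁻ y, ENNReal.ofReal (inner ℝ v y ^ 2) ∂(heatMeasure E t) ≤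
      ENNReal.ofReal (2 * t * ‖v‖ ^ 2) := by
  have := isProbabilityMeasure_heatMeasure (E := E) ht
  set m := ∫⁻ y, ENNReal.ofReal (inner ℝ v y ^ 2) ∂(heatMeasure E t) with hm
  have hmeas : Measurable fun y : E => ENNReal.ofReal (inner ℝ v y ^ 2) := by fun_prop
  have key : ∀ r : ℝ, 0 < r →
      1 + ENNReal.ofReal (r / 2) * m ≤ ENNReal.ofReal (Real.exp (t * ‖v‖ ^ 2 * r)) := by
    intro r hr
    have h1 := lintegral_exp_inner_heatMeasure ht v √r
    have h2 := lintegral_exp_inner_heatMeasure ht v (-√r)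
    rw [neg_sq, Real.sq_sqrt hr.le] at h2
    rw [Real.sq_sqrt hr.le] at h1
    have h3 : ∀ y : E, 2 * (1 + ENNReal.ofReal (r / 2) * ENNReal.ofReal (inner ℝ v y ^ 2)) ≤
        ENNReal.ofReal (Real.exp (√r * inner ℝ v y)) +
          ENNReal.ofReal (Real.exp (-√r * inner ℝ v y)) := by
      intro y
      rw [← ENNReal.ofReal_add (Real.exp_nonneg _) (Real.exp_nonneg _),
        ← ENNReal.ofReal_mul (by positivity), ← ENNReal.ofReal_one,
        ← ENNReal.ofReal_add zero_le_one (by positivity), ← ENNReal.ofReal_ofNat,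
        ← ENNReal.ofReal_mul zero_le_two]
      refine ENNReal.ofReal_le_ofReal ?_
      have h4 := one_add_sq_div_two_le_cosh (√r * inner ℝ v y)
      rw [Real.cosh_eq, mul_pow, Real.sq_sqrt hr.le] at h4
      rw [neg_mul]
      linarith
    have h5 := lintegral_mono (μ := heatMeasure E t) h3
    rw [lintegral_add_left (by fun_prop), h1, h2, lintegral_const_mul _ (by fun_prop),
      lintegral_add_left measurable_const, lintegral_const_mul _ hmeas, lintegral_const,
      measure_univ, mul_one, ← two_mul] at h5
    have h6 := (ENNReal.mul_le_mul_iff_right two_ne_zero ENNReal.ofNat_ne_top).1 h5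
    refine h6.trans (le_of_eq ?_)
    congr 2
    ring
  have hfin : m ≠ ⊤ := by
    intro h
    have := key 1 one_pos
    rw [h, ENNReal.mul_top (by simp)] at this
    simp at this
  have key' : ∀ r : ℝ, 0 < r →
      m.toReal ≤ 2 * ((Real.exp (t * ‖v‖ ^ 2 * r) - 1) / r) := by
    intro r hr
    have h1 := ENNReal.toReal_mono ENNReal.ofReal_ne_top (key r hr)
    rw [ENNReal.toReal_add ENNReal.one_ne_top (ENNReal.mul_ne_top ENNReal.ofReal_ne_top hfin),
      ENNReal.toReal_mul, ENNReal.toReal_ofReal (by positivity),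
      ENNReal.toReal_ofReal (Real.exp_nonneg _), ENNReal.toReal_one] at h1
    rw [← mul_div_assoc, le_div_iff₀ hr]
    linarith
  have hder : HasDerivAt (fun r : ℝ => Real.exp (t * ‖v‖ ^ 2 * r)) (t * ‖v‖ ^ 2) 0 := by
    have := ((hasDerivAt_id (0 : ℝ)).const_mul (t * ‖v‖ ^ 2)).exp
    simpa using this
  have hlim := (hasDerivAt_iff_tendsto_slope_zero.1 hder).mono_left
    (nhdsWithin_mono (0 : ℝ) (fun r (hr : r ∈ Set.Ioi (0 : ℝ)) => (ne_of_gt hr : r ≠ 0)))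
  have hle : m.toReal ≤ 2 * (t * ‖v‖ ^ 2) := by
    refine ge_of_tendsto (hlim.const_mul 2) ?_
    filter_upwards [self_mem_nhdsWithin] with r hr
    refine (key' r hr).trans (le_of_eq ?_)
    simp only [zero_add, mul_zero, Real.exp_zero, smul_eq_mul]
    ring
  rw [← ENNReal.ofReal_toReal hfin]
  exact ENNReal.ofReal_le_ofReal (by linarith)

end HeatMeasure

/-! ### The Dirichlet energy of Gaussian jumps -/

section HeatEnergy

variable {E : Type*} [NormedAddCommGroup E] [InnerProductSpace ℝ E] [MeasureSpace E]

/-- The unnormalized Dirichlet energy of `u` for the heat flow with time step `t`. -/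
noncomputable def heatEnergy (t : ℝ) (u : E → ℝ) : ℝ≥0∞ :=
  ∫⁻ p : E × E, ENNReal.ofReal ((u (p.1 + p.2) - u p.1) ^ 2) ∂(volume.prod (heatMeasure E t))

variable [BorelSpace E] [FiniteDimensional ℝ E] [(volume : Measure E).IsAddHaarMeasure]
  [HeatNormalized E]

theorem heatEnergy_abs_le (t : ℝ) (u : E → ℝ) : heatEnergy t (fun x => |u x|) ≤ heatEnergy t u := by
  refine lintegral_mono fun p => ENNReal.ofReal_le_ofReal ?_
  exact sq_le_sq.2 (abs_abs_sub_abs_le _ _)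

/-- Jensen's inequality on the unit segment, then translation invariance. -/
theorem lintegral_sub_sq_le_of_isWeakGradient {u : E → ℝ} {g : E → E} (h : IsWeakGradient u g)
    (hg : Measurable g) (y : E) :
    ∫⁻ x, ENNReal.ofReal ((u (x + y) - u x) ^ 2) ≤ ∫⁻ x, ENNReal.ofReal (inner ℝ (g x) y ^ 2) := by
  set ν : Measure ℝ := volume.restrict (Set.Ioc 0 1) with hν
  have : IsProbabilityMeasure ν := ⟨by simp [hν]⟩
  have hmeas : Measurable fun p : ℝ × E => ENNReal.ofReal (inner ℝ (g (p.2 + p.1 • y)) y ^ 2) := by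
    have h1 : Measurable fun p : ℝ × E => p.2 + p.1 • y :=
      measurable_snd.add (measurable_fst.smul_const y)
    exact (((hg.comp h1).inner measurable_const).pow_const 2).ennreal_ofReal
  calc ∫⁻ x, ENNReal.ofReal ((u (x + y) - u x) ^ 2)
      ≤ ∫⁻ x, ∫⁻ s, ENNReal.ofReal (inner ℝ (g (x + s • y)) y ^ 2) ∂ν := by
        refine lintegral_mono_ae ?_
        filter_upwards [h.sub_eq_segment_integral y] with x hx
        rw [hx]
        have h1 : Measurable fun s : ℝ => inner ℝ (g (x + s • y)) y :=
          (hg.comp (measurable_const.add (measurable_id.smul_const y))).inner measurable_const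
        have h2 := enorm_integral_sq_le (μ := ν) h1.aestronglyMeasurable
        simp only [Real.enorm_eq_ofReal_abs] at h2
        simpa only [← ENNReal.ofReal_pow (abs_nonneg _), sq_abs] using h2
    _ = ∫⁻ s, (∫⁻ x, ENNReal.ofReal (inner ℝ (g (x + s • y)) y ^ 2)) ∂ν :=
        lintegral_lintegral_swap (f := fun x s => ENNReal.ofReal (inner ℝ (g (x + s • y)) y ^ 2))
          (hmeas.comp measurable_swap).aemeasurable
    _ = ∫⁻ _, (∫⁻ x, ENNReal.ofReal (inner ℝ (g x) y ^ 2)) ∂ν := by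
        refine lintegral_congr fun s => ?_
        exact lintegral_add_right_eq_self (fun x => ENNReal.ofReal (inner ℝ (g x) y ^ 2)) (s • y)
    _ = _ := by simp

theorem heatEnergy_le_of_isWeakGradient {t : ℝ} (ht : 0 < t) {u : E → ℝ} (hu : Measurable u)
    {g : E → E} (hg : Measurable g) (h : IsWeakGradient u g) :
    heatEnergy t u ≤ ENNReal.ofReal (2 * t) * ∫⁻ x, ‖g x‖ₑ ^ 2 := by
  have hm1 : Measurable fun p : E × E => ENNReal.ofReal ((u (p.1 + p.2) - u p.1) ^ 2) :=
    (((hu.comp (measurable_fst.add measurable_snd)).sub (hu.comp measurable_fst)).pow_const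
      2).ennreal_ofReal
  have hm2 : Measurable fun p : E × E => ENNReal.ofReal (inner ℝ (g p.1) p.2 ^ 2) :=
    (((hg.comp measurable_fst).inner measurable_snd).pow_const 2).ennreal_ofReal
  calc heatEnergy t u
      = ∫⁻ y, (∫⁻ x, ENNReal.ofReal ((u (x + y) - u x) ^ 2)) ∂(heatMeasure E t) :=
        lintegral_prod_symm _ hm1.aemeasurable
    _ ≤ ∫⁻ y, (∫⁻ x, ENNReal.ofReal (inner ℝ (g x) y ^ 2)) ∂(heatMeasure E t) :=
        lintegral_mono fun y => lintegral_sub_sq_le_of_isWeakGradient h hg y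
    _ = ∫⁻ x, ∫⁻ y, ENNReal.ofReal (inner ℝ (g x) y ^ 2) ∂(heatMeasure E t) :=
        (lintegral_lintegral_swap (f := fun x y => ENNReal.ofReal (inner ℝ (g x) y ^ 2))
          hm2.aemeasurable).symm
    _ ≤ ∫⁻ x, ENNReal.ofReal (2 * t * ‖g x‖ ^ 2) :=
        lintegral_mono fun x => lintegral_inner_sq_heatMeasure_le ht (g x)
    _ = _ := by
        rw [← lintegral_const_mul _ (hg.enorm.pow_const 2)]
        refine lintegral_congr fun x => ?_
        rw [ENNReal.ofReal_mul (by positivity), ENNReal.ofReal_pow (norm_nonneg _), ofReal_norm]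

/-- The comparison principle. With `w = M - f`, expansion and reversibility give `E(f) = E(M) + 4 ∫
(PM - M) w + E(w)`. The middle integrand is nonnegative: at almost every point either `w = 0` or `PM
≥ M`. -/
theorem heatEnergy_le_of_subsolution {t : ℝ} (ht : 0 < t) {f M : E → ℝ} (hf : MemLp f 2)
    (hM : MemLp M 2) (hfM : ∀ᵐ x, f x ≤ M x)
    (hsub : ∀ᵐ x, f x < M x → M x ≤ ∫ y, M (x + y) ∂(heatMeasure E t)) :
    heatEnergy t M ≤ heatEnergy t f := by
  have := isProbabilityMeasure_heatMeasure (E := E) ht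
  set μ := (volume : Measure E).prod (heatMeasure E t) with hμ
  have hadd : MeasurePreserving (fun p : E × E => p.1 + p.2) μ volume := measurePreserving_heat_add ht
  have hfst : MeasurePreserving (Prod.fst : E × E → E) μ volume := measurePreserving_fst
  set w : E → ℝ := fun x => M x - f x with hw
  have hwL : MemLp w 2 := hM.sub hf
  have hM1 : MemLp (fun p : E × E => M (p.1 + p.2)) 2 μ := hM.comp_measurePreserving hadd
  have hM0 : MemLp (fun p : E × E => M p.1) 2 μ := hM.comp_measurePreserving hfst
  have hw1 : MemLp (fun p : E × E => w (p.1 + p.2)) 2 μ := hwL.comp_measurePreserving hadd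
  have hw0 : MemLp (fun p : E × E => w p.1) 2 μ := hwL.comp_measurePreserving hfst
  have hdM : MemLp (fun p : E × E => M (p.1 + p.2) - M p.1) 2 μ := hM1.sub hM0
  have hdw : MemLp (fun p : E × E => w (p.1 + p.2) - w p.1) 2 μ := hw1.sub hw0
  have hdf : MemLp (fun p : E × E => f (p.1 + p.2) - f p.1) 2 μ :=
    (hf.comp_measurePreserving hadd).sub (hf.comp_measurePreserving hfst)
  have hi0 : Integrable (fun p : E × E => (M (p.1 + p.2) - M p.1) * w p.1) μ :=
    hdM.integrable_mul hw0
  have hi1 : Integrable (fun p : E × E => (M (p.1 + p.2) - M p.1) * w (p.1 + p.2)) μ :=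
    hdM.integrable_mul hw1
  have hpos : 0 ≤ ∫ p : E × E, (M (p.1 + p.2) - M p.1) * w p.1 ∂μ := by
    rw [integral_prod _ hi0]
    refine integral_nonneg_of_ae ?_
    have hint : ∀ᵐ x : E, Integrable (fun y => M (x + y)) (heatMeasure E t) := by
      have h1 := ((memLp_two_iff_integrable_sq hM1.1).1 hM1).prod_right_ae
      filter_upwards [h1, hM1.1.prodMk_left] with x hx hx'
      exact ((memLp_two_iff_integrable_sq hx').2 hx).integrable one_le_two
    filter_upwards [hfM, hsub, hint] with x h1 h2 h3
    simp only [Pi.zero_apply]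
    rw [integral_mul_const, integral_sub h3 (integrable_const _), integral_const]
    simp only [probReal_univ, smul_eq_mul, one_mul]
    rcases h1.lt_or_eq with h4 | h4
    · exact mul_nonneg (sub_nonneg.2 (h2 h4)) (sub_nonneg.2 h1)
    · simp [hw, h4]
  -- Reversing the jump exchanges its endpoints and changes the sign of the increment of `M`.
  have hsymm : ∫ p : E × E, (M (p.1 + p.2) - M p.1) * w (p.1 + p.2) ∂μ =
      - ∫ p : E × E, (M (p.1 + p.2) - M p.1) * w p.1 ∂μ := by
    rw [← integral_heat_reverse t fun p : E × E => (M (p.1 + p.2) - M p.1) * w p.1,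
      ← integral_neg]
    refine integral_congr_ae (Filter.Eventually.of_forall fun p => ?_)
    simp only [add_neg_cancel_right]
    ring
  have hexp : ∫ p : E × E, (f (p.1 + p.2) - f p.1) ^ 2 ∂μ =
      (∫ p : E × E, (M (p.1 + p.2) - M p.1) ^ 2 ∂μ) +
      4 * (∫ p : E × E, (M (p.1 + p.2) - M p.1) * w p.1 ∂μ) +
      ∫ p : E × E, (w (p.1 + p.2) - w p.1) ^ 2 ∂μ := by
    have h1 : ∀ p : E × E, (f (p.1 + p.2) - f p.1) ^ 2 = (M (p.1 + p.2) - M p.1) ^ 2 +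
        (2 * ((M (p.1 + p.2) - M p.1) * w p.1) - 2 * ((M (p.1 + p.2) - M p.1) * w (p.1 + p.2))) +
        (w (p.1 + p.2) - w p.1) ^ 2 := by
      intro p
      simp only [hw]
      ring
    simp only [h1]
    have ha : Integrable (fun p : E × E => (M (p.1 + p.2) - M p.1) ^ 2) μ := hdM.integrable_sq
    have hb : Integrable (fun p : E × E => (w (p.1 + p.2) - w p.1) ^ 2) μ := hdw.integrable_sq
    have hc : Integrable (fun p : E × E => 2 * ((M (p.1 + p.2) - M p.1) * w p.1) -
        2 * ((M (p.1 + p.2) - M p.1) * w (p.1 + p.2))) μ :=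
      (hi0.const_mul 2).sub (hi1.const_mul 2)
    have hd : Integrable (fun p : E × E => (M (p.1 + p.2) - M p.1) ^ 2 +
        (2 * ((M (p.1 + p.2) - M p.1) * w p.1) -
        2 * ((M (p.1 + p.2) - M p.1) * w (p.1 + p.2)))) μ := ha.add hc
    rw [integral_add hd hb, integral_add ha hc, integral_sub (hi0.const_mul 2) (hi1.const_mul 2), integral_const_mul, integral_const_mul,
      hsymm]
    ring
  unfold heatEnergy
  rw [← ofReal_integral_eq_lintegral_ofReal hdM.integrable_sq
      (Filter.Eventually.of_forall fun p => sq_nonneg _),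
    ← ofReal_integral_eq_lintegral_ofReal hdf.integrable_sq
      (Filter.Eventually.of_forall fun p => sq_nonneg _)]
  refine ENNReal.ofReal_le_ofReal ?_
  have h2 : 0 ≤ ∫ p : E × E, (w (p.1 + p.2) - w p.1) ^ 2 ∂μ :=
    integral_nonneg fun p => sq_nonneg _
  rw [hexp]
  linarith

/-- The mean of `M` over a heat jump. -/
noncomputable def heatMean (t : ℝ) (M : E → ℝ) (x : E) : ℝ := ∫ y, M (x + y) ∂(heatMeasure E t)

/-- The gradient of `heatMean t M`, written as a mean of increments. -/
noncomputable def heatMeanGradient (t : ℝ) (M : E → ℝ) (x : E) : E :=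
  (1 / (2 * t)) • ∫ y, (M (x + y) - M x) • y ∂(heatMeasure E t)

theorem ae_memLp_two_translate {t : ℝ} (ht : 0 < t) {M : E → ℝ} (hM : MemLp M 2) :
    ∀ᵐ x : E, MemLp (fun y => M (x + y)) 2 (heatMeasure E t) := by
  have := isProbabilityMeasure_heatMeasure (E := E) ht
  have hM1 : MemLp (fun p : E × E => M (p.1 + p.2)) 2 (volume.prod (heatMeasure E t)) :=
    hM.comp_measurePreserving (measurePreserving_heat_add ht)
  have h1 := ((memLp_two_iff_integrable_sq hM1.1).1 hM1).prod_right_ae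
  filter_upwards [h1, hM1.1.prodMk_left] with x hx hx'
  exact (memLp_two_iff_integrable_sq hx').2 hx

theorem aestronglyMeasurable_heatMean (t : ℝ) {M : E → ℝ} (hM : Measurable M) :
    AEStronglyMeasurable (heatMean t M) := by
  have h : StronglyMeasurable fun p : E × E => M (p.1 + p.2) :=
    (hM.comp (measurable_fst.add measurable_snd)).stronglyMeasurable
  exact h.integral_prod_right'.aestronglyMeasurable

theorem aestronglyMeasurable_heatMeanGradient (t : ℝ) {M : E → ℝ} (hM : Measurable M) :
    AEStronglyMeasurable (heatMeanGradient t M) := by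
  have h : StronglyMeasurable fun p : E × E => (M (p.1 + p.2) - M p.1) • p.2 :=
    (((hM.comp (measurable_fst.add measurable_snd)).sub (hM.comp measurable_fst)).smul
      measurable_snd).stronglyMeasurable
  exact (h.integral_prod_right'.const_smul (1 / (2 * t))).aestronglyMeasurable

theorem lintegral_heatMean_sub_sq_le {t : ℝ} (ht : 0 < t) {M : E → ℝ} (hM : Measurable M)
    (hM2 : MemLp M 2) : ∫⁻ x, ‖heatMean t M x - M x‖ₑ ^ 2 ≤ heatEnergy t M := by
  have := isProbabilityMeasure_heatMeasure (E := E) ht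
  have hm1 : Measurable fun p : E × E => ENNReal.ofReal ((M (p.1 + p.2) - M p.1) ^ 2) :=
    (((hM.comp (measurable_fst.add measurable_snd)).sub (hM.comp measurable_fst)).pow_const
      2).ennreal_ofReal
  unfold heatEnergy
  rw [lintegral_prod _ hm1.aemeasurable]
  refine lintegral_mono_ae ?_
  filter_upwards [ae_memLp_two_translate ht hM2] with x hx
  have h1 : heatMean t M x - M x = ∫ y, (M (x + y) - M x) ∂(heatMeasure E t) := by
    rw [integral_sub (hx.integrable one_le_two) (integrable_const _), integral_const]
    simp [heatMean]
  rw [h1]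
  have h2 : Measurable fun y => M (x + y) - M x :=
    (hM.comp (measurable_const_add x)).sub_const _
  refine (enorm_integral_sq_le h2.aestronglyMeasurable).trans (le_of_eq ?_)
  refine lintegral_congr fun y => ?_
  rw [Real.enorm_eq_ofReal_abs, ← ENNReal.ofReal_pow (abs_nonneg _), sq_abs]

/-- Duality: pairing `G` with its own defining mean gives `2t‖G‖²` as the mean of `(M(x+y) - M(x))
⟨G, y⟩`. By Cauchy–Schwarz and the second moment bound `2t‖G‖²`, one factor cancels. The constant
`2t` is the one in `heatEnergy_le_of_isWeakGradient`, so nothing is lost when the two are combined.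
-/
theorem enorm_heatMeanGradient_sq_le {t : ℝ} (ht : 0 < t) {M : E → ℝ} (hM : Measurable M) (x : E) :
    ENNReal.ofReal (2 * t) * ‖heatMeanGradient t M x‖ₑ ^ 2 ≤
      ∫⁻ y, ENNReal.ofReal ((M (x + y) - M x) ^ 2) ∂(heatMeasure E t) := by
  set G := heatMeanGradient t M x with hG
  by_cases hint : Integrable (fun y => (M (x + y) - M x) • y) (heatMeasure E t)
  swap
  · have : G = 0 := by rw [hG, heatMeanGradient, integral_undef hint, smul_zero]
    simp [this]
  by_cases hG0 : G = 0
  · simp [hG0]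
  set q := ∫⁻ y, ENNReal.ofReal ((M (x + y) - M x) ^ 2) ∂(heatMeasure E t) with hq
  have hd : Measurable fun y => M (x + y) - M x :=
    (hM.comp (measurable_const_add x)).sub_const _
  have h1 : 2 * t * ‖G‖ ^ 2 = ∫ y, (M (x + y) - M x) * inner ℝ G y ∂(heatMeasure E t) := by
    have h2 : (2 * t) • G = ∫ y, (M (x + y) - M x) • y ∂(heatMeasure E t) := by
      rw [hG, heatMeanGradient, smul_smul, mul_one_div_cancel (by positivity), one_smul]
    have h3 : inner ℝ G ((2 * t) • G) = 2 * t * ‖G‖ ^ 2 := by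
      rw [inner_smul_right, real_inner_self_eq_norm_sq]
    rw [← h3, h2, ← integral_inner hint]
    simp only [inner_smul_right]
  have h4 : ENNReal.ofReal (2 * t * ‖G‖ ^ 2) ≤
      ∫⁻ y, ‖M (x + y) - M x‖ₑ * ‖inner ℝ G y‖ₑ ∂(heatMeasure E t) := by
    have h5 : ENNReal.ofReal (2 * t * ‖G‖ ^ 2) = ‖2 * t * ‖G‖ ^ 2‖ₑ := by
      rw [Real.enorm_of_nonneg (by positivity)]
    rw [h5, h1]
    refine (enorm_integral_le_lintegral_enorm _).trans (le_of_eq ?_)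
    simp only [enorm_mul]
  have h6 := ENNReal.sq_lintegral_mul_le (μ := heatMeasure E t) hd.enorm.aemeasurable
    (b := fun y : E => ‖inner ℝ G y‖ₑ) (by fun_prop)
  simp only [Real.enorm_eq_ofReal_abs, ← ENNReal.ofReal_pow (abs_nonneg _), sq_abs] at h4 h6
  have h7 : ENNReal.ofReal (2 * t * ‖G‖ ^ 2) ^ 2 ≤ q * ENNReal.ofReal (2 * t * ‖G‖ ^ 2) :=
    (pow_le_pow_left₀ bot_le h4 2).trans
      (h6.trans (mul_le_mul_right (lintegral_inner_sq_heatMeasure_le ht G) _))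
  have hpos : 0 < ‖G‖ := norm_pos_iff.2 hG0
  rw [sq, ENNReal.mul_le_mul_iff_left (by simpa using by positivity) ENNReal.ofReal_ne_top] at h7
  rwa [ENNReal.ofReal_mul (by positivity), ENNReal.ofReal_pow (norm_nonneg _), ofReal_norm] at h7

theorem lintegral_heatMeanGradient_sq_le {t : ℝ} (ht : 0 < t) {M : E → ℝ} (hM : Measurable M) :
    ENNReal.ofReal (2 * t) * ∫⁻ x, ‖heatMeanGradient t M x‖ₑ ^ 2 ≤ heatEnergy t M := by
  have hm1 : Measurable fun p : E × E => ENNReal.ofReal ((M (p.1 + p.2) - M p.1) ^ 2) :=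
    (((hM.comp (measurable_fst.add measurable_snd)).sub (hM.comp measurable_fst)).pow_const
      2).ennreal_ofReal
  unfold heatEnergy
  rw [lintegral_prod _ hm1.aemeasurable, ← lintegral_const_mul' _ _ ENNReal.ofReal_ne_top]
  exact lintegral_mono fun x => enorm_heatMeanGradient_sq_le ht hM x

end HeatEnergy

/-! ### The weak gradient of a heat mean -/

section HeatMeanGradient

variable {E : Type*} [NormedAddCommGroup E] [InnerProductSpace ℝ E]

theorem hasFDerivAt_heatKernel (t : ℝ) (y : E) :
    HasFDerivAt (heatKernel t) (-(heatKernel t y / (2 * t)) • innerSL ℝ y) y := by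
  have h1 : HasFDerivAt (fun x : E => -‖x‖ ^ 2 / (4 * t)) (-(1 / (2 * t)) • innerSL ℝ y) y := by
    have h2 := ((hasStrictFDerivAt_norm_sq y).hasFDerivAt.const_mul (-(1 / (4 * t))))
    refine (h2.congr_fderiv ?_).congr_of_eventuallyEq (Filter.Eventually.of_forall fun x => ?_)
    · ext v
      simp
      ring
    · simp only
      ring
  have h3 := (h1.exp.const_mul (1 / (4 * Real.pi * t) ^ ((Module.finrank ℝ E : ℝ) / 2)))
  refine h3.congr_fderiv ?_
  ext v
  simp [heatKernel]
  ring

variable [MeasureSpace E] [BorelSpace E] [FiniteDimensional ℝ E]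
  [(volume : Measure E).IsAddHaarMeasure] [HeatNormalized E]

/-- Gaussian integration by parts, from `∇K_t(y) = -(y/2t) K_t(y)`. -/
theorem integral_fderiv_heatMeasure {t : ℝ} (ht : 0 < t) {φ : E → ℝ} (hφ : ContDiff ℝ ∞ φ)
    (hc : HasCompactSupport φ) (x v : E) :
    ∫ y, fderiv ℝ φ (x + y) v ∂(heatMeasure E t) =
      1 / (2 * t) * ∫ y, inner ℝ y v * φ (x + y) ∂(heatMeasure E t) := by
  have hφd : Differentiable ℝ φ := hφ.differentiable (by simp)
  have hc' : HasCompactSupport fun y => φ (x + y) := hc.comp_homeomorph (Homeomorph.addLeft x)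
  have hcont : Continuous fun y => φ (x + y) := hφ.continuous.comp (by fun_prop)
  have hcd : Continuous fun z => fderiv ℝ φ z v :=
    (hφ.continuous_fderiv (by simp)).clm_apply continuous_const
  have hcd' : Continuous fun y => fderiv ℝ φ (x + y) v := hcd.comp (by fun_prop)
  have hcs' : HasCompactSupport fun y => fderiv ℝ φ (x + y) v :=
    (hc.fderiv_apply ℝ v).comp_homeomorph (Homeomorph.addLeft x)
  have hK (y : E) : fderiv ℝ (heatKernel t : E → ℝ) y v = -(heatKernel t y / (2 * t)) * inner ℝ y v := by
    rw [(hasFDerivAt_heatKernel t y).fderiv]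
    simp
  have hg (y : E) : fderiv ℝ (fun y => φ (x + y)) y v = fderiv ℝ φ (x + y) v := by
    rw [fderiv_comp_add_left]
  have hKc := continuous_heatKernel (E := E) t
  have h := integral_mul_fderiv_eq_neg_fderiv_mul_of_integrable (μ := (volume : Measure E))
    (f := heatKernel t) (g := fun y => φ (x + y)) (v := v) ?_ ?_ ?_
    (fun y _ => (hasFDerivAt_heatKernel t y).differentiableAt)
    (fun y _ => (hφd.comp (differentiable_id.const_add x)) y)
  · rw [integral_heatMeasure ht, integral_heatMeasure ht]
    simp only [hK, hg] at h
    simp only [smul_eq_mul]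
    rw [h, ← integral_neg, ← integral_const_mul]
    congr 1
    ext y
    ring
  · simp only [hK]
    refine Continuous.integrable_of_hasCompactSupport (by fun_prop) ?_
    exact hc'.mul_left
  · simp only [hg]
    exact Continuous.integrable_of_hasCompactSupport (by fun_prop) hcs'.mul_left
  · exact Continuous.integrable_of_hasCompactSupport (by fun_prop) hc'.mul_left

theorem memLp_inner_heatMeasure {t : ℝ} (ht : 0 < t) (v : E) :
    MemLp (fun y : E => inner ℝ v y) 2 (heatMeasure E t) := by
  have h1 : AEStronglyMeasurable (fun y : E => inner ℝ v y) (heatMeasure E t) := by fun_prop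
  refine (memLp_two_iff_integrable_sq h1).2 ⟨by fun_prop, ?_⟩
  rw [hasFiniteIntegral_iff_ofReal (Filter.Eventually.of_forall fun y => sq_nonneg _)]
  exact (lintegral_inner_sq_heatMeasure_le ht v).trans_lt ENNReal.ofReal_lt_top

theorem memLp_id_heatMeasure {t : ℝ} (ht : 0 < t) : MemLp (fun y : E => y) 2 (heatMeasure E t) := by
  have h : (fun y : E => y) =
      fun y => ∑ i, inner ℝ (stdOrthonormalBasis ℝ E i) y • stdOrthonormalBasis ℝ E i := by
    ext y
    exact ((stdOrthonormalBasis ℝ E).sum_repr' y).symm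
  rw [h]
  refine memLp_finsetSum _ fun i _ => ?_
  have h1 := memLp_inner_heatMeasure ht (stdOrthonormalBasis ℝ E i)
  exact (ContinuousLinearMap.comp_memLp'
    ((ContinuousLinearMap.id ℝ ℝ).smulRight (stdOrthonormalBasis ℝ E i)) h1)

theorem integral_inner_heatMeasure (t : ℝ) (v : E) :
    ∫ y, inner ℝ y v ∂(heatMeasure E t) = 0 := by
  have h := (measurePreserving_neg_heatMeasure (E := E) t).integral_comp
    (MeasurableEquiv.neg E).measurableEmbedding (fun y => inner ℝ y v)
  simp only [inner_neg_left, integral_neg] at h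
  linarith

/-- Reversing jumps moves the mean from `M` to the test function, where Gaussian integration by
parts produces the factor `y/2t`; reversing again puts that factor on the increments of `M`. Finite
energy makes the gradient square integrable. -/
theorem isWeakGradient_heatMean {t : ℝ} (ht : 0 < t) {M : E → ℝ} (hM : Measurable M)
    (hM2 : MemLp M 2) (hen : heatEnergy t M ≠ ⊤) :
    MemLp (heatMean t M) 2 ∧ IsWeakGradient (heatMean t M) (heatMeanGradient t M) := by
  have := isProbabilityMeasure_heatMeasure (E := E) ht
  set μ := (volume : Measure E).prod (heatMeasure E t) with hμ
  have hP : MemLp (heatMean t M) 2 := by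
    have h1 : MemLp (fun x => heatMean t M x - M x) 2 := by
      refine ⟨(aestronglyMeasurable_heatMean t hM).sub hM.aestronglyMeasurable, ?_⟩
      rw [eLpNorm_lt_top_iff_lintegral_rpow_enorm_lt_top two_ne_zero ENNReal.ofNat_ne_top]
      simpa using (lintegral_heatMean_sub_sq_le ht hM hM2).trans_lt hen.lt_top
    refine (memLp_congr_ae (Filter.Eventually.of_forall fun x => ?_)).1 (h1.add hM2)
    simp
  have hG : MemLp (heatMeanGradient t M) 2 := by
    refine ⟨aestronglyMeasurable_heatMeanGradient t hM, ?_⟩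
    rw [eLpNorm_lt_top_iff_lintegral_rpow_enorm_lt_top two_ne_zero ENNReal.ofNat_ne_top]
    have h1 := (lintegral_heatMeanGradient_sq_le ht hM).trans_lt hen.lt_top
    simp only [ENNReal.toReal_ofNat, ENNReal.rpow_ofNat]
    exact ENNReal.lt_top_of_mul_ne_top_right h1.ne (by simpa using ht)
  refine ⟨hP, hP.locallyIntegrable one_le_two, hG.locallyIntegrable one_le_two,
    fun φ hφ hc v => ?_⟩
  have hcd : Continuous fun z => fderiv ℝ φ z v :=
    (hφ.continuous_fderiv (by simp)).clm_apply continuous_const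
  have hcs : HasCompactSupport fun z => fderiv ℝ φ z v := hc.fderiv_apply ℝ v
  have hφ2 : MemLp φ 2 := hφ.continuous.memLp_of_hasCompactSupport hc
  have hφ2' : MemLp (fun z => fderiv ℝ φ z v) 2 := hcd.memLp_of_hasCompactSupport hcs
  have hadd : MeasurePreserving (fun p : E × E => p.1 + p.2) μ volume := measurePreserving_heat_add ht
  have hfst : MeasurePreserving (Prod.fst : E × E → E) μ volume := measurePreserving_fst
  have hM1 : MemLp (fun p : E × E => M (p.1 + p.2)) 2 μ := hM2.comp_measurePreserving hadd
  have hM0 : MemLp (fun p : E × E => M p.1) 2 μ := hM2.comp_measurePreserving hfst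
  have hd0 : MemLp (fun p : E × E => fderiv ℝ φ p.1 v) 2 μ := hφ2'.comp_measurePreserving hfst
  have hd1 : MemLp (fun p : E × E => fderiv ℝ φ (p.1 + p.2) v) 2 μ :=
    hφ2'.comp_measurePreserving hadd
  have hψ : MemLp (fun p : E × E => inner ℝ p.2 v * φ p.1) 2 μ := by
    have hmeas : AEStronglyMeasurable (fun p : E × E => inner ℝ p.2 v * φ p.1) μ := by
      have := hφ.continuous
      exact Continuous.aestronglyMeasurable (by fun_prop)
    refine (memLp_two_iff_integrable_sq hmeas).2 ?_
    refine ((hφ2.integrable_sq).mul_prod (memLp_inner_heatMeasure ht v).integrable_sq).congr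
      (Filter.Eventually.of_forall fun p => ?_)
    simp only [real_inner_comm v]
    ring
  have hψ1 : MemLp (fun p : E × E => inner ℝ p.2 v * φ (p.1 + p.2)) 2 μ := by
    have h1 := (hψ.comp_measurePreserving (measurePreserving_heat_reverse t)).neg
    refine (memLp_congr_ae (Filter.Eventually.of_forall fun p => ?_)).1 h1
    simp [Function.comp]
  have hi3 : Integrable (fun p : E × E => M (p.1 + p.2) * fderiv ℝ φ p.1 v) μ :=
    hM1.integrable_mul hd0
  have hi4 : Integrable (fun p : E × E => M p.1 * fderiv ℝ φ (p.1 + p.2) v) μ :=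
    hM0.integrable_mul hd1
  have hlhs : ∫ x, heatMean t M x * fderiv ℝ φ x v =
      ∫ x, M x * ∫ y, fderiv ℝ φ (x + y) v ∂(heatMeasure E t) := by
    calc ∫ x, heatMean t M x * fderiv ℝ φ x v
        = ∫ p : E × E, M (p.1 + p.2) * fderiv ℝ φ p.1 v ∂μ := by
          rw [integral_prod _ hi3]
          simp only [integral_mul_const]
          rfl
      _ = ∫ p : E × E, M p.1 * fderiv ℝ φ (p.1 + p.2) v ∂μ := by
          rw [hμ, ← integral_heat_reverse t fun p : E × E => M p.1 * fderiv ℝ φ (p.1 + p.2) v]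
          simp
      _ = _ := by
          rw [integral_prod _ hi4]
          simp only [integral_const_mul]
  have hGv : ∀ᵐ x, inner ℝ (heatMeanGradient t M x) v =
      1 / (2 * t) * ∫ y, (M (x + y) - M x) * inner ℝ y v ∂(heatMeasure E t) := by
    filter_upwards [ae_memLp_two_translate ht hM2] with x hx
    have hint : Integrable (fun y => (M (x + y) - M x) • y) (heatMeasure E t) :=
      memLp_one_iff_integrable.1 ((memLp_id_heatMeasure ht).smul (hx.sub (memLp_const (M x))))
    rw [heatMeanGradient, inner_smul_left, real_inner_comm, ← integral_inner hint]
    simp [inner_smul_right, real_inner_comm v]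
  have hi1 : Integrable (fun p : E × E => M (p.1 + p.2) * (inner ℝ p.2 v * φ p.1)) μ :=
    hM1.integrable_mul hψ
  have hi0 : Integrable (fun p : E × E => M p.1 * (inner ℝ p.2 v * φ p.1)) μ :=
    hM0.integrable_mul hψ
  have hi2 : Integrable (fun p : E × E => M p.1 * (inner ℝ p.2 v * φ (p.1 + p.2))) μ :=
    hM0.integrable_mul hψ1
  have hi5 : Integrable (fun p : E × E => M (p.1 + p.2) * (inner ℝ p.2 v * φ p.1) -
      M p.1 * (inner ℝ p.2 v * φ p.1)) μ := hi1.sub hi0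
  have hrhs : ∫ x, inner ℝ (heatMeanGradient t M x) v * φ x =
      - (1 / (2 * t) * ∫ x, M x * ∫ y, inner ℝ y v * φ (x + y) ∂(heatMeasure E t)) := by
    calc ∫ x, inner ℝ (heatMeanGradient t M x) v * φ x
        = ∫ x, 1 / (2 * t) * ∫ y, (M (x + y) * (inner ℝ y v * φ x) - M x * (inner ℝ y v * φ x))
            ∂(heatMeasure E t) := by
          refine integral_congr_ae ?_
          filter_upwards [hGv] with x hx
          rw [hx, mul_assoc, ← integral_mul_const]
          congr 2
          ext y
          ring
      _ = 1 / (2 * t) * ∫ p : E × E, (M (p.1 + p.2) * (inner ℝ p.2 v * φ p.1) -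
            M p.1 * (inner ℝ p.2 v * φ p.1)) ∂μ := by
          rw [integral_const_mul, integral_prod _ hi5]
      _ = 1 / (2 * t) * ((∫ p : E × E, M (p.1 + p.2) * (inner ℝ p.2 v * φ p.1) ∂μ) -
            ∫ p : E × E, M p.1 * (inner ℝ p.2 v * φ p.1) ∂μ) := by
          rw [integral_sub hi1 hi0]
      _ = 1 / (2 * t) * (- ∫ p : E × E, M p.1 * (inner ℝ p.2 v * φ (p.1 + p.2)) ∂μ) := by
          -- Jumps have mean zero, so the subtracted `M x` in `heatMeanGradient` contributes nothing
          -- here; it is present so that the energy controls the gradient.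
          have h1 : ∫ p : E × E, M p.1 * (inner ℝ p.2 v * φ p.1) ∂μ = 0 := by
            rw [integral_prod _ hi0]
            simp only [integral_const_mul, integral_mul_const, integral_inner_heatMeasure]
            simp
          rw [h1, sub_zero, hμ, ← integral_heat_reverse t
            fun p : E × E => M p.1 * (inner ℝ p.2 v * φ (p.1 + p.2)), ← integral_neg]
          simp
      _ = _ := by
          rw [integral_prod _ hi2]
          simp only [integral_const_mul]
          ring
  rw [hlhs, hrhs, neg_neg, ← integral_const_mul]
  refine integral_congr_ae (Filter.Eventually.of_forall fun x => ?_)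
  simp only
  rw [integral_fderiv_heatMeasure ht hφ hc x v]
  ring

end HeatMeanGradient

/-! ### Weak limits of gradients in `L²` -/

section WeakLimit

variable {E : Type*} [NormedAddCommGroup E] [InnerProductSpace ℝ E] [MeasureSpace E]

/-- Banach–Alaoglu, with convergence along an ultrafilter on `ℕ` instead of a subsequence, so that
separability plays no role. -/
theorem exists_weak_limit {H : Type*} [NormedAddCommGroup H] [InnerProductSpace ℝ H]
    [CompleteSpace H] (x : ℕ → H) {C : ℝ} (hx : ∀ n, ‖x n‖ ≤ C) :
    ∃ y : H, ‖y‖ ≤ C ∧ ∀ z, Filter.Tendsto (fun n => inner ℝ (x n) z)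
      (Filter.hyperfilter ℕ : Filter ℕ) (nhds (inner ℝ y z)) := by
  set F : ℕ → WeakDual ℝ H := fun n =>
    StrongDual.toWeakDual (InnerProductSpace.toDual ℝ H (x n)) with hF
  have hcomp := WeakDual.isCompact_closedBall (𝕜 := ℝ) (E := H) 0 C
  obtain ⟨w, hw, hlim⟩ := hcomp.ultrafilter_le_nhds (Ultrafilter.map F (Filter.hyperfilter ℕ)) (by
    rw [Filter.le_principal_iff]
    refine Filter.mem_map.2 (Filter.Eventually.of_forall fun n => ?_)
    simpa [hF] using hx n)
  refine ⟨(InnerProductSpace.toDual ℝ H).symm (WeakDual.toStrongDual w), ?_, fun z => ?_⟩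
  · rw [LinearIsometryEquiv.norm_map]
    simpa using hw
  · rw [InnerProductSpace.toDual_symm_apply]
    have h1 : Filter.Tendsto F (Filter.hyperfilter ℕ : Filter ℕ) (nhds w) := hlim
    exact ((WeakDual.eval_continuous z).tendsto w).comp h1

variable [BorelSpace E] [FiniteDimensional ℝ E] [(volume : Measure E).IsAddHaarMeasure]

/-- Both sides of the weak gradient identity are `L²` pairings, so it survives a strong limit of the
functions and a weak limit of the gradients; the norm bound is kept by `exists_weak_limit`. -/
theorem exists_isWeakGradient_of_tendsto_L2 {U : E → ℝ} {v : ℕ → E → ℝ} {G : ℕ → E → E} {C : ℝ}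
    (hU : MemLp U 2) (hv : ∀ n, MemLp (v n) 2) (hG : ∀ n, MemLp (G n) 2)
    (hw : ∀ n, IsWeakGradient (v n) (G n))
    (hGC : ∀ n, eLpNorm (G n) 2 volume ≤ ENNReal.ofReal C) (hC : 0 ≤ C)
    (hlim : Filter.Tendsto (fun n => eLpNorm (v n - U) 2 volume) Filter.atTop (nhds 0)) :
    ∃ g : E → E, MemLp g 2 ∧ IsWeakGradient U g ∧ eLpNorm g 2 volume ≤ ENNReal.ofReal C := by
  obtain ⟨y, hy, hylim⟩ := exists_weak_limit (fun n => (hG n).toLp (G n)) (C := C) fun n => by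
    rw [Lp.norm_toLp]
    exact ENNReal.toReal_le_of_le_ofReal hC (hGC n)
  refine ⟨y, Lp.memLp y, ⟨hU.locallyIntegrable one_le_two,
    (Lp.memLp y).locallyIntegrable one_le_two, fun φ hφ hc w => ?_⟩, ?_⟩
  · have hcd : Continuous fun z => fderiv ℝ φ z w :=
      (hφ.continuous_fderiv (by simp)).clm_apply continuous_const
    have hφ2' : MemLp (fun z => fderiv ℝ φ z w) 2 :=
      hcd.memLp_of_hasCompactSupport (hc.fderiv_apply ℝ w)
    have hφw : MemLp (fun z => φ z • w) 2 :=
      (hφ.continuous.smul continuous_const).memLp_of_hasCompactSupport hc.smul_right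
    have hinner (f : E → E) (hf : MemLp f 2) :
        inner ℝ (hf.toLp f) (hφw.toLp _) = ∫ x, inner ℝ (f x) w * φ x := by
      rw [L2.inner_def]
      refine integral_congr_ae ?_
      filter_upwards [hf.coeFn_toLp, hφw.coeFn_toLp] with x h1 h2
      rw [h1, h2, inner_smul_right, mul_comm]
    have hinner' (f : E → ℝ) (hf : MemLp f 2) :
        inner ℝ (hf.toLp f) (hφ2'.toLp _) = ∫ x, f x * fderiv ℝ φ x w := by
      rw [L2.inner_def]
      refine integral_congr_ae ?_
      filter_upwards [hf.coeFn_toLp, hφ2'.coeFn_toLp] with x h1 h2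
      rw [h1, h2]
      simp [mul_comm]
    have hvU : Filter.Tendsto (fun n => (hv n).toLp (v n)) Filter.atTop (nhds (hU.toLp U)) :=
      (Lp.tendsto_Lp_iff_tendsto_eLpNorm'' v hv U hU).2 hlim
    have h1 : Filter.Tendsto (fun n => ∫ x, v n x * fderiv ℝ φ x w)
        (Filter.hyperfilter ℕ : Filter ℕ) (nhds (∫ x, U x * fderiv ℝ φ x w)) := by
      have h2 := (hvU.inner (tendsto_const_nhds (x := hφ2'.toLp _)) (𝕜 := ℝ))
      simp only [hinner'] at h2
      exact h2.mono_left Nat.hyperfilter_le_atTop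
    have h3 := hylim (hφw.toLp _)
    simp only [hinner] at h3
    have h4 : inner ℝ y (hφw.toLp _) = ∫ x, inner ℝ (y x) w * φ x := by
      rw [← hinner y (Lp.memLp y), Lp.toLp_coeFn]
    rw [h4] at h3
    refine tendsto_nhds_unique h1 (h3.neg.congr fun n => ?_)
    exact ((hw n).2.2 φ hφ hc w).symm
  · rw [← ENNReal.ofReal_toReal (Lp.memLp y).2.ne]
    exact ENNReal.ofReal_le_ofReal hy

end WeakLimit

/-! ### The case `W^{1,2}` in every dimension -/

section SobolevTwo

theorem eLpNorm_two_eq {α F : Type*} [MeasurableSpace α] {μ : Measure α} [NormedAddCommGroup F]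
    (f : α → F) : eLpNorm f 2 μ = (∫⁻ x, ‖f x‖ₑ ^ 2 ∂μ) ^ (1 / 2 : ℝ) := by
  rw [eLpNorm_eq_lintegral_rpow_enorm_toReal two_ne_zero ENNReal.ofNat_ne_top]
  simp

variable {E : Type*} [NormedAddCommGroup E] [InnerProductSpace ℝ E] [MeasureSpace E]
  [BorelSpace E] [FiniteDimensional ℝ E] [(volume : Measure E).IsAddHaarMeasure]
  [HeatNormalized E]

theorem lintegral_ofReal_abs_rpow_eq {α : Type*} [MeasurableSpace α] {μ : Measure α} (u : α → ℝ)
    {p : ℝ} (hp : 0 < p) :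
    ∫⁻ x, ENNReal.ofReal (|u x| ^ p) ∂μ = ∫⁻ x, ‖u x‖ₑ ^ p ∂μ := by
  refine lintegral_congr fun x => ?_
  rw [Real.enorm_eq_ofReal_abs, ENNReal.ofReal_rpow_of_nonneg (abs_nonneg _) hp.le]

/-- The heat maximal function is bounded on `L^p` for `1 < p < ∞`. -/
theorem memLp_heatMaximal {u : E → ℝ} (hum : Measurable u) {p : ℝ≥0∞} (hp : 1 < p) (hpt : p ≠ ⊤)
    (hu : MemLp u p) :
    (∀ᵐ x, heatMaximal u x < ⊤) ∧ MemLp (fun x => (heatMaximal u x).toReal) p := by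
  have hp0 : p ≠ 0 := (zero_lt_one.trans hp).ne'
  have hp1 : 1 < p.toReal := by
    rw [← ENNReal.toReal_one]
    exact (ENNReal.toReal_lt_toReal ENNReal.one_ne_top hpt).2 hp
  have hpp : 0 < p.toReal := zero_lt_one.trans hp1
  have hfin : ∫⁻ x, ENNReal.ofReal (|u x| ^ p.toReal) ≠ ⊤ := by
    rw [lintegral_ofReal_abs_rpow_eq u hpp]
    exact ((eLpNorm_lt_top_iff_lintegral_rpow_enorm_lt_top hp0 hpt).1 hu.2).ne
  refine ⟨heatMaximal_lt_top_ae hum hp1 hfin,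
    (measurable_heatMaximal hum).ennreal_toReal.aestronglyMeasurable, ?_⟩
  rw [eLpNorm_lt_top_iff_lintegral_rpow_enorm_lt_top hp0 hpt, ← lintegral_ofReal_abs_rpow_eq _ hpp]
  simpa only [abs_of_nonneg ENNReal.toReal_nonneg] using
    lintegral_heatMaximal_rpow_lt_top hum hp1 hfin

/-- The maximum of `f` and its heat flow at positive multiples of `ε`. -/
noncomputable def gridMaximalZero (ε : ℝ) (f : E → ℝ≥0∞) (x : E) : ℝ≥0∞ := max (f x) (gridMaximal ε f x)

theorem measurable_gridMaximalZero (ε : ℝ) {f : E → ℝ≥0∞} (hf : Measurable f) :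
    Measurable (gridMaximalZero ε f) := hf.max (measurable_gridMaximal ε hf)

/-- One step is peeled off each positive grid time. The remaining time may be zero, which is why
`gridMaximalZero` includes `f` itself. Where that maximum exceeds `f`, this is the subsolution
property. -/
theorem gridMaximal_le_heatConv {ε : ℝ} (hε : 0 < ε) {f : E → ℝ≥0∞} (hf : Measurable f) (x : E) :
    gridMaximal ε f x ≤ heatConv ε (gridMaximalZero ε f) x := by
  refine iSup_le fun k => ?_
  cases k with
  | zero =>
    simp only [CharP.cast_eq_zero, zero_add, one_mul]
    exact heatConv_mono ε (fun y => le_max_left _ _) x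
  | succ k =>
    have h : (((k + 1 : ℕ) : ℝ) + 1) * ε = ε + ((k : ℝ) + 1) * ε := by push_cast; ring
    rw [h, ← heatConv_heatConv hε (by positivity) hf]
    refine heatConv_mono ε (fun y => le_trans ?_ (le_max_right _ _)) x
    exact le_iSup (fun k : ℕ => heatConv ((k + 1) * ε) f y) k

/-- The approximants are `P_ε S` with `ε = 2⁻ⁿ`. Their gradients are bounded by the norm of `g` with
constant one because the factors `2ε` cancel. The energy bound `2ε‖g‖₂²` also makes `P_ε S - S`
small, and `S → u*` by dominated convergence. -/
theorem exists_isWeakGradient_heatMaximal_two {u : E → ℝ} {g : E → E} (hum : Measurable u) (hgm : Measurable g)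
    (hu : MemLp u 2) (hg : MemLp g 2) (hw : IsWeakGradient u g) :
    ∃ G : E → E, MemLp G 2 ∧ IsWeakGradient (fun x => (heatMaximal u x).toReal) G ∧
      eLpNorm G 2 volume ≤ eLpNorm g 2 volume := by
  set F : E → ℝ≥0∞ := fun y => ENNReal.ofReal |u y| with hF
  have hFm : Measurable F := hum.abs.ennreal_ofReal
  have hFtop (x : E) : F x ≠ ⊤ := ENNReal.ofReal_ne_top
  have hFr (x : E) : (F x).toReal = |u x| := ENNReal.toReal_ofReal (abs_nonneg _)
  set V : E → ℝ := fun x => (heatMaximal u x).toReal with hVdef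
  obtain ⟨hfin, hV⟩ := memLp_heatMaximal hum ENNReal.one_lt_two ENNReal.ofNat_ne_top hu
  have hVm : Measurable V := (measurable_heatMaximal hum).ennreal_toReal
  have habs : MemLp (fun x => |u x|) 2 := hu.norm
  set I := ∫⁻ x, ‖g x‖ₑ ^ 2 with hI
  have hIfin : I ≠ ⊤ := by
    have := (eLpNorm_lt_top_iff_lintegral_rpow_enorm_lt_top two_ne_zero ENNReal.ofNat_ne_top).1 hg.2
    simpa using this.ne
  have hstep : Filter.Tendsto (fun n => ENNReal.ofReal (2 * dyadicStep n) * I) Filter.atTop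
      (nhds 0) := by
    have h1 := ENNReal.tendsto_ofReal (tendsto_dyadicStep.const_mul 2)
    simp only [mul_zero, ENNReal.ofReal_zero] at h1
    simpa using ENNReal.Tendsto.mul_const h1 (Or.inr hIfin)
  set S : ℕ → E → ℝ≥0∞ := fun n => gridMaximalZero (dyadicStep n) F with hS
  set M : ℕ → E → ℝ := fun n x => (S n x).toReal with hM
  have hSm (n : ℕ) : Measurable (S n) := measurable_gridMaximalZero _ hFm
  have hMm (n : ℕ) : Measurable (M n) := (hSm n).ennreal_toReal
  have hgrid (n : ℕ) (x : E) : gridMaximal (dyadicStep n) F x ≤ heatMaximal u x := by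
    rw [heatMaximal_eq_iSup_gridMaximal hum]
    exact le_iSup (fun n => gridMaximal (dyadicStep n) F x) n
  have hSle (n : ℕ) (x : E) : S n x ≤ F x + heatMaximal u x :=
    max_le le_self_add ((hgrid n x).trans le_add_self)
  have hSfin (n : ℕ) : ∀ᵐ x, S n x < ⊤ := by
    filter_upwards [hfin] with x hx
    exact (hSle n x).trans_lt (ENNReal.add_lt_top.2 ⟨(hFtop x).lt_top, hx⟩)
  have hMle (n : ℕ) : ∀ᵐ x, ‖M n x‖ ≤ |u x| + V x := by
    filter_upwards [hfin] with x hx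
    have h1 := ENNReal.toReal_mono (ENNReal.add_ne_top.2 ⟨hFtop x, hx.ne⟩) (hSle n x)
    rw [ENNReal.toReal_add (hFtop x) hx.ne, hFr] at h1
    rwa [Real.norm_of_nonneg ENNReal.toReal_nonneg]
  have hM2 (n : ℕ) : MemLp (M n) 2 :=
    (habs.add hV).mono' (hMm n).aestronglyMeasurable (hMle n)
  have huM (n : ℕ) : ∀ᵐ x, |u x| ≤ M n x := by
    filter_upwards [hSfin n] with x hx
    rw [← hFr]
    exact ENNReal.toReal_mono hx.ne (le_max_left _ _)
  have hsub (n : ℕ) : ∀ᵐ x, |u x| < M n x →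
      M n x ≤ ∫ y, M n (x + y) ∂(heatMeasure E (dyadicStep n)) := by
    have := isProbabilityMeasure_heatMeasure (E := E) (dyadicStep_pos n)
    filter_upwards [hSfin n, ae_memLp_two_translate (dyadicStep_pos n) (hM2 n)] with x hx hx2 hlt
    -- Where the maximum exceeds `|u|`, it comes from the positive times.
    have h1 : S n x = gridMaximal (dyadicStep n) F x := by
      refine max_eq_right (le_of_not_gt fun h => ?_)
      have h2 : S n x = F x := max_eq_left h.le
      rw [hM, ← hFr x] at hlt
      simp only [h2, lt_self_iff_false] at hlt
    have h3 : S n x ≤ ∫⁻ y, S n (x + y) ∂(heatMeasure E (dyadicStep n)) := by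
      rw [h1, ← heatConv_eq_lintegral_heatMeasure _ (hSm n)]
      exact gridMaximal_le_heatConv (dyadicStep_pos n) hFm x
    have h4 : ∀ᵐ y ∂(heatMeasure E (dyadicStep n)), S n (x + y) < ⊤ :=
      (heatMeasure_absolutelyContinuous _).ae_le
        ((measurePreserving_add_left volume x).quasiMeasurePreserving.ae (hSfin n))
    have h5 : ∫⁻ y, S n (x + y) ∂(heatMeasure E (dyadicStep n)) =
        ENNReal.ofReal (∫ y, M n (x + y) ∂(heatMeasure E (dyadicStep n))) := by
      rw [ofReal_integral_eq_lintegral_ofReal (hx2.integrable one_le_two)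
        (Filter.Eventually.of_forall fun y => ENNReal.toReal_nonneg)]
      refine lintegral_congr_ae ?_
      filter_upwards [h4] with y hy
      exact (ENNReal.ofReal_toReal hy.ne).symm
    rw [h5] at h3
    exact ENNReal.toReal_le_of_le_ofReal (integral_nonneg fun y => ENNReal.toReal_nonneg) h3
  have hEu (n : ℕ) : heatEnergy (dyadicStep n) (fun x => |u x|) ≤
      ENNReal.ofReal (2 * dyadicStep n) * I :=
    (heatEnergy_abs_le _ u).trans (heatEnergy_le_of_isWeakGradient (dyadicStep_pos n) hum hgm hw)
  have hEM (n : ℕ) : heatEnergy (dyadicStep n) (M n) ≤ ENNReal.ofReal (2 * dyadicStep n) * I :=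
    (heatEnergy_le_of_subsolution (dyadicStep_pos n) habs (hM2 n) (huM n) (hsub n)).trans (hEu n)
  have hEfin (n : ℕ) : heatEnergy (dyadicStep n) (M n) ≠ ⊤ :=
    ne_top_of_le_ne_top (ENNReal.mul_ne_top ENNReal.ofReal_ne_top hIfin) (hEM n)
  -- No Lebesgue differentiation is needed: as `P_ε|u| ≤ u*`, the positive part of `|u| - u*` is at
  -- most the absolute value of `|u| - P_ε|u|`, whose squared norm is at most `2εI`.
  have huV : ∀ᵐ x, |u x| ≤ V x := by
    have h1 (n : ℕ) : ∫⁻ x, ENNReal.ofReal (|u x| - V x) ^ 2 ≤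
        ENNReal.ofReal (2 * dyadicStep n) * I := by
      refine le_trans (lintegral_mono_ae ?_) ((lintegral_heatMean_sub_sq_le (dyadicStep_pos n)
        hum.abs habs).trans (hEu n))
      have := isProbabilityMeasure_heatMeasure (E := E) (dyadicStep_pos n)
      filter_upwards [hfin, ae_memLp_two_translate (dyadicStep_pos n) habs] with x hx hx2
      have h2 : heatMean (dyadicStep n) (fun x => |u x|) x ≤ V x := by
        have h3 : ENNReal.ofReal (heatMean (dyadicStep n) (fun x => |u x|) x) ≤ heatMaximal u x := by
          rw [heatMean, ofReal_integral_eq_lintegral_ofReal (hx2.integrable one_le_two)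
            (Filter.Eventually.of_forall fun y => abs_nonneg _),
            ← heatConv_eq_lintegral_heatMeasure _ hFm, heatMaximal_eq]
          exact le_iSup₂ (f := fun (t : ℝ) (_ : 0 < t) => heatConv t F x) _ (dyadicStep_pos n)
        exact (ENNReal.ofReal_le_iff_le_toReal hx.ne).1 h3
      gcongr
      rw [Real.enorm_eq_ofReal_abs]
      refine ENNReal.ofReal_le_ofReal ?_
      rw [abs_sub_comm]
      exact (by linarith : |u x| - V x ≤ |u x| - heatMean (dyadicStep n) (fun x => |u x|) x).trans
        (le_abs_self _)
    have h2 : ∫⁻ x, ENNReal.ofReal (|u x| - V x) ^ 2 = 0 :=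
      le_antisymm (ge_of_tendsto' hstep h1) bot_le
    have hmeas : Measurable fun x => ENNReal.ofReal (|u x| - V x) ^ 2 :=
      (hum.abs.sub hVm).ennreal_ofReal.pow_const 2
    rw [lintegral_eq_zero_iff hmeas] at h2
    filter_upwards [h2] with x hx
    have h3 : ENNReal.ofReal (|u x| - V x) = 0 := by simpa using hx
    linarith [ENNReal.ofReal_eq_zero.1 h3]
  have hSlim : ∀ᵐ x, Filter.Tendsto (fun n => M n x) Filter.atTop (nhds (V x)) := by
    filter_upwards [hfin, huV] with x hx hux
    have h1 : Filter.Tendsto (fun n => gridMaximal (dyadicStep n) F x) Filter.atTop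
        (nhds (heatMaximal u x)) := by
      rw [heatMaximal_eq_iSup_gridMaximal hum]
      exact tendsto_atTop_iSup (monotone_gridMaximal_dyadicStep F x)
    have h2 : Filter.Tendsto (fun n => S n x) Filter.atTop (nhds (heatMaximal u x)) := by
      have h3 := (tendsto_const_nhds (x := F x)).max h1
      rwa [max_eq_right] at h3
      exact ENNReal.ofReal_le_of_le_toReal hux
    exact (ENNReal.tendsto_toReal hx.ne).comp h2
  have hMV : Filter.Tendsto (fun n => eLpNorm (M n - V) 2 volume) Filter.atTop (nhds 0) := by
    have h1 : Filter.Tendsto (fun n => ∫⁻ x, ‖M n x - V x‖ₑ ^ 2) Filter.atTop (nhds 0) := by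
      have hbd : MemLp (fun x => |u x| + 2 * V x) 2 := habs.add (hV.const_mul 2)
      have h2 := tendsto_lintegral_of_dominated_convergence (μ := (volume : Measure E))
        (F := fun n x => ‖M n x - V x‖ₑ ^ 2) (f := fun _ => 0)
        (fun x => ‖|u x| + 2 * V x‖ₑ ^ 2) ?_ ?_ ?_ ?_
      · simpa using h2
      · exact fun n => ((hMm n).sub hVm).enorm.pow_const 2
      · intro n
        filter_upwards [hMle n] with x hx
        gcongr
        rw [enorm_le_iff_norm_le]
        refine (norm_sub_le _ _).trans (le_trans ?_ (le_abs_self _))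
        rw [Real.norm_of_nonneg (r := V x) ENNReal.toReal_nonneg]
        linarith
      · have := (eLpNorm_lt_top_iff_lintegral_rpow_enorm_lt_top two_ne_zero
          ENNReal.ofNat_ne_top).1 hbd.2
        simpa using this.ne
      · filter_upwards [hSlim] with x hx
        have h3 := ((ENNReal.continuous_pow 2).tendsto _).comp ((hx.sub_const (V x)).enorm)
        simpa [Function.comp_def] using h3
    have h4 := (ENNReal.continuous_rpow_const (y := (1 / 2 : ℝ))).tendsto 0 |>.comp h1
    simp only [eLpNorm_two_eq]
    simpa [Function.comp_def] using h4
  have hmean (n : ℕ) := isWeakGradient_heatMean (dyadicStep_pos n) (hMm n) (hM2 n) (hEfin n)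
  have hGI (n : ℕ) : ∫⁻ x, ‖heatMeanGradient (dyadicStep n) (M n) x‖ₑ ^ 2 ≤ I := by
    have h1 := (lintegral_heatMeanGradient_sq_le (dyadicStep_pos n) (hMm n)).trans (hEM n)
    have h2 : 0 < 2 * dyadicStep n := mul_pos two_pos (dyadicStep_pos n)
    exact (ENNReal.mul_le_mul_iff_right (by simpa using dyadicStep_pos n) ENNReal.ofReal_ne_top).1 h1
  have hGnorm (n : ℕ) : eLpNorm (heatMeanGradient (dyadicStep n) (M n)) 2 volume ≤
      eLpNorm g 2 volume := by
    rw [eLpNorm_two_eq, eLpNorm_two_eq]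
    exact ENNReal.rpow_le_rpow (hGI n) (by norm_num)
  have hlim : Filter.Tendsto (fun n => eLpNorm (heatMean (dyadicStep n) (M n) - V) 2 volume)
      Filter.atTop (nhds 0) := by
    have h1 : Filter.Tendsto (fun n => eLpNorm (heatMean (dyadicStep n) (M n) - M n) 2 volume)
        Filter.atTop (nhds 0) := by
      have h2 : Filter.Tendsto (fun n => ∫⁻ x, ‖heatMean (dyadicStep n) (M n) x - M n x‖ₑ ^ 2)
          Filter.atTop (nhds 0) :=
        tendsto_of_tendsto_of_tendsto_of_le_of_le tendsto_const_nhds hstep (fun _ => bot_le)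
          fun n => (lintegral_heatMean_sub_sq_le (dyadicStep_pos n) (hMm n) (hM2 n)).trans (hEM n)
      have h4 := (ENNReal.continuous_rpow_const (y := (1 / 2 : ℝ))).tendsto 0 |>.comp h2
      simp only [eLpNorm_two_eq]
      simpa [Function.comp_def] using h4
    have h5 := h1.add hMV
    rw [add_zero] at h5
    refine tendsto_of_tendsto_of_tendsto_of_le_of_le tendsto_const_nhds h5 (fun _ => bot_le)
      fun n => ?_
    have h6 := eLpNorm_add_le (μ := (volume : Measure E))
      ((hmean n).1.sub (hM2 n)).1 ((hM2 n).sub hV).1 one_le_two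
    rwa [sub_add_sub_cancel] at h6
  obtain ⟨G, hG2, hGw, hGle⟩ := exists_isWeakGradient_of_tendsto_L2 (C := (eLpNorm g 2 volume).toReal)
    hV (fun n => (hmean n).1)
    (fun n => ⟨aestronglyMeasurable_heatMeanGradient _ (hMm n), (hGnorm n).trans_lt hg.2⟩)
    (fun n => (hmean n).2) (fun n => by rw [ENNReal.ofReal_toReal hg.2.ne]; exact hGnorm n)
    ENNReal.toReal_nonneg hlim
  exact ⟨G, hG2, hGw, by rwa [ENNReal.ofReal_toReal hg.2.ne] at hGle⟩

/-- The `W^{1,2}` case of the regularity theorem, valid in all dimensions. -/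
theorem heatMaximal_memW1_two {u : E → ℝ} (hu : MemW1 2 u) :
    (∀ᵐ x, heatMaximal u x < ⊤) ∧ MemW1 2 (fun x => (heatMaximal u x).toReal) ∧
      ∀ g₀ g : E → E, IsWeakGradient u g₀ →
        IsWeakGradient (fun x => (heatMaximal u x).toReal) g →
        eLpNorm g 2 volume ≤ eLpNorm g₀ 2 volume := by
  obtain ⟨hu2, g₁, hg₁, hg₁2⟩ := hu
  have hae := hu2.1.ae_eq_mk
  have hgae := hg₁2.1.ae_eq_mk
  have hmax : heatMaximal u = heatMaximal (hu2.1.mk u) := funext fun x => heatMaximal_congr hae x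
  have hum := hu2.1.stronglyMeasurable_mk.measurable
  have hu2' : MemLp (hu2.1.mk u) 2 := hu2.ae_eq hae
  obtain ⟨hfin, hV⟩ := memLp_heatMaximal hum ENNReal.one_lt_two ENNReal.ofNat_ne_top hu2'
  obtain ⟨G, hG2, hGw, hGle⟩ := exists_isWeakGradient_heatMaximal_two hum hg₁2.1.stronglyMeasurable_mk.measurable hu2'
    (hg₁2.ae_eq hgae) (hg₁.congr hae hgae)
  rw [hmax]
  refine ⟨hfin, ⟨hV, G, hGw, hG2⟩, fun g₀ g hg₀ hg => ?_⟩
  rw [eLpNorm_congr_ae (hg.ae_unique hGw), eLpNorm_congr_ae (hg₀.ae_unique hg₁),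
    eLpNorm_congr_ae hgae]
  exact hGle

end SobolevTwo

/-! ### Polygonal energies of convex functions -/

section PolygonalEnergy

/-- `Φ` is a convex function with minimum `Φ 0 = 0`, presented by a subgradient `c`. -/
structure IsConvexEnergy (Φ c : ℝ → ℝ) : Prop where
  zero : Φ 0 = 0
  subgradient_zero : c 0 = 0
  le : ∀ s r, Φ s + c s * (r - s) ≤ Φ r

theorem IsConvexEnergy.nonneg {Φ c : ℝ → ℝ} (h : IsConvexEnergy Φ c) (r : ℝ) : 0 ≤ Φ r := by
  simpa [h.zero, h.subgradient_zero] using h.le 0 r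

theorem IsConvexEnergy.monotone {Φ c : ℝ → ℝ} (h : IsConvexEnergy Φ c) : Monotone c := by
  intro s r hsr
  rcases hsr.eq_or_lt with rfl | hlt
  · exact le_rfl
  · nlinarith [h.le s r, h.le r s]

/-- The energy of the affine interpolation of `f` between `a` and `b`. -/
noncomputable def pieceEnergy (Φ f : ℝ → ℝ) (a b : ℝ) : ℝ :=
  (b - a) * Φ ((f b - f a) / (b - a))

/-- The energy of the piecewise affine interpolation of `f` at the points of a list. -/
noncomputable def polygonalEnergy (Φ f : ℝ → ℝ) : List ℝ → ℝ
  | [] => 0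
  | [_] => 0
  | a :: b :: l => pieceEnergy Φ f a b + polygonalEnergy Φ f (b :: l)

variable {Φ c : ℝ → ℝ}

theorem IsConvexEnergy.pieceEnergy_le (h : IsConvexEnergy Φ c) (f : ℝ → ℝ) {a b : ℝ} (hab : a < b)
    (s : ℝ) : (b - a) * Φ s + c s * (f b - f a - (b - a) * s) ≤ pieceEnergy Φ f a b := by
  have h1 : 0 < b - a := sub_pos.2 hab
  have h2 := mul_le_mul_of_nonneg_left (h.le s ((f b - f a) / (b - a))) h1.le
  unfold pieceEnergy
  calc _ = (b - a) * (Φ s + c s * ((f b - f a) / (b - a) - s)) := by field_simp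
    _ ≤ _ := h2

theorem IsConvexEnergy.pieceEnergy_nonneg (h : IsConvexEnergy Φ c) (f : ℝ → ℝ) {a b : ℝ}
    (hab : a < b) : 0 ≤ pieceEnergy Φ f a b :=
  mul_nonneg (sub_pos.2 hab).le (h.nonneg _)

/-- Use the supporting line of `Φ` at the slope over `[a, b]`: its linear errors on the two pieces
cancel. -/
theorem IsConvexEnergy.pieceEnergy_le_add (h : IsConvexEnergy Φ c) (f : ℝ → ℝ) {a m b : ℝ}
    (ham : a < m) (hmb : m < b) :
    pieceEnergy Φ f a b ≤ pieceEnergy Φ f a m + pieceEnergy Φ f m b := by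
  have h1 := h.pieceEnergy_le f ham ((f b - f a) / (b - a))
  have h2 := h.pieceEnergy_le f hmb ((f b - f a) / (b - a))
  have h3 : 0 < b - a := by linarith
  have h4 : (b - a) * ((f b - f a) / (b - a)) = f b - f a := by field_simp
  unfold pieceEnergy at h1 h2 ⊢
  set s := (f b - f a) / (b - a)
  have h5 : c s * (f m - f a - (m - a) * s) + c s * (f b - f m - (b - m) * s) = 0 := by
    rw [← mul_add]
    have : f m - f a - (m - a) * s + (f b - f m - (b - m) * s) = 0 := by linarith
    rw [this, mul_zero]
  linarith

theorem IsConvexEnergy.polygonalEnergy_tail_le (h : IsConvexEnergy Φ c) (f : ℝ → ℝ) {a : ℝ}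
    {l : List ℝ} (hl : (a :: l).Pairwise (· < ·)) :
    polygonalEnergy Φ f l ≤ polygonalEnergy Φ f (a :: l) := by
  cases l with
  | nil => simp [polygonalEnergy]
  | cons b l =>
    simp only [polygonalEnergy]
    have := h.pieceEnergy_nonneg f (List.rel_of_pairwise_cons hl (List.mem_cons_self))
    linarith

theorem IsConvexEnergy.polygonalEnergy_insert_le (h : IsConvexEnergy Φ c) (f : ℝ → ℝ) {a m : ℝ}
    {l : List ℝ} (hl : (a :: m :: l).Pairwise (· < ·)) :
    polygonalEnergy Φ f (a :: l) ≤ polygonalEnergy Φ f (a :: m :: l) := by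
  have ham : a < m := List.rel_of_pairwise_cons hl List.mem_cons_self
  cases l with
  | nil =>
    simp only [polygonalEnergy]
    linarith [h.pieceEnergy_nonneg f ham]
  | cons b l =>
    simp only [polygonalEnergy]
    have := h.pieceEnergy_le_add f ham
      (List.rel_of_pairwise_cons (List.pairwise_cons.1 hl).2 List.mem_cons_self)
    linarith

theorem IsConvexEnergy.polygonalEnergy_le_of_sublist (h : IsConvexEnergy Φ c) (f : ℝ → ℝ)
    {l l' : List ℝ} (hs : l.Sublist l') (hl : l'.Pairwise (· < ·)) :
    polygonalEnergy Φ f l ≤ polygonalEnergy Φ f l' := by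
  -- The energy couples consecutive points, so the induction also carries the statement with a
  -- common head prepended.
  suffices H : polygonalEnergy Φ f l ≤ polygonalEnergy Φ f l' ∧
      ∀ a, (a :: l').Pairwise (· < ·) →
        polygonalEnergy Φ f (a :: l) ≤ polygonalEnergy Φ f (a :: l') from H.1
  induction hs with
  | slnil => exact ⟨le_rfl, fun _ _ => le_rfl⟩
  | cons m hs ih =>
    have ih := ih (List.pairwise_cons.1 hl).2
    refine ⟨ih.1.trans (h.polygonalEnergy_tail_le f hl), fun a ha => ?_⟩
    refine (ih.2 a ?_).trans (h.polygonalEnergy_insert_le f ha)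
    exact ha.sublist ((List.sublist_cons_self _ _).cons_cons a)
  | cons_cons m hs ih =>
    have ih := ih (List.pairwise_cons.1 hl).2
    refine ⟨ih.2 m hl, fun a ha => ?_⟩
    simp only [polygonalEnergy]
    gcongr
    exact ih.2 m hl

/-- `A a` plays the role of the energy available to the right of `a`; the inequality telescopes
along the list. -/
theorem polygonalEnergy_le_of_superadditive {f A : ℝ → ℝ} {M : ℝ}
    (hA : ∀ a b, a < b → pieceEnergy Φ f a b + A b ≤ A a) (hA0 : ∀ x, 0 ≤ A x)
    (hAM : ∀ x, A x ≤ M) {l : List ℝ} (hl : l.Pairwise (· < ·)) : polygonalEnergy Φ f l ≤ M := by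
  have key : ∀ (l : List ℝ) (a : ℝ), (a :: l).Pairwise (· < ·) →
      polygonalEnergy Φ f (a :: l) ≤ A a := by
    intro l
    induction l with
    | nil => intro a _; simpa [polygonalEnergy] using hA0 a
    | cons b l ih =>
      intro a ha
      simp only [polygonalEnergy]
      have h1 := ih b (List.pairwise_cons.1 ha).2
      have h2 := hA a b (List.rel_of_pairwise_cons ha List.mem_cons_self)
      linarith
  cases l with
  | nil => simpa [polygonalEnergy] using (hA0 0).trans (hAM 0)
  | cons a l => exact (key l a hl).trans (hAM a)

theorem polygonalEnergy_map_range' (f : ℝ → ℝ) (v : ℕ → ℝ) (n k : ℕ) :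
    polygonalEnergy Φ f ((List.range' k (n + 1)).map v) =
      ∑ i ∈ Finset.range n, pieceEnergy Φ f (v (k + i)) (v (k + i + 1)) := by
  induction n generalizing k with
  | zero => simp [polygonalEnergy]
  | succ n ih =>
    rw [Finset.sum_range_succ', List.range'_succ, List.range'_succ]
    have h1 := ih (k + 1)
    rw [List.range'_succ] at h1
    simp only [List.map_cons, polygonalEnergy] at h1 ⊢
    rw [h1, add_comm]
    simp [add_assoc, add_comm 1]

/-- Comparison of polygonal energies by summation by parts: `g ≥ f` has less energy than `f` if at
each point either `f` and `g` agree or the interpolation of `g` is convex there (and has the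
right monotonicity at the ends). -/
theorem IsConvexEnergy.polygonalEnergy_le (h : IsConvexEnergy Φ c) {f g : ℝ → ℝ}
    (hfg : ∀ x, f x ≤ g x) {L : List ℝ} (hL : L.Pairwise (· < ·))
    (hmid : ∀ a x b l, (a :: x :: b :: l) <:+ L → f x = g x ∨
      (g x - g a) / (x - a) ≤ (g b - g x) / (b - x))
    (hend : ∀ a x, [a, x] <:+ L → f x = g x ∨ g x ≤ g a)
    (hstart : ∀ x b l, x :: b :: l = L → f x = g x ∨ g x ≤ g b) :
    polygonalEnergy Φ g L ≤ polygonalEnergy Φ f L := by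
  -- Abel summation from the right, carrying the boundary term at the head. Prepending a piece of
  -- slope `s` to one of slope `r` leaves the term `(c r - c s)(g b - f b)`, nonnegative by contact
  -- or convexity at `b`.
  have key : ∀ (l : List ℝ) (a b : ℝ), (a :: b :: l) <:+ L →
      polygonalEnergy Φ g (a :: b :: l) + c ((g b - g a) / (b - a)) * (g a - f a) ≤
        polygonalEnergy Φ f (a :: b :: l) := by
    intro l
    induction l with
    | nil =>
      intro a b hs
      have hab : a < b := List.rel_of_pairwise_cons (hL.sublist hs.sublist) List.mem_cons_self
      have hba : 0 < b - a := sub_pos.2 hab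
      have h1 := h.pieceEnergy_le f hab ((g b - g a) / (b - a))
      have h4 : (b - a) * ((g b - g a) / (b - a)) = g b - g a := by field_simp
      rw [h4] at h1
      simp only [polygonalEnergy]
      unfold pieceEnergy at h1 ⊢
      set s := (g b - g a) / (b - a) with hs'
      have h5 : 0 ≤ c s * (f b - g b) := by
        rcases hend a b hs with h6 | h6
        · simp [h6]
        · have : s ≤ 0 := div_nonpos_of_nonpos_of_nonneg (by linarith) hba.le
          have h7 := h.monotone this
          rw [h.subgradient_zero] at h7
          exact mul_nonneg_of_nonpos_of_nonpos h7 (by linarith [hfg b])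
      linarith
    | cons d l ih =>
      intro a b hs
      have hab : a < b := List.rel_of_pairwise_cons (hL.sublist hs.sublist) List.mem_cons_self
      have hba : 0 < b - a := sub_pos.2 hab
      have h1 := h.pieceEnergy_le f hab ((g b - g a) / (b - a))
      have h4 : (b - a) * ((g b - g a) / (b - a)) = g b - g a := by field_simp
      rw [h4] at h1
      have h2 := ih b d ((List.suffix_cons _ _).trans hs)
      have he (f : ℝ → ℝ) : polygonalEnergy Φ f (a :: b :: d :: l) =
        pieceEnergy Φ f a b + polygonalEnergy Φ f (b :: d :: l) := rfl
      rw [he, he]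
      have h0 : pieceEnergy Φ g a b = (b - a) * Φ ((g b - g a) / (b - a)) := rfl
      set s := (g b - g a) / (b - a) with hs'
      set r := (g d - g b) / (d - b) with hr
      have h5 : 0 ≤ (c r - c s) * (g b - f b) := by
        rcases hmid a b d l hs with h6 | h6
        · simp [h6]
        · exact mul_nonneg (sub_nonneg.2 (h.monotone h6)) (by linarith [hfg b])
      linarith
  match L, hstart, key, hL with
  | [], _, _, _ => simp [polygonalEnergy]
  | [_], _, _, _ => simp [polygonalEnergy]
  | a :: b :: l, hstart, key, hL =>
    have h1 := key l a b List.suffix_rfl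
    have hab : a < b := List.rel_of_pairwise_cons hL List.mem_cons_self
    have h5 : 0 ≤ c ((g b - g a) / (b - a)) * (g a - f a) := by
      rcases hstart a b l rfl with h6 | h6
      · simp [h6]
      · have : 0 ≤ (g b - g a) / (b - a) := div_nonneg (by linarith) (by linarith)
        have h7 := h.monotone this
        rw [h.subgradient_zero] at h7
        exact mul_nonneg h7 (by linarith [hfg a])
    linarith

end PolygonalEnergy

/-! ### Obstacles on the line and contact points -/

section Detachment

/-- `g` satisfies a maximum principle relative to the obstacle `f`: an affine function above `f` on
an interval and above `g` at its endpoints is above `g` on the interval. -/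
def ObstacleMaximumPrinciple (f g : ℝ → ℝ) : Prop :=
  ∀ a b m k : ℝ, a < b → (∀ y ∈ Set.Icc a b, f y ≤ m * y + k) → g a ≤ m * a + k →
    g b ≤ m * b + k → ∀ x ∈ Set.Icc a b, g x ≤ m * x + k

variable {f g : ℝ → ℝ}

/-- Suppose `f` exceeds the chord `ℓ` of `g`, by at most `N > 0` with equality at `x₁`. The
principle for `ℓ + N` gives `g ≤ ℓ + N`, so `x₁` is a contact point. It is not an endpoint, where `g
= ℓ`, and interior contact is excluded. Hence `f ≤ ℓ`, and the principle applies to `ℓ` itself. -/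
theorem ObstacleMaximumPrinciple.le_chord (h : ObstacleMaximumPrinciple f g) (hf : Continuous f)
    (hfg : ∀ x, f x ≤ g x) {a x b : ℝ} (hax : a < x) (hxb : x < b)
    (hlt : ∀ y ∈ Set.Ioo a b, f y ≠ g y) :
    (b - a) * g x ≤ (b - x) * g a + (x - a) * g b := by
  have hab : a < b := hax.trans hxb
  have hba : 0 < b - a := sub_pos.2 hab
  set m := (g b - g a) / (b - a) with hm
  set k := g a - m * a with hk
  have hmm : m * (b - a) = g b - g a := by rw [hm]; field_simp
  obtain ⟨x₁, hx₁, hmax⟩ := isCompact_Icc.exists_isMaxOn (Set.nonempty_Icc.2 hab.le)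
    (f := fun y => f y - (m * y + k)) (by fun_prop)
  set N := f x₁ - (m * x₁ + k) with hN
  have hle : ∀ y ∈ Set.Icc a b, f y ≤ m * y + (k + N) := fun y hy => by
    have h1 : f y - (m * y + k) ≤ N := hmax hy
    linarith
  have hN0 : N ≤ 0 := by
    by_contra hcon
    push Not at hcon
    have h1 := h a b m (k + N) hab hle (by linarith) (by nlinarith) x₁ hx₁
    have h2 : f x₁ = g x₁ := le_antisymm (hfg _) (by linarith)
    rcases eq_or_ne x₁ a with rfl | h3
    · linarith
    rcases eq_or_ne x₁ b with rfl | h4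
    · nlinarith
    exact hlt x₁ ⟨lt_of_le_of_ne hx₁.1 (Ne.symm h3), lt_of_le_of_ne hx₁.2 h4⟩ h2
  have h5 := h a b m k hab (fun y hy => by linarith [hle y hy]) (by linarith) (by nlinarith) x
    ⟨hax.le, hxb.le⟩
  have h6 : (b - a) * g x ≤ (b - a) * (m * x + k) := by gcongr
  have h7 : (b - a) * (m * x + k) = m * (b - a) * (x - a) + (b - a) * g a := by rw [hk]; ring
  rw [h7, hmm] at h6
  linarith

/-- A bounded convex function on a left half-line is nondecreasing: if `g x > g b`, the chord from
`x - R` to `b` violates the bound `B` once `R` is large. -/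
theorem ObstacleMaximumPrinciple.le_right (h : ObstacleMaximumPrinciple f g) (hf : Continuous f)
    (hfg : ∀ x, f x ≤ g x) {B : ℝ} (hB : ∀ x, |g x| ≤ B) {x b : ℝ} (hxb : x < b)
    (hlt : ∀ y < b, f y ≠ g y) : g x ≤ g b := by
  by_contra! hcon
  have hd : 0 < g x - g b := sub_pos.2 hcon
  obtain ⟨R, hR⟩ : ∃ R, 0 < R ∧ (b - x) * (2 * B) < R * (g x - g b) := by
    refine ⟨|(b - x) * (2 * B)| / (g x - g b) + 1, by positivity, ?_⟩
    rw [add_mul, div_mul_cancel₀ _ hd.ne']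
    linarith [le_abs_self ((b - x) * (2 * B))]
  have h1 := h.le_chord hf hfg (a := x - R) (by linarith [hR.1]) hxb (fun y hy => hlt y hy.2)
  have h2 := abs_le.1 (hB (x - R))
  have h3 := abs_le.1 (hB x)
  have h4 : (b - x) * (g (x - R) - g x) ≤ (b - x) * (2 * B) := by
    gcongr
    · linarith
  nlinarith [hR.2]

theorem ObstacleMaximumPrinciple.le_left (h : ObstacleMaximumPrinciple f g) (hf : Continuous f)
    (hfg : ∀ x, f x ≤ g x) {B : ℝ} (hB : ∀ x, |g x| ≤ B) {a x : ℝ} (hax : a < x)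
    (hlt : ∀ y, a < y → f y ≠ g y) : g x ≤ g a := by
  by_contra! hcon
  have hd : 0 < g x - g a := sub_pos.2 hcon
  obtain ⟨R, hR⟩ : ∃ R, 0 < R ∧ (x - a) * (2 * B) < R * (g x - g a) := by
    refine ⟨|(x - a) * (2 * B)| / (g x - g a) + 1, by positivity, ?_⟩
    rw [add_mul, div_mul_cancel₀ _ hd.ne']
    linarith [le_abs_self ((x - a) * (2 * B))]
  have h1 := h.le_chord hf hfg (b := x + R) hax (by linarith [hR.1]) (fun y hy => hlt y hy.1)
  have h2 := abs_le.1 (hB (x + R))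
  have h3 := abs_le.1 (hB x)
  have h4 : (x - a) * (g (x + R) - g x) ≤ (x - a) * (2 * B) := by
    gcongr
    · linarith
  nlinarith [hR.2]

/-- Nearest point of a closed set to the left. -/
theorem exists_nearest_left {S : Set ℝ} (hS : IsClosed S) {x : ℝ} (hx : x ∉ S)
    (hne : ∃ y ∈ S, y < x) : ∃ z ∈ S, z < x ∧ ∀ y, z < y → y ≤ x → y ∉ S := by
  obtain ⟨y₀, hy₀, hyx⟩ := hne
  have hc : IsClosed (S ∩ Set.Iic x) := hS.inter isClosed_Iic
  have hbd : BddAbove (S ∩ Set.Iic x) := ⟨x, fun y hy => hy.2⟩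
  have hmem := hc.csSup_mem ⟨y₀, hy₀, hyx.le⟩ hbd
  refine ⟨_, hmem.1, lt_of_le_of_ne hmem.2 fun h => hx (h ▸ hmem.1), fun y hy hyx hyS => ?_⟩
  exact absurd (le_csSup hbd ⟨hyS, hyx⟩) (not_le.2 hy)

/-- Nearest point of a closed set to the right. -/
theorem exists_nearest_right {S : Set ℝ} (hS : IsClosed S) {x : ℝ} (hx : x ∉ S)
    (hne : ∃ y ∈ S, x < y) : ∃ z ∈ S, x < z ∧ ∀ y, x ≤ y → y < z → y ∉ S := by
  obtain ⟨y₀, hy₀, hyx⟩ := hne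
  have hc : IsClosed (S ∩ Set.Ici x) := hS.inter isClosed_Ici
  have hbd : BddBelow (S ∩ Set.Ici x) := ⟨x, fun y hy => hy.2⟩
  have hmem := hc.csInf_mem ⟨y₀, hy₀, hyx.le⟩ hbd
  refine ⟨_, hmem.1, lt_of_le_of_ne hmem.2 fun h => hx (h ▸ hmem.1), fun y hxy hy hyS => ?_⟩
  exact absurd (csInf_le hbd ⟨hyS, hxy⟩) (not_le.2 hy)

/-- Enlarging a finite set by the endpoints of the complementary components it meets. -/
theorem exists_finset_nearest {S : Set ℝ} (hS : IsClosed S) (F : Finset ℝ) :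
    ∃ F' : Finset ℝ, F ⊆ F' ∧
      (∀ x ∈ F', x ∉ S → (∀ y < x, y ∉ S) ∨ ∃ z ∈ F', z < x ∧ ∀ y, z < y → y ≤ x → y ∉ S) ∧
      (∀ x ∈ F', x ∉ S → (∀ y, x < y → y ∉ S) ∨
        ∃ z ∈ F', x < z ∧ ∀ y, x ≤ y → y < z → y ∉ S) := by
  classical
  have hl : ∀ x, ∃ z, x ∉ S → (∀ y < x, y ∉ S) ∨
      (z ∈ S ∧ z < x ∧ ∀ y, z < y → y ≤ x → y ∉ S) := by
    intro x
    by_cases hx : x ∉ S ∧ ∃ y ∈ S, y < x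
    · obtain ⟨z, hz⟩ := exists_nearest_left hS hx.1 hx.2
      exact ⟨z, fun _ => Or.inr hz⟩
    · refine ⟨0, fun hxS => Or.inl fun y hy hyS => hx ⟨hxS, y, hyS, hy⟩⟩
  have hr : ∀ x, ∃ z, x ∉ S → (∀ y, x < y → y ∉ S) ∨
      (z ∈ S ∧ x < z ∧ ∀ y, x ≤ y → y < z → y ∉ S) := by
    intro x
    by_cases hx : x ∉ S ∧ ∃ y ∈ S, x < y
    · obtain ⟨z, hz⟩ := exists_nearest_right hS hx.1 hx.2
      exact ⟨z, fun _ => Or.inr hz⟩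
    · refine ⟨0, fun hxS => Or.inl fun y hy hyS => hx ⟨hxS, y, hyS, hy⟩⟩
  choose p hp using hl
  choose q hq using hr
  -- Only contact points are added, so the new points impose no further requirement.
  let G := F ∪ (((F.image p) ∪ (F.image q)).filter (· ∈ S))
  have hG : ∀ x ∈ G, x ∉ S → x ∈ F := by
    intro x hx hxS
    rcases Finset.mem_union.1 hx with h | h
    · exact h
    · exact absurd (Finset.mem_filter.1 h).2 hxS
  refine ⟨G, Finset.subset_union_left, fun x hx hxS => ?_, fun x hx hxS => ?_⟩
  · refine (hp x hxS).imp_right fun h => ⟨p x, ?_, h.2⟩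
    exact Finset.mem_union_right _ (Finset.mem_filter.2 ⟨Finset.mem_union_left _
      (Finset.mem_image_of_mem _ (hG x hx hxS)), h.1⟩)
  · refine (hq x hxS).imp_right fun h => ⟨q x, ?_, h.2⟩
    exact Finset.mem_union_right _ (Finset.mem_filter.2 ⟨Finset.mem_union_right _
      (Finset.mem_image_of_mem _ (hG x hx hxS)), h.1⟩)

theorem slope_le_slope_of_le_chord {a x b : ℝ} (hax : a < x) (hxb : x < b)
    (h : (b - a) * g x ≤ (b - x) * g a + (x - a) * g b) :
    (g x - g a) / (x - a) ≤ (g b - g x) / (b - x) := by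
  rw [div_le_div_iff₀ (by linarith) (by linarith)]
  linarith

/-- The polygonal energies of a bounded `g` satisfying a maximum principle relative to the
obstacle `f` are bounded by those of `f`. -/
theorem ObstacleMaximumPrinciple.exists_polygonalEnergy_le (h : ObstacleMaximumPrinciple f g)
    (hf : Continuous f) (hfg : ∀ x, f x ≤ g x) (hcl : IsClosed {x | f x = g x}) {B : ℝ}
    (hB : ∀ x, |g x| ≤ B) {Φ c : ℝ → ℝ} (hΦ : IsConvexEnergy Φ c) {l : List ℝ}
    (hl : l.Pairwise (· < ·)) :
    ∃ L : List ℝ, L.Pairwise (· < ·) ∧ polygonalEnergy Φ g l ≤ polygonalEnergy Φ f L := by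
  classical
  obtain ⟨F, hlF, hleft, hright⟩ := exists_finset_nearest hcl l.toFinset
  simp only [Set.mem_ofPred_eq] at hleft hright
  have hL : (F.sort (· ≤ ·)).Pairwise (· < ·) := F.sortedLT_sort.pairwise
  have hmemL : ∀ z, z ∈ F.sort (· ≤ ·) ↔ z ∈ F := fun z => F.mem_sort _
  set L := F.sort (· ≤ ·) with hLdef
  clear_value L
  have hsub : l.Sublist L := by
    refine List.sublist_of_subperm_of_pairwise (r := (· < ·)) ?_ hl hL
    exact List.Nodup.subperm (hl.imp fun h => ne_of_lt h) fun x hx =>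
      (hmemL x).2 (hlF (List.mem_toFinset.2 hx))
  have hord : ∀ a x l, (a :: x :: l) <:+ L → a ∈ F ∧ x ∈ F ∧ a < x ∧ (∀ z ∈ F, z < x → z ≤ a) ∧
      (∀ z ∈ F, a < z → x ≤ z) := by
    rintro a x l ⟨pre, hpre⟩
    have h1 := hL
    rw [← hpre, List.pairwise_append] at h1
    have h2 := List.pairwise_cons.1 h1.2.1
    have h3 := List.pairwise_cons.1 h2.2
    have hax := h2.1 x List.mem_cons_self
    have hmem : ∀ z ∈ F, z ∈ pre ∨ z = a ∨ z = x ∨ z ∈ l := fun z hz => by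
      have := (hmemL z).2 hz
      rw [← hpre] at this
      simpa using this
    refine ⟨(hmemL a).1 (by simp [← hpre]), (hmemL x).1 (by simp [← hpre]), hax,
      fun z hz hzx => ?_, fun z hz haz => ?_⟩
    · rcases hmem z hz with h | h | h | h
      · exact (h1.2.2 z h a List.mem_cons_self).le
      · exact h.le
      · exact absurd hzx (h ▸ lt_irrefl _)
      · exact absurd hzx (not_lt.2 (h3.1 z h).le)
    · rcases hmem z hz with h | h | h | h
      · exact absurd haz (not_lt.2 (h1.2.2 z h a List.mem_cons_self).le)
      · exact absurd haz (h ▸ lt_irrefl _)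
      · exact h.ge
      · exact (h3.1 z h).le
  -- The nearest contact points of a non-contact point are already in the list, so none lies between
  -- it and its neighbours.
  have hfree_left : ∀ a x l, (a :: x :: l) <:+ L → f x ≠ g x → ∀ y, a < y → y ≤ x → f y ≠ g y := by
    intro a x l hs hx y hay hyx
    obtain ⟨haF, hxF, hax, hpred, -⟩ := hord a x l hs
    rcases hyx.eq_or_lt with rfl | hyx'
    · exact hx
    rcases hleft x hxF hx with h1 | ⟨z, hz, hzx, h1⟩
    · exact h1 y hyx'
    · exact h1 y ((hpred z hz hzx).trans_lt hay) hyx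
  have hfree_right : ∀ x b l, (x :: b :: l) <:+ L → f x ≠ g x → ∀ y, x ≤ y → y < b → f y ≠ g y := by
    intro x b l hs hx y hxy hyb
    obtain ⟨hxF, hbF, hxb, -, hsucc⟩ := hord x b l hs
    rcases hxy.eq_or_lt with rfl | hxy'
    · exact hx
    rcases hright x hxF hx with h1 | ⟨z, hz, hzx, h1⟩
    · exact h1 y hxy'
    · exact h1 y hxy (hyb.trans_le (hsucc z hz hzx))
  refine ⟨L, hL, (hΦ.polygonalEnergy_le_of_sublist g hsub hL).trans
    (hΦ.polygonalEnergy_le hfg hL ?_ ?_ ?_)⟩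
  · intro a x b l hs
    refine or_iff_not_imp_left.2 fun hx => ?_
    have hs' := (List.suffix_cons a (x :: b :: l)).trans hs
    have hax := (hord a x _ hs).2.2.1
    have hxb := (hord x b _ hs').2.2.1
    refine slope_le_slope_of_le_chord hax hxb (h.le_chord hf hfg hax hxb fun y hy => ?_)
    rcases le_total y x with hyx | hxy
    · exact hfree_left a x _ hs hx y hy.1 hyx
    · exact hfree_right x b _ hs' hx y hxy hy.2
  · intro a x hs
    refine or_iff_not_imp_left.2 fun hx => ?_
    obtain ⟨-, hxF, hax, -, -⟩ := hord a x _ hs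
    -- Beyond the last point there is no contact point either, as the nearest one would be in the
    -- list; hence the half-line statement applies.
    refine h.le_left hf hfg hB hax fun y hay => ?_
    rcases le_or_gt y x with hyx | hxy
    · exact hfree_left a x _ hs hx y hay hyx
    rcases hright x hxF hx with h1 | ⟨z, hz, hxz, -⟩
    · exact h1 y hxy
    · exfalso
      obtain ⟨pre, hpre⟩ := hs
      have h1 := hL
      rw [← hpre, List.pairwise_append] at h1
      have h2 := (hmemL z).2 hz
      rw [← hpre] at h2
      simp only [List.mem_append, List.mem_cons, List.not_mem_nil, or_false] at h2
      rcases h2 with h2 | h2 | h2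
      · exact absurd hxz (not_lt.2 (h1.2.2 z h2 x (by simp)).le)
      · exact absurd hxz (not_lt.2 (h2 ▸ hax.le))
      · exact absurd hxz (h2 ▸ lt_irrefl _)
  · intro x b l hs
    refine or_iff_not_imp_left.2 fun hx => ?_
    have hs' : (x :: b :: l) <:+ L := hs ▸ List.suffix_rfl
    obtain ⟨hxF, -, hxb, -, -⟩ := hord x b _ hs'
    refine h.le_right hf hfg hB hxb fun y hyb => ?_
    rcases le_or_gt x y with hxy | hyx
    · exact hfree_right x b _ hs' hx y hxy hyb
    rcases hleft x hxF hx with h1 | ⟨z, hz, hzx, -⟩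
    · exact h1 y hyx
    · exfalso
      have h1 := hL
      rw [← hs] at h1
      have h2 := (hmemL z).2 hz
      rw [← hs] at h2
      rcases List.mem_cons.1 h2 with h3 | h3
      · exact absurd hzx (h3 ▸ lt_irrefl _)
      · exact absurd hzx (not_lt.2 ((List.pairwise_cons.1 h1).1 z h3).le)

end Detachment

/-! ### Heat flow of bounded continuous data on the line; parabolic maximum principle -/

section HeatFlow

instance : IsProbabilityMeasure (heatMeasure ℝ 1) := isProbabilityMeasure_heatMeasure one_pos

theorem sqrt_mul_heatKernel {t : ℝ} (ht : 0 < t) (z : ℝ) :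
    √t * heatKernel t (√t * z) = heatKernel 1 z := by
  unfold heatKernel
  have h1 : -‖√t * z‖ ^ 2 / (4 * t) = -‖z‖ ^ 2 / (4 * 1) := by
    rw [norm_mul, mul_pow, Real.norm_of_nonneg (Real.sqrt_nonneg t), Real.sq_sqrt ht.le]
    field_simp
  rw [h1, ← mul_assoc]
  congr 1
  simp only [Module.finrank_self, Nat.cast_one, ← Real.sqrt_eq_rpow]
  rw [Real.sqrt_mul (by positivity) t, mul_one]
  have : 0 < √t := Real.sqrt_pos.2 ht
  field_simp

theorem integral_heatMeasure_eq_integral_sqrt_mul {t : ℝ} (ht : 0 < t) (h : ℝ → ℝ) :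
    ∫ y, h y ∂(heatMeasure ℝ t) = ∫ z, h (√t * z) ∂(heatMeasure ℝ 1) := by
  have hs : 0 < √t := Real.sqrt_pos.2 ht
  rw [integral_heatMeasure ht, integral_heatMeasure one_pos]
  have h1 := Measure.integral_comp_mul_left (fun y => heatKernel t y * h y) (√t)
  rw [abs_of_pos (inv_pos.2 hs), smul_eq_mul, eq_inv_mul_iff_mul_eq₀ hs.ne',
    ← integral_const_mul] at h1
  simp only [smul_eq_mul]
  rw [← h1]
  refine integral_congr_ae (Filter.Eventually.of_forall fun z => ?_)
  simp only [← mul_assoc]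
  rw [sqrt_mul_heatKernel ht]

/-- The solution of the heat equation on the line with initial datum `f`. -/
noncomputable def heatFlow (f : ℝ → ℝ) (t x : ℝ) : ℝ :=
  ∫ z, f (x + √t * z) ∂(heatMeasure ℝ 1)

variable {f : ℝ → ℝ} {B : ℝ}

theorem heatFlow_zero (x : ℝ) : heatFlow f 0 x = f x := by
  simp [heatFlow]

theorem integrable_heatFlow (hf : Continuous f) (hB : ∀ x, |f x| ≤ B) (t x : ℝ) :
    Integrable (fun z => f (x + √t * z)) (heatMeasure ℝ 1) :=
  (memLp_top_of_bound (hf.comp (by fun_prop)).aestronglyMeasurable B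
    (Filter.Eventually.of_forall fun _ => hB _)).integrable le_top

theorem abs_heatFlow_le (hB : ∀ x, |f x| ≤ B) (t x : ℝ) : |heatFlow f t x| ≤ B := by
  have := norm_integral_le_of_norm_le_const (μ := heatMeasure ℝ 1)
    (f := fun z => f (x + √t * z)) (Filter.Eventually.of_forall fun _ => hB _)
  simpa [heatFlow] using this

/-- Scaling to the Gaussian of time one leaves the dependence on `(t, x)` inside `f` alone, so joint
continuity, including at `t = 0`, is dominated convergence. -/
theorem continuous_heatFlow (hf : Continuous f) (hB : ∀ x, |f x| ≤ B) :
    Continuous fun p : ℝ × ℝ => heatFlow f p.1 p.2 := by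
  refine continuous_of_dominated (bound := fun _ => B) (fun p => ?_) (fun p => ?_)
    (integrable_const B) ?_
  · exact (hf.comp (by fun_prop)).aestronglyMeasurable
  · exact Filter.Eventually.of_forall fun _ => hB _
  · exact Filter.Eventually.of_forall fun z => hf.comp (by fun_prop)

theorem heatFlow_eq_heatMean {t : ℝ} (ht : 0 < t) (x : ℝ) : heatFlow f t x = heatMean t f x :=
  (integral_heatMeasure_eq_integral_sqrt_mul ht fun y => f (x + y)).symm

theorem heatFlow_nonneg (hf0 : ∀ x, 0 ≤ f x) (t x : ℝ) : 0 ≤ heatFlow f t x :=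
  integral_nonneg fun _ => hf0 _

theorem heatConv_eq_ofReal_heatFlow (hf : Continuous f) (hB : ∀ x, |f x| ≤ B) (hf0 : ∀ x, 0 ≤ f x)
    {t : ℝ} (ht : 0 < t) (x : ℝ) :
    heatConv t (fun y => ENNReal.ofReal (f y)) x = ENNReal.ofReal (heatFlow f t x) := by
  have := isProbabilityMeasure_heatMeasure (E := ℝ) ht
  rw [heatFlow_eq_heatMean ht, heatMean, ofReal_integral_eq_lintegral_ofReal,
    heatConv_eq_lintegral_heatMeasure t hf.measurable.ennreal_ofReal]
  · exact (memLp_top_of_bound (hf.comp (by fun_prop)).aestronglyMeasurable B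
      (Filter.Eventually.of_forall fun _ => hB _)).integrable le_top
  · exact Filter.Eventually.of_forall fun y => hf0 _

theorem heatFlow_add (hf : Continuous f) (hB : ∀ x, |f x| ≤ B) (hf0 : ∀ x, 0 ≤ f x)
    {s t : ℝ} (hs : 0 < s) (ht : 0 < t) (x : ℝ) :
    heatFlow f (s + t) x = heatFlow (heatFlow f t) s x := by
  have h1 := heatConv_heatConv hs ht hf.measurable.ennreal_ofReal x
  have hc : Continuous (heatFlow f t) :=
    (continuous_heatFlow hf hB).comp (by fun_prop : Continuous fun x : ℝ => (t, x))
  rw [heatConv_eq_ofReal_heatFlow hf hB hf0 (add_pos hs ht),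
    funext fun y => heatConv_eq_ofReal_heatFlow hf hB hf0 ht y,
    heatConv_eq_ofReal_heatFlow hc (abs_heatFlow_le hB t) (heatFlow_nonneg hf0 t) hs] at h1
  exact ((ENNReal.ofReal_eq_ofReal_iff (heatFlow_nonneg (heatFlow_nonneg hf0 t) s x)
    (heatFlow_nonneg hf0 _ x)).1 h1).symm

theorem integrable_id_heatMeasure_one : Integrable (fun z : ℝ => z) (heatMeasure ℝ 1) :=
  (memLp_id_heatMeasure one_pos).integrable one_le_two

theorem integral_id_heatMeasure_one : ∫ z, z ∂(heatMeasure ℝ 1) = 0 := by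
  have h := (measurePreserving_neg_heatMeasure (E := ℝ) 1).integral_comp
    (MeasurableEquiv.neg ℝ).measurableEmbedding (fun z : ℝ => z)
  rw [integral_neg] at h
  linarith

theorem integrable_pow_four_heatMeasure_one : Integrable (fun z : ℝ => z ^ 4) (heatMeasure ℝ 1) := by
  rw [integrable_heatMeasure_iff one_pos]
  have h := (integrable_rpow_mul_exp_neg_mul_sq (b := 1 / 4) (by norm_num) (s := 4)
    (by norm_num)).const_mul (1 / (4 * Real.pi * 1) ^ ((Module.finrank ℝ ℝ : ℝ) / 2))
  refine h.congr (Filter.Eventually.of_forall fun z => ?_)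
  have h4 : z ^ (4 : ℝ) = z ^ 4 := by exact_mod_cast Real.rpow_natCast z 4
  simp only [heatKernel, smul_eq_mul, h4, Real.norm_eq_abs, sq_abs]
  rw [show -(1 / 4) * z ^ 2 = -z ^ 2 / (4 * 1) by ring]
  ring

/-- A function bounded above by an affine function up to a quartic error has heat flow bounded by
the affine function up to a quadratic error in time. -/
theorem heatFlow_le_of_le_quartic {h : ℝ → ℝ} (hh : Continuous h) (hB : ∀ x, |h x| ≤ B)
    {x α m K s : ℝ} (hs : 0 ≤ s) (hle : ∀ y, h (x + y) ≤ α + m * y + K * y ^ 4) :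
    heatFlow h s x ≤ α + K * (∫ z, z ^ 4 ∂(heatMeasure ℝ 1)) * s ^ 2 := by
  have h4 : √s ^ 4 = s ^ 2 := by
    rw [show (4 : ℕ) = 2 * 2 by norm_num, pow_mul, Real.sq_sqrt hs]
  have hi1 := integrable_id_heatMeasure_one.const_mul (m * √s)
  have hi4 := integrable_pow_four_heatMeasure_one.const_mul (K * √s ^ 4)
  have hi0 : Integrable (fun _ : ℝ => α) (heatMeasure ℝ 1) := integrable_const α
  have hi : Integrable (fun z => α + m * √s * z + K * √s ^ 4 * z ^ 4) (heatMeasure ℝ 1) :=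
    (hi0.add hi1).add hi4
  have h1 : heatFlow h s x ≤ ∫ z, (α + m * √s * z + K * √s ^ 4 * z ^ 4) ∂(heatMeasure ℝ 1) := by
    refine integral_mono (integrable_heatFlow hh hB s x) hi fun z => ?_
    refine (hle (√s * z)).trans_eq ?_
    ring
  refine h1.trans_eq ?_
  have hi01 : Integrable (fun z => α + m * √s * z) (heatMeasure ℝ 1) := hi0.add hi1
  rw [integral_add hi01 hi4, integral_add hi0 hi1, integral_const_mul, integral_const_mul,
    integral_id_heatMeasure_one, h4]
  simp
  ring

/-- The maximum principle on a parabolic rectangle. -/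
theorem heatFlow_le_affine (hf : Continuous f) (hB : ∀ x, |f x| ≤ B) (hf0 : ∀ x, 0 ≤ f x)
    {a b m k : ℝ} (hle : ∀ y ∈ Set.Icc a b, f y ≤ m * y + k)
    (ha : ∀ t, 0 < t → heatFlow f t a ≤ m * a + k) (hb : ∀ t, 0 < t → heatFlow f t b ≤ m * b + k)
    {t x : ℝ} (ht : 0 < t) (hx : x ∈ Set.Icc a b) : heatFlow f t x ≤ m * x + k := by
  refine le_of_forall_pos_le_add fun ε hε => ?_
  -- Subtracting `δt` makes the inequality at a positive maximum strict; its cost up to time `t` is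
  -- at most `ε`.
  obtain ⟨δ, hδ, hδt⟩ : ∃ δ, 0 < δ ∧ δ * t ≤ ε := ⟨ε / t, by positivity, by field_simp; exact le_rfl⟩
  have hc := continuous_heatFlow hf hB
  obtain ⟨⟨t₀, x₀⟩, ⟨ht₀, hx₀⟩, hmax⟩ := (isCompact_Icc.prod isCompact_Icc).exists_isMaxOn
    (s := Set.Icc 0 t ×ˢ Set.Icc a b) ⟨(t, x), ⟨ht.le, le_rfl⟩, hx⟩
    (f := fun p : ℝ × ℝ => heatFlow f p.1 p.2 - (m * p.2 + k) - δ * p.1) (by fun_prop)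
  set N := heatFlow f t₀ x₀ - (m * x₀ + k) - δ * t₀ with hN
  have hle' : ∀ s ∈ Set.Icc 0 t, ∀ y ∈ Set.Icc a b, heatFlow f s y ≤ N + (m * y + k) + δ * s := by
    intro s hs y hy
    have h1 : heatFlow f s y - (m * y + k) - δ * s ≤ N := isMaxOn_iff.1 hmax (s, y) ⟨hs, hy⟩
    linarith
  suffices hN0 : N ≤ 0 by
    have := hle' t ⟨ht.le, le_rfl⟩ x hx
    linarith
  by_contra! hN0
  simp only [Set.mem_Icc] at ht₀ hx₀
  have ht₀' : 0 < t₀ := by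
    rcases ht₀.1.eq_or_lt with h | h
    · rw [← h, heatFlow_zero] at hN
      linarith [hle x₀ hx₀]
    · exact h
  have hδt₀ : 0 < δ * t₀ := by positivity
  have hax : a < x₀ := by
    refine lt_of_le_of_ne hx₀.1 fun h => ?_
    rw [← h] at hN
    linarith [ha t₀ ht₀']
  have hxb : x₀ < b := by
    refine lt_of_le_of_ne hx₀.2 fun h => ?_
    rw [h] at hN
    linarith [hb t₀ ht₀']
  obtain ⟨r, hr, hra, hrb⟩ : ∃ r, 0 < r ∧ a ≤ x₀ - r ∧ x₀ + r ≤ b :=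
    ⟨min (x₀ - a) (b - x₀), lt_min (by linarith) (by linarith),
      by linarith [min_le_left (x₀ - a) (b - x₀)], by linarith [min_le_right (x₀ - a) (b - x₀)]⟩
  -- At times before `t₀` the flow is below an affine function plus a quartic: within distance `r`
  -- of `x₀` by maximality, farther away by boundedness, absorbed by `K y⁴`. A quartic costs only
  -- `O(s²)` after time `s`.
  set D := |B| + |N + (m * x₀ + k)| with hD
  set K := D / r ^ 4 + |m| / r ^ 3 with hK
  have hK0 : 0 ≤ K := by positivity
  have hquart : ∀ s, 0 < s → s < t₀ → ∀ y, heatFlow f (t₀ - s) (x₀ + y) ≤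
      (N + (m * x₀ + k) + δ * (t₀ - s)) + m * y + K * y ^ 4 := by
    intro s hs hst y
    rcases le_or_gt |y| r with hy | hy
    · have h1 := abs_le.1 hy
      have h2 := hle' (t₀ - s) ⟨by linarith, by linarith⟩ (x₀ + y) ⟨by linarith, by linarith⟩
      have h3 : 0 ≤ K * y ^ 4 := by positivity
      linarith
    · have h1 := (le_abs_self _).trans (abs_heatFlow_le hB (t₀ - s) (x₀ + y))
      have h2 : 0 < δ * (t₀ - s) := mul_pos hδ (by linarith)
      have hy4 : y ^ 4 = |y| ^ 4 := by rw [← abs_pow, abs_of_nonneg (by positivity)]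
      have h3 : D ≤ D / r ^ 4 * y ^ 4 := by
        rw [div_mul_eq_mul_div, le_div_iff₀ (by positivity), hy4]
        gcongr
      have h4 : |m| * |y| ≤ |m| / r ^ 3 * y ^ 4 := by
        rw [div_mul_eq_mul_div, le_div_iff₀ (by positivity), hy4]
        calc |m| * |y| * r ^ 3 ≤ |m| * |y| * |y| ^ 3 := by gcongr
          _ = _ := by ring
      have h5 := neg_abs_le (m * y)
      rw [abs_mul] at h5
      have h6 := neg_abs_le (N + (m * x₀ + k))
      have h7 := le_abs_self B
      rw [hK, add_mul]
      linarith
  set c := ∫ z, z ^ 4 ∂(heatMeasure ℝ 1)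
  have hc0 : 0 ≤ c := integral_nonneg fun z => by positivity
  -- Flowing from time `t₀ - s` to `t₀` must recover the maximum, so the gain `δs` is at most the
  -- quartic error. This fails for small `s`, and no derivative of the flow is used.
  have hstep : ∀ s, 0 < s → s < t₀ → δ * s ≤ K * c * s ^ 2 := by
    intro s hs hst
    have h1 := heatFlow_add hf hB hf0 hs (sub_pos.2 hst) x₀
    rw [add_sub_cancel] at h1
    have hcc : Continuous (heatFlow f (t₀ - s)) :=
      hc.comp (by fun_prop : Continuous fun x : ℝ => (t₀ - s, x))
    have h2 := heatFlow_le_of_le_quartic hcc (abs_heatFlow_le hB _) hs.le (hquart s hs hst)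
    rw [← h1] at h2
    linarith
  set s := min (t₀ / 2) (δ / (2 * (K * c + 1))) with hsdef
  have hKc : 0 ≤ K * c := by positivity
  have hs : 0 < s := lt_min (by linarith) (by positivity)
  have h1 := hstep s hs ((min_le_left _ _).trans_lt (by linarith))
  have h2 : s ≤ δ / (2 * (K * c + 1)) := min_le_right _ _
  rw [le_div_iff₀ (by positivity)] at h2
  have h3 : K * c * s ^ 2 = K * c * s * s := by ring
  rw [h3] at h1
  have h4 := le_of_mul_le_mul_right h1 hs
  linarith

theorem heatMaximal_eq_iSup_heatFlow (hf : Continuous f) (hB : ∀ x, |f x| ≤ B) (hf0 : ∀ x, 0 ≤ f x)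
    (x : ℝ) : heatMaximal f x = ⨆ (t : ℝ) (_ : 0 < t), ENNReal.ofReal (heatFlow f t x) := by
  rw [heatMaximal_eq]
  refine iSup_congr fun t => iSup_congr fun ht => ?_
  rw [← heatConv_eq_ofReal_heatFlow hf hB hf0 ht]
  simp only [abs_of_nonneg (hf0 _)]

theorem heatMaximal_le_ofReal (hB : ∀ x, |f x| ≤ B) (x : ℝ) :
    heatMaximal f x ≤ ENNReal.ofReal B :=
  heatMaximal_le_of_ae_le (Filter.Eventually.of_forall hB) x

theorem heatFlow_le_toReal_heatMaximal (hf : Continuous f) (hB : ∀ x, |f x| ≤ B)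
    (hf0 : ∀ x, 0 ≤ f x) {t : ℝ} (ht : 0 ≤ t) (x : ℝ) :
    heatFlow f t x ≤ (heatMaximal f x).toReal := by
  have hfin : heatMaximal f x ≠ ⊤ := ((heatMaximal_le_ofReal hB x).trans_lt ENNReal.ofReal_lt_top).ne
  have hpos : ∀ t, 0 < t → heatFlow f t x ≤ (heatMaximal f x).toReal := fun t ht => by
    rw [← ENNReal.ofReal_le_iff_le_toReal hfin, heatMaximal_eq_iSup_heatFlow hf hB hf0]
    exact le_iSup₂ (f := fun (t : ℝ) (_ : 0 < t) => ENNReal.ofReal (heatFlow f t x)) t ht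
  have hc : Continuous fun t => heatFlow f t x :=
    (continuous_heatFlow hf hB).comp (by fun_prop : Continuous fun t : ℝ => (t, x))
  have hcl : IsClosed {t | heatFlow f t x ≤ (heatMaximal f x).toReal} :=
    isClosed_le hc continuous_const
  have hsub : closure (Set.Ioi (0 : ℝ)) ⊆ {t | heatFlow f t x ≤ (heatMaximal f x).toReal} :=
    closure_minimal hpos hcl
  rw [closure_Ioi] at hsub
  exact hsub ht

theorem toReal_heatMaximal_le (hf : Continuous f) (hB : ∀ x, |f x| ≤ B) (hf0 : ∀ x, 0 ≤ f x)
    {x α : ℝ} (h : ∀ t, 0 < t → heatFlow f t x ≤ α) : (heatMaximal f x).toReal ≤ α := by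
  have hα : 0 ≤ α := (heatFlow_nonneg hf0 1 x).trans (h 1 one_pos)
  refine ENNReal.toReal_le_of_le_ofReal hα ?_
  rw [heatMaximal_eq_iSup_heatFlow hf hB hf0]
  exact iSup₂_le fun t ht => ENNReal.ofReal_le_ofReal (h t ht)

theorem le_toReal_heatMaximal (hf : Continuous f) (hB : ∀ x, |f x| ≤ B) (hf0 : ∀ x, 0 ≤ f x)
    (x : ℝ) : f x ≤ (heatMaximal f x).toReal := by
  simpa [heatFlow_zero] using heatFlow_le_toReal_heatMaximal hf hB hf0 le_rfl x

/-- On the vertical sides of the parabolic rectangle the flow is at most `u*`, for every time. Take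
the supremum over time in `heatFlow_le_affine`; continuity of `u*` is not needed. -/
theorem obstacleMaximumPrinciple_heatMaximal (hf : Continuous f) (hB : ∀ x, |f x| ≤ B)
    (hf0 : ∀ x, 0 ≤ f x) :
    ObstacleMaximumPrinciple f fun x => (heatMaximal f x).toReal := by
  intro a b m k hab hle ha hb x hx
  refine toReal_heatMaximal_le hf hB hf0 fun t ht => heatFlow_le_affine hf hB hf0 hle
    (fun s hs => ?_) (fun s hs => ?_) ht hx
  · exact (heatFlow_le_toReal_heatMaximal hf hB hf0 hs.le a).trans ha
  · exact (heatFlow_le_toReal_heatMaximal hf hB hf0 hs.le b).trans hb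

/-- Contact means `P_t f ≤ f` for every `t > 0`, which is a closed condition for each `t`. -/
theorem isClosed_setOf_eq_heatMaximal (hf : Continuous f) (hB : ∀ x, |f x| ≤ B)
    (hf0 : ∀ x, 0 ≤ f x) : IsClosed {x | f x = (heatMaximal f x).toReal} := by
  have h : {x | f x = (heatMaximal f x).toReal} =
      ⋂ (t : ℝ) (_ : 0 < t), {x | heatFlow f t x ≤ f x} := by
    ext x
    simp only [Set.mem_iInter, Set.mem_ofPred_eq]
    refine ⟨fun h t ht => h ▸ heatFlow_le_toReal_heatMaximal hf hB hf0 ht.le x, fun h => ?_⟩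
    exact le_antisymm (le_toReal_heatMaximal hf hB hf0 x) (toReal_heatMaximal_le hf hB hf0 h)
  rw [h]
  refine isClosed_biInter fun t _ => isClosed_le ?_ hf
  exact (continuous_heatFlow hf hB).comp (by fun_prop : Continuous fun x : ℝ => (t, x))

/-- Polygonal energies of the heat maximal function of a bounded continuous function are
dominated by those of the function. -/
theorem exists_polygonalEnergy_heatMaximal_le (hf : Continuous f) (hB : ∀ x, |f x| ≤ B)
    (hf0 : ∀ x, 0 ≤ f x) {Φ c : ℝ → ℝ} (hΦ : IsConvexEnergy Φ c) {l : List ℝ}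
    (hl : l.Pairwise (· < ·)) :
    ∃ L : List ℝ, L.Pairwise (· < ·) ∧
      polygonalEnergy Φ (fun x => (heatMaximal f x).toReal) l ≤ polygonalEnergy Φ f L := by
  refine (obstacleMaximumPrinciple_heatMaximal hf hB hf0).exists_polygonalEnergy_le hf
    (le_toReal_heatMaximal hf hB hf0) (isClosed_setOf_eq_heatMaximal hf hB hf0) (B := B)
    (fun x => ?_) hΦ hl
  rw [abs_of_nonneg ENNReal.toReal_nonneg]
  exact ENNReal.toReal_le_of_le_ofReal ((abs_nonneg _).trans (hB 0)) (heatMaximal_le_ofReal hB x)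

end HeatFlow

/-! ### The energies `(|s| - k)₊ ^ p` and total variation -/

section PowEnergy

/-- The convex energy `s ↦ ((|s| - k)₊) ^ p`. -/
noncomputable def powEnergy (k p s : ℝ) : ℝ := max (|s| - k) 0 ^ p

theorem rpow_add_mul_sub_le {p a b : ℝ} (hp : 1 ≤ p) (ha : 0 < a) (hb : 0 ≤ b) :
    a ^ p + p * a ^ (p - 1) * (b - a) ≤ b ^ p := by
  have h1 := one_add_mul_self_le_rpow_one_add (s := b / a - 1) (p := p)
    (by linarith [div_nonneg hb ha.le]) hp
  have h2 : 1 + (b / a - 1) = b / a := by ring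
  rw [h2, Real.div_rpow hb ha.le, le_div_iff₀ (Real.rpow_pos_of_pos ha p)] at h1
  refine le_trans (le_of_eq ?_) h1
  rw [Real.rpow_sub_one ha.ne']
  field_simp

/-- The tangent inequality for `x ↦ x^p` combined with the one for `s ↦ (|s| - k)₊`. With `k = 0`
the energy measures the `p`-norm of the slope; large `k` isolates steep slopes. -/
theorem isConvexEnergy_powEnergy {k p : ℝ} (hk : 0 ≤ k) (hp : 1 ≤ p) :
    IsConvexEnergy (powEnergy k p)
      fun s => if |s| ≤ k then 0 else p * (|s| - k) ^ (p - 1) * Real.sign s where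
  zero := by simp [powEnergy, hk, Real.zero_rpow (by linarith : p ≠ 0)]
  subgradient_zero := by simp
  le s r := by
    have hr : 0 ≤ powEnergy k p r := Real.rpow_nonneg (le_max_right _ _) _
    split_ifs with h
    · have : powEnergy k p s = 0 := by
        rw [powEnergy, max_eq_right (by linarith), Real.zero_rpow (by linarith)]
      linarith
    · push Not at h
      have ha : 0 < |s| - k := by linarith
      have h1 := rpow_add_mul_sub_le hp ha (le_max_right (|r| - k) 0)
      have h2 : Real.sign s * (r - s) ≤ max (|r| - k) 0 - (|s| - k) := by
        have h3 : Real.sign s * r ≤ |r| := by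
          rcases Real.sign_apply_eq s with h | h | h <;> rw [h]
          · simpa using neg_le_abs r
          · simp
          · simpa using le_abs_self r
        have h4 : Real.sign s * s = |s| := by
          rcases lt_trichotomy s 0 with h | h | h
          · rw [Real.sign_of_neg h, abs_of_neg h]; ring
          · simp [h]
          · rw [Real.sign_of_pos h, abs_of_pos h, one_mul]
        have h5 := le_max_left (|r| - k) 0
        linarith
      have h6 : 0 ≤ p * (|s| - k) ^ (p - 1) := mul_nonneg (by linarith) (Real.rpow_nonneg ha.le _)
      have h7 := mul_le_mul_of_nonneg_left h2 h6
      simp only [powEnergy]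
      rw [max_eq_left ha.le]
      linarith

theorem powEnergy_zero_one (s : ℝ) : powEnergy 0 1 s = |s| := by simp [powEnergy]

theorem pieceEnergy_powEnergy_zero_one (f : ℝ → ℝ) {a b : ℝ} (hab : a < b) :
    pieceEnergy (powEnergy 0 1) f a b = |f b - f a| := by
  have : 0 < b - a := sub_pos.2 hab
  rw [pieceEnergy, powEnergy_zero_one, abs_div, abs_of_pos this]
  field_simp

theorem pairwise_map_range' {v : ℕ → ℝ} {n : ℕ} (hv : StrictMonoOn v (Set.Iic n)) :
    ((List.range' 0 (n + 1)).map v).Pairwise (· < ·) := by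
  rw [List.pairwise_map]
  refine List.Pairwise.imp_of_mem ?_ (List.pairwise_lt_range' (s := 0) (n := n + 1))
  intro i j hi hj hij
  simp only [List.mem_range'_1] at hi hj
  exact hv (by simp; omega) (by simp; omega) hij

theorem eVariationOn_le_of_polygonalEnergy_le {g : ℝ → ℝ} {s : Set ℝ} {M : ℝ}
    (h : ∀ l : List ℝ, l.Pairwise (· < ·) → (∀ x ∈ l, x ∈ s) →
      polygonalEnergy (powEnergy 0 1) g l ≤ M) : eVariationOn g s ≤ ENNReal.ofReal M := by
  rw [eVariationOn.eVariationOn_eq_strictMonoOn]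
  refine iSup_le ?_
  rintro ⟨n, v, hv, hvs⟩
  have h1 := h _ (pairwise_map_range' hv) fun x hx => by
    obtain ⟨i, hi, rfl⟩ := List.mem_map.1 hx
    simp only [List.mem_range'_1] at hi
    exact hvs i (by simp; omega)
  rw [polygonalEnergy_map_range'] at h1
  simp only [zero_add] at h1
  refine le_trans (le_of_eq ?_) (ENNReal.ofReal_le_ofReal h1)
  rw [ENNReal.ofReal_sum_of_nonneg]
  · refine Finset.sum_congr rfl fun i hi => ?_
    have hi := Finset.mem_range.1 hi
    rw [pieceEnergy_powEnergy_zero_one _ (hv (by simp; omega) (by simp; omega) (by omega)),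
      edist_dist, Real.dist_eq]
  · intro i hi
    have hi := Finset.mem_range.1 hi
    exact (isConvexEnergy_powEnergy le_rfl le_rfl).pieceEnergy_nonneg _
      (hv (by simp; omega) (by simp; omega) (by omega))

end PowEnergy

/-! ### Data of bounded variation -/

section BoundedVariation

variable {F A : ℝ → ℝ} {B V : ℝ}

/-- The hypothesis encodes bounded variation: `A a` majorizes what `F` still varies to the right of
`a`. In this form it is stable under averaging (`heatMean_abs_sub_add_le`). -/
theorem antitone_of_abs_sub_add_le (hA : ∀ a b, a < b → |F b - F a| + A b ≤ A a) : Antitone A := by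
  intro a b hab
  rcases hab.eq_or_lt with rfl | h
  · exact le_rfl
  · linarith [hA a b h, abs_nonneg (F b - F a)]

theorem abs_sub_le_abs_sub_of_abs_sub_add_le (hA : ∀ a b, a < b → |F b - F a| + A b ≤ A a)
    (a b : ℝ) : |F b - F a| ≤ |A b - A a| := by
  rcases lt_trichotomy a b with h | rfl | h
  · rw [abs_sub_comm (A b)]
    exact (by linarith [hA a b h] : |F b - F a| ≤ A a - A b).trans (le_abs_self _)
  · simp
  · rw [abs_sub_comm]
    exact (by linarith [hA b a h] : |F a - F b| ≤ A b - A a).trans (le_abs_self _)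

theorem continuousAt_of_abs_sub_add_le (hA : ∀ a b, a < b → |F b - F a| + A b ≤ A a) {x : ℝ}
    (hx : ContinuousAt A x) : ContinuousAt F x := by
  rw [ContinuousAt, tendsto_iff_dist_tendsto_zero] at hx ⊢
  exact squeeze_zero (fun _ => dist_nonneg)
    (fun y => abs_sub_le_abs_sub_of_abs_sub_add_le hA x y) hx

theorem measurable_of_abs_sub_add_le (hA : ∀ a b, a < b → |F b - F a| + A b ≤ A a) :
    Measurable F :=
  measurable_of_countable_not_continuousAt
    ((antitone_of_abs_sub_add_le hA).countable_not_continuousAt.mono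
      fun _ hx h => hx (continuousAt_of_abs_sub_add_le hA h))

theorem integrable_translate_heatMeasure {h : ℝ → ℝ} (hm : Measurable h) {C : ℝ}
    (hC : ∀ x, |h x| ≤ C) {t : ℝ} (ht : 0 < t) (x : ℝ) :
    Integrable (fun y => h (x + y)) (heatMeasure ℝ t) := by
  have := isProbabilityMeasure_heatMeasure (E := ℝ) ht
  exact (memLp_top_of_bound (hm.comp (measurable_const_add x)).aestronglyMeasurable C
    (Filter.Eventually.of_forall fun _ => hC _)).integrable le_top

/-- `F` is continuous off a countable set because `A` is monotone, so almost every jump lands at a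
continuity point and dominated convergence applies. -/
theorem continuous_heatMean_of_abs_sub_add_le (hA : ∀ a b, a < b → |F b - F a| + A b ≤ A a)
    (hB : ∀ x, |F x| ≤ B) {t : ℝ} (ht : 0 < t) : Continuous (heatMean t F) := by
  have := isProbabilityMeasure_heatMeasure (E := ℝ) ht
  rw [continuous_iff_continuousAt]
  intro x
  refine continuousAt_of_dominated (bound := fun _ => B) ?_ ?_ (integrable_const B) ?_
  · exact Filter.Eventually.of_forall fun z =>
      (integrable_translate_heatMeasure (measurable_of_abs_sub_add_le hA) hB ht z).1
  · exact Filter.Eventually.of_forall fun z => Filter.Eventually.of_forall fun _ => hB _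
  · have hc := (antitone_of_abs_sub_add_le hA).countable_not_continuousAt
    have hc' := (hc.preimage (add_right_injective x)).ae_notMem (volume : Measure ℝ)
    filter_upwards [(heatMeasure_absolutelyContinuous t).ae_le hc'] with y hy
    simp only [Set.mem_preimage, Set.mem_ofPred_eq, not_not] at hy
    exact ContinuousAt.comp (f := fun z => z + y)
      (continuousAt_of_abs_sub_add_le hA hy) (by fun_prop)

theorem heatMean_abs_sub_add_le (hA : ∀ a b, a < b → |F b - F a| + A b ≤ A a)
    (hB : ∀ x, |F x| ≤ B) (hA0 : ∀ x, 0 ≤ A x) (hAV : ∀ x, A x ≤ V) {t : ℝ} (ht : 0 < t) :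
    ∀ a b, a < b → |heatMean t F b - heatMean t F a| + heatMean t A b ≤ heatMean t A a := by
  intro a b hab
  have hiF := integrable_translate_heatMeasure (measurable_of_abs_sub_add_le hA) hB ht
  have hiA := integrable_translate_heatMeasure (antitone_of_abs_sub_add_le hA).measurable
    (fun x => by rw [abs_of_nonneg (hA0 x)]; exact hAV x) ht
  have h1 : |heatMean t F b - heatMean t F a| ≤
      ∫ y, |F (b + y) - F (a + y)| ∂(heatMeasure ℝ t) := by
    rw [heatMean, heatMean, ← integral_sub (hiF b) (hiF a)]
    exact abs_integral_le_integral_abs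
  have hi : Integrable (fun y => |F (b + y) - F (a + y)|) (heatMeasure ℝ t) :=
    ((hiF b).sub (hiF a)).abs
  calc _ ≤ (∫ y, |F (b + y) - F (a + y)| ∂(heatMeasure ℝ t)) + heatMean t A b := by gcongr
    _ = ∫ y, (|F (b + y) - F (a + y)| + A (b + y)) ∂(heatMeasure ℝ t) :=
      (integral_add hi (hiA b)).symm
    _ ≤ _ := integral_mono (hi.add (hiA b)) (hiA a) fun y => hA _ _ (by linarith)

theorem abs_heatMean_le (hB : ∀ x, |F x| ≤ B) {t : ℝ} (ht : 0 < t) (x : ℝ) :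
    |heatMean t F x| ≤ B := by
  have := isProbabilityMeasure_heatMeasure (E := ℝ) ht
  have h := norm_integral_le_of_norm_le_const (μ := heatMeasure ℝ t)
    (f := fun y => F (x + y)) (Filter.Eventually.of_forall fun _ => hB _)
  simpa [heatMean] using h

theorem ofReal_heatMean (hm : Measurable F) (hB : ∀ x, |F x| ≤ B) (hF0 : ∀ x, 0 ≤ F x)
    {t : ℝ} (ht : 0 < t) (x : ℝ) :
    ENNReal.ofReal (heatMean t F x) = heatConv t (fun y => ENNReal.ofReal (F y)) x := by
  rw [heatMean, ofReal_integral_eq_lintegral_ofReal (integrable_translate_heatMeasure hm hB ht x)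
    (Filter.Eventually.of_forall fun y => hF0 _),
    heatConv_eq_lintegral_heatMeasure t hm.ennreal_ofReal]

/-- By the semigroup law the maximal function of `P_ε F` is the supremum over times `t > ε`, which
tends to the full supremum at every point. Everywhere convergence matters because the variation is
pointwise. -/
theorem tendsto_heatMaximal_heatMean (hm : Measurable F) (hB : ∀ x, |F x| ≤ B)
    (hF0 : ∀ x, 0 ≤ F x) (x : ℝ) :
    Filter.Tendsto (fun n => heatMaximal (heatMean (dyadicStep n) F) x) Filter.atTop
      (nhds (heatMaximal F x)) := by
  have hconv (n : ℕ) : heatMaximal (heatMean (dyadicStep n) F) x =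
      ⨆ (t : ℝ) (_ : 0 < t), heatConv (t + dyadicStep n) (fun y => ENNReal.ofReal (F y)) x := by
    rw [heatMaximal_eq]
    refine iSup_congr fun t => iSup_congr fun ht => ?_
    rw [← heatConv_heatConv ht (dyadicStep_pos n) hm.ennreal_ofReal]
    congr 1
    ext y
    rw [← ofReal_heatMean hm hB hF0 (dyadicStep_pos n), abs_of_nonneg]
    exact integral_nonneg fun _ => hF0 _
  have hF : heatMaximal F x = ⨆ (t : ℝ) (_ : 0 < t), heatConv t (fun y => ENNReal.ofReal (F y)) x := by
    rw [heatMaximal_eq]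
    simp only [abs_of_nonneg (hF0 _)]
  refine tendsto_order.2 ⟨fun a ha => ?_, fun a ha => Filter.Eventually.of_forall fun n => ?_⟩
  · rw [hF] at ha
    obtain ⟨t, ha⟩ := lt_iSup_iff.1 ha
    obtain ⟨ht, ha⟩ := lt_iSup_iff.1 ha
    filter_upwards [tendsto_dyadicStep.eventually (gt_mem_nhds ht)] with n hn
    rw [hconv]
    refine ha.trans_le ?_
    have h1 := le_iSup₂ (f := fun (t : ℝ) (_ : 0 < t) =>
      heatConv (t + dyadicStep n) (fun y => ENNReal.ofReal (F y)) x) (t - dyadicStep n)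
      (sub_pos.2 hn)
    simpa using h1
  · refine lt_of_le_of_lt ?_ ha
    rw [hconv, hF]
    refine iSup₂_le fun t ht => ?_
    exact le_iSup₂ (f := fun (t : ℝ) (_ : 0 < t) =>
      heatConv t (fun y => ENNReal.ofReal (F y)) x) _ (add_pos ht (dyadicStep_pos n))

theorem tendsto_polygonalEnergy_powEnergy {G : ℕ → ℝ → ℝ} {g : ℝ → ℝ}
    (h : ∀ x, Filter.Tendsto (fun n => G n x) Filter.atTop (nhds (g x))) (l : List ℝ) :
    Filter.Tendsto (fun n => polygonalEnergy (powEnergy 0 1) (G n) l) Filter.atTop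
      (nhds (polygonalEnergy (powEnergy 0 1) g l)) := by
  have key : ∀ (l : List ℝ) (a : ℝ),
      Filter.Tendsto (fun n => polygonalEnergy (powEnergy 0 1) (G n) (a :: l)) Filter.atTop
        (nhds (polygonalEnergy (powEnergy 0 1) g (a :: l))) := by
    intro l
    induction l with
    | nil => intro a; simp [polygonalEnergy]
    | cons b l ih =>
      intro a
      simp only [polygonalEnergy, pieceEnergy, powEnergy_zero_one]
      exact (((((h b).sub (h a)).div_const (b - a)).abs).const_mul (b - a)).add (ih b)
  cases l with
  | nil => simp [polygonalEnergy]
  | cons a l => exact key l a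

/-- Smoothing gives continuous data with majorant `P_ε A`, still at most `V`; the energy of a fixed
polygon then passes to the limit. -/
theorem eVariationOn_heatMaximal_le (hA : ∀ a b, a < b → |F b - F a| + A b ≤ A a)
    (hB : ∀ x, |F x| ≤ B) (hF0 : ∀ x, 0 ≤ F x) (hA0 : ∀ x, 0 ≤ A x) (hAV : ∀ x, A x ≤ V) :
    eVariationOn (fun x => (heatMaximal F x).toReal) Set.univ ≤ ENNReal.ofReal V := by
  have hm := measurable_of_abs_sub_add_le hA
  refine eVariationOn_le_of_polygonalEnergy_le fun l hl _ => ?_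
  have hlim : ∀ x, Filter.Tendsto (fun n => (heatMaximal (heatMean (dyadicStep n) F) x).toReal)
      Filter.atTop (nhds (heatMaximal F x).toReal) := fun x =>
    (ENNReal.tendsto_toReal ((heatMaximal_le_ofReal hB x).trans_lt ENNReal.ofReal_lt_top).ne).comp
      (tendsto_heatMaximal_heatMean hm hB hF0 x)
  refine le_of_tendsto' (tendsto_polygonalEnergy_powEnergy hlim l) fun n => ?_
  have hn := dyadicStep_pos n
  obtain ⟨L, hL, hle⟩ := exists_polygonalEnergy_heatMaximal_le
    (continuous_heatMean_of_abs_sub_add_le hA hB hn) (abs_heatMean_le hB hn)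
    (fun x => integral_nonneg fun _ => hF0 _) (isConvexEnergy_powEnergy le_rfl le_rfl) hl
  refine hle.trans (polygonalEnergy_le_of_superadditive (A := heatMean (dyadicStep n) A)
    (fun a b hab => ?_) (fun x => integral_nonneg fun _ => hA0 _) (fun x => ?_) hL)
  · rw [pieceEnergy_powEnergy_zero_one _ hab]
    exact heatMean_abs_sub_add_le hA hB hA0 hAV hn a b hab
  · refine (le_abs_self _).trans (abs_heatMean_le (fun x => ?_) hn x)
    rw [abs_of_nonneg (hA0 x)]
    exact hAV x

theorem heatMaximal_boundedVariation {u : ℝ → ℝ} (hu : BoundedVariationOn u Set.univ) :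
    (∀ x : ℝ, heatMaximal u x < ⊤) ∧
      BoundedVariationOn (fun x => (heatMaximal u x).toReal) Set.univ ∧
      eVariationOn (fun x => (heatMaximal u x).toReal) Set.univ ≤ eVariationOn u Set.univ := by
  have hfin (s : Set ℝ) : eVariationOn u s ≠ ⊤ := hu.mono (Set.subset_univ s)
  -- The majorant is the variation of `u` on `[a, ∞)`.
  have hA : ∀ a b, a < b → |(|u b|) - (|u a|)| + (eVariationOn u (Set.Ici b)).toReal ≤
      (eVariationOn u (Set.Ici a)).toReal := by
    intro a b hab
    have h1 : edist (u b) (u a) + eVariationOn u (Set.Ici b) ≤ eVariationOn u (Set.Ici a) :=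
      calc _ ≤ eVariationOn u (Set.Icc a b) + eVariationOn u (Set.Ici b) := by
            gcongr
            exact eVariationOn.edist_le u ⟨hab.le, le_rfl⟩ ⟨le_rfl, hab.le⟩
        _ ≤ eVariationOn u (Set.Icc a b ∪ Set.Ici b) :=
            eVariationOn.add_le_union u fun x hx y hy => hx.2.trans hy
        _ ≤ _ := eVariationOn.mono u (Set.union_subset Set.Icc_subset_Ici_self
            (Set.Ici_subset_Ici.2 hab.le))
    have h2 := ENNReal.toReal_mono (hfin _) h1
    rw [ENNReal.toReal_add (edist_ne_top _ _) (hfin _), edist_dist, ENNReal.toReal_ofReal dist_nonneg,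
      Real.dist_eq] at h2
    linarith [abs_abs_sub_abs_le_abs_sub (u b) (u a)]
  have hB : ∀ x, |(|u x|)| ≤ |u 0| + (eVariationOn u Set.univ).toReal := by
    intro x
    have h1 := hu.dist_le (Set.mem_univ x) (Set.mem_univ 0)
    rw [Real.dist_eq] at h1
    rw [abs_abs]
    linarith [abs_sub_abs_le_abs_sub (u x) (u 0)]
  have heq : heatMaximal u = heatMaximal fun x => |u x| := by
    funext x
    simp only [heatMaximal_eq, abs_abs]
  have hle := eVariationOn_heatMaximal_le hA hB (fun x => abs_nonneg _)
    (fun x => ENNReal.toReal_nonneg) (V := (eVariationOn u Set.univ).toReal)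
    (fun x => ENNReal.toReal_mono hu (eVariationOn.mono u (Set.subset_univ _)))
  rw [ENNReal.ofReal_toReal hu] at hle
  rw [heq]
  exact ⟨fun x => (heatMaximal_le_ofReal hB x).trans_lt ENNReal.ofReal_lt_top,
    ne_top_of_le_ne_top hu hle, hle⟩

end BoundedVariation

/-! ### Continuous representatives on the line -/

section Representative

theorem IsWeakGradient.sub_eq_intervalIntegral {u g : ℝ → ℝ} (h : IsWeakGradient u g) (y : ℝ) :
    ∀ᵐ x, u (x + y) - u x = ∫ z in x..x + y, g z := by
  filter_upwards [h.sub_eq_segment_integral y] with x hx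
  rw [hx, ← intervalIntegral.integral_of_le zero_le_one]
  have h1 := intervalIntegral.mul_integral_comp_add_mul (a := 0) (b := 1) (f := g) y x
  simp only [mul_zero, add_zero, mul_one] at h1
  rw [← h1, ← intervalIntegral.integral_const_mul]
  refine intervalIntegral.integral_congr fun s _ => ?_
  simp [mul_comm]

/-- By Fubini a single base point `x` serves almost every shift, and its value is the constant. -/
theorem ae_eq_const_of_forall_ae_translate_eq {h : ℝ → ℝ} (hm : AEStronglyMeasurable h)
    (ht : ∀ y, ∀ᵐ x, h (x + y) = h x) : ∃ c, ∀ᵐ x, h x = c := by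
  have hmk := hm.ae_eq_mk
  have h1 : ∀ y, ∀ᵐ x, hm.mk h (x + y) = hm.mk h x := by
    intro y
    have h2 := (measurePreserving_add_right (volume : Measure ℝ) y).quasiMeasurePreserving.ae hmk
    filter_upwards [ht y, hmk, h2] with x hx h3 h4
    rw [← h3, ← h4, hx]
  have hms : MeasurableSet {q : ℝ × ℝ | hm.mk h (q.2 + q.1) = hm.mk h q.2} :=
    measurableSet_eq_fun (hm.stronglyMeasurable_mk.measurable.comp
      (measurable_snd.add measurable_fst)) (hm.stronglyMeasurable_mk.measurable.comp measurable_snd)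
  have h2 := (Measure.ae_ae_comm (μ := (volume : Measure ℝ)) (ν := (volume : Measure ℝ))
    (p := fun y x => hm.mk h (x + y) = hm.mk h x) hms).1 (Filter.Eventually.of_forall h1)
  obtain ⟨x, hx⟩ := h2.exists
  refine ⟨hm.mk h x, ?_⟩
  have h3 := (measurePreserving_add_right (volume : Measure ℝ) (-x)).quasiMeasurePreserving.ae hx
  filter_upwards [h3, hmk] with y hy hy'
  rw [hy', ← hy]
  congr 1
  ring

theorem LocallyIntegrable.intervalIntegrable' {g : ℝ → ℝ} (hg : LocallyIntegrable g) (a b : ℝ) :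
    IntervalIntegrable g volume a b :=
  (hg.integrableOn_isCompact isCompact_uIcc).intervalIntegrable

/-- A function with a weak derivative on the line has a representative which is a primitive of the
weak derivative. -/
theorem IsWeakGradient.exists_primitive {u g : ℝ → ℝ} (h : IsWeakGradient u g) :
    ∃ v : ℝ → ℝ, Continuous v ∧ u =ᵐ[volume] v ∧ ∀ a b, v b - v a = ∫ x in a..b, g x := by
  have hi := LocallyIntegrable.intervalIntegrable' h.2.1
  have hc : Continuous fun x => ∫ z in (0 : ℝ)..x, g z :=
    intervalIntegral.continuous_primitive hi 0
  obtain ⟨c, hcst⟩ := ae_eq_const_of_forall_ae_translate_eq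
    (h := fun x => u x - ∫ z in (0 : ℝ)..x, g z)
    (h.1.aestronglyMeasurable.sub hc.aestronglyMeasurable) fun y => by
      filter_upwards [h.sub_eq_intervalIntegral y] with x hx
      rw [← intervalIntegral.integral_add_adjacent_intervals (hi 0 x) (hi x (x + y)), ← hx]
      ring
  refine ⟨fun x => c + ∫ z in (0 : ℝ)..x, g z, hc.const_add c, ?_, fun a b => ?_⟩
  · filter_upwards [hcst] with x hx
    linarith
  · rw [← intervalIntegral.integral_interval_sub_left (hi 0 b) (hi 0 a)]
    ring

theorem abs_le_one_add_rpow {p : ℝ} (hp : 1 ≤ p) (a : ℝ) : |a| ≤ 1 + |a| ^ p := by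
  rcases le_or_gt |a| 1 with h | h
  · linarith [Real.rpow_nonneg (abs_nonneg a) p]
  · have := Real.rpow_le_rpow_of_exponent_le h.le hp
    rw [Real.rpow_one] at this
    linarith

theorem setIntegral_Ioc_abs_le {p : ℝ} (hp : 1 ≤ p) {w : ℝ → ℝ} (hw : LocallyIntegrable w)
    (hwp : Integrable fun x => |w x| ^ p) (x : ℝ) :
    ∫ y in x..x + 1, |w y| ≤ 1 + ∫ y, |w y| ^ p := by
  have h1 : ∫ y in x..x + 1, |w y| ≤ ∫ y in x..x + 1, (1 + |w y| ^ p) :=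
    intervalIntegral.integral_mono (by linarith)
      (LocallyIntegrable.intervalIntegrable' hw _ _).abs
      (intervalIntegrable_const.add hwp.intervalIntegrable) fun y => abs_le_one_add_rpow hp _
  rw [intervalIntegral.integral_add intervalIntegrable_const hwp.intervalIntegrable] at h1
  have h2 : ∫ y in x..x + 1, |w y| ^ p ≤ ∫ y, |w y| ^ p := by
    rw [intervalIntegral.integral_of_le (by linarith)]
    exact setIntegral_le_integral hwp
      (Filter.Eventually.of_forall fun _ => Real.rpow_nonneg (abs_nonneg _) _)
  have h3 : ∫ _ in x..x + 1, (1 : ℝ) = 1 := by simp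
  linarith

/-- Average `|v x| ≤ |v y| + ∫ |g|` over `y` in a unit interval, with `|a| ≤ 1 + |a|^p`. Only
boundedness matters: it gives access to the results for bounded continuous data. -/
theorem abs_le_of_primitive {p : ℝ} (hp : 1 ≤ p) {v g : ℝ → ℝ} (hv : Continuous v)
    (hg : LocallyIntegrable g) (hvg : ∀ a b, v b - v a = ∫ x in a..b, g x)
    (hvp : Integrable fun x => |v x| ^ p) (hgp : Integrable fun x => |g x| ^ p) (x : ℝ) :
    |v x| ≤ 2 + (∫ y, |v y| ^ p) + ∫ y, |g y| ^ p := by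
  have hgi := fun a b => (LocallyIntegrable.intervalIntegrable' hg a b).abs
  have h1 : ∀ y ∈ Set.Icc x (x + 1), |v x| ≤ |v y| + ∫ z in x..x + 1, |g z| := by
    intro y hy
    have h2 : |v y - v x| ≤ ∫ z in x..x + 1, |g z| := by
      rw [hvg]
      refine (intervalIntegral.abs_integral_le_integral_abs hy.1).trans ?_
      exact intervalIntegral.integral_mono_interval le_rfl hy.1 hy.2
        (Filter.Eventually.of_forall fun _ => abs_nonneg _) (hgi _ _)
    have h3 := abs_sub_abs_le_abs_sub (v x) (v y)
    rw [abs_sub_comm] at h3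
    linarith
  have hvi := hv.abs.intervalIntegrable (μ := volume) x (x + 1)
  have h2 : ∫ _ in x..x + 1, |v x| ≤ ∫ y in x..x + 1, (|v y| + ∫ z in x..x + 1, |g z|) :=
    intervalIntegral.integral_mono_on (by linarith) intervalIntegrable_const
      (hvi.add intervalIntegrable_const) h1
  rw [intervalIntegral.integral_add hvi intervalIntegrable_const] at h2
  simp only [intervalIntegral.integral_const, add_sub_cancel_left, one_smul] at h2
  have h3 := setIntegral_Ioc_abs_le hp (hv.locallyIntegrable) hvp x
  have h4 := setIntegral_Ioc_abs_le hp hg hgp x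
  linarith

end Representative

/-! ### Polygonal energies bounded by integrals of the derivative -/

section EnergyBound

theorem powEnergy_nonneg (k p s : ℝ) : 0 ≤ powEnergy k p s := Real.rpow_nonneg (le_max_right _ _) _

theorem powEnergy_le_powEnergy {k p s r : ℝ} (hp : 1 ≤ p) (h : |s| ≤ |r|) :
    powEnergy k p s ≤ powEnergy k p r :=
  Real.rpow_le_rpow (le_max_right _ _) (max_le_max (by linarith) le_rfl) (by linarith)

theorem powEnergy_le_abs_rpow {k p : ℝ} (hk : 0 ≤ k) (hp : 1 ≤ p) (s : ℝ) :
    powEnergy k p s ≤ |s| ^ p :=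
  Real.rpow_le_rpow (le_max_right _ _) (max_le (by linarith) (abs_nonneg _)) (by linarith)

theorem continuous_powEnergy {k p : ℝ} (hp : 1 ≤ p) : Continuous (powEnergy k p) :=
  (by fun_prop : Continuous fun s : ℝ => max (|s| - k) 0).rpow_const fun _ => Or.inr (by linarith)

theorem integrable_powEnergy {k p : ℝ} (hk : 0 ≤ k) (hp : 1 ≤ p) {g : ℝ → ℝ}
    (hgm : AEStronglyMeasurable g) (hgp : Integrable fun x => |g x| ^ p) :
    Integrable fun x => powEnergy k p (g x) := by
  have hm : AEStronglyMeasurable fun x => powEnergy k p (g x) :=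
    (continuous_powEnergy hp).comp_aestronglyMeasurable hgm
  refine hgp.mono hm (Filter.Eventually.of_forall fun x => ?_)
  rw [Real.norm_of_nonneg (powEnergy_nonneg _ _ _),
    Real.norm_of_nonneg (Real.rpow_nonneg (abs_nonneg _) _)]
  exact powEnergy_le_abs_rpow hk hp _

/-- Jensen's inequality: the linear part of the supporting line at the mean slope integrates to
zero. Passing from `v` to `|v|` only shrinks increments. -/
theorem pieceEnergy_abs_le_integral {k p : ℝ} (hk : 0 ≤ k) (hp : 1 ≤ p) {v g : ℝ → ℝ}
    (hg : LocallyIntegrable g) (hvg : ∀ a b, v b - v a = ∫ x in a..b, g x)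
    (hgp : Integrable fun x => |g x| ^ p) {a b : ℝ} (hab : a < b) :
    pieceEnergy (powEnergy k p) (fun x => |v x|) a b ≤ ∫ x in Set.Ioc a b, powEnergy k p (g x) := by
  have hba : 0 < b - a := sub_pos.2 hab
  set s := (v b - v a) / (b - a) with hs
  have h1 : pieceEnergy (powEnergy k p) (fun x => |v x|) a b ≤ (b - a) * powEnergy k p s := by
    unfold pieceEnergy
    refine mul_le_mul_of_nonneg_left (powEnergy_le_powEnergy hp ?_) hba.le
    rw [hs, abs_div, abs_div]
    exact div_le_div_of_nonneg_right (abs_abs_sub_abs_le_abs_sub (v b) (v a)) (abs_nonneg _)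
  refine h1.trans ?_
  have hgi := LocallyIntegrable.intervalIntegrable' hg a b
  rw [← intervalIntegral.integral_of_le hab.le]
  set c := (if |s| ≤ k then 0 else p * (|s| - k) ^ (p - 1) * Real.sign s) with hc
  have h2 : ∫ x in a..b, (powEnergy k p s + c * (g x - s)) ≤ ∫ x in a..b, powEnergy k p (g x) :=
    intervalIntegral.integral_mono hab.le
      (intervalIntegrable_const.add ((hgi.sub intervalIntegrable_const).const_mul c))
      (integrable_powEnergy hk hp hg.aestronglyMeasurable hgp).intervalIntegrable
      fun x => (isConvexEnergy_powEnergy hk hp).le s (g x)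
  rw [intervalIntegral.integral_add intervalIntegrable_const
    ((hgi.sub intervalIntegrable_const).const_mul c), intervalIntegral.integral_const_mul,
    intervalIntegral.integral_sub hgi intervalIntegrable_const, ← hvg] at h2
  simp only [intervalIntegral.integral_const, smul_eq_mul] at h2
  have h3 : v b - v a - (b - a) * s = 0 := by
    rw [hs]; field_simp; ring
  rw [h3, mul_zero, add_zero] at h2
  exact h2

theorem polygonalEnergy_abs_le_integral {k p : ℝ} (hk : 0 ≤ k) (hp : 1 ≤ p) {v g : ℝ → ℝ}
    (hg : LocallyIntegrable g) (hvg : ∀ a b, v b - v a = ∫ x in a..b, g x)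
    (hgp : Integrable fun x => |g x| ^ p) {l : List ℝ} (hl : l.Pairwise (· < ·)) :
    polygonalEnergy (powEnergy k p) (fun x => |v x|) l ≤ ∫ x, powEnergy k p (g x) := by
  have hi := integrable_powEnergy hk hp hg.aestronglyMeasurable hgp
  have h0 : 0 ≤ᵐ[volume] fun x => powEnergy k p (g x) :=
    Filter.Eventually.of_forall fun x => powEnergy_nonneg _ _ _
  refine polygonalEnergy_le_of_superadditive (A := fun a => ∫ x in Set.Ioi a, powEnergy k p (g x))
    (fun a b hab => ?_) (fun a => integral_nonneg fun x => powEnergy_nonneg _ _ _)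
    (fun a => setIntegral_le_integral hi h0) hl
  have h1 := pieceEnergy_abs_le_integral hk hp hg hvg hgp hab
  have h2 : ∫ x in Set.Ioi a, powEnergy k p (g x) = (∫ x in Set.Ioc a b, powEnergy k p (g x)) +
      ∫ x in Set.Ioi b, powEnergy k p (g x) := by
    rw [← Set.Ioc_union_Ioi_eq_Ioi hab.le, setIntegral_union (Set.Ioc_disjoint_Ioi le_rfl)
      measurableSet_Ioi hi.integrableOn hi.integrableOn]
  simp only [h2]
  linarith

theorem tendsto_integral_powEnergy {p : ℝ} (hp : 1 ≤ p) {g : ℝ → ℝ} (hgm : AEStronglyMeasurable g)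
    (hgp : Integrable fun x => |g x| ^ p) :
    Filter.Tendsto (fun k : ℕ => ∫ x, powEnergy k p (g x)) Filter.atTop (nhds 0) := by
  have h := tendsto_integral_of_dominated_convergence (μ := (volume : Measure ℝ))
    (F := fun (k : ℕ) x => powEnergy k p (g x)) (f := fun _ => 0) (fun x => |g x| ^ p) ?_ hgp ?_ ?_
  · simpa using h
  · exact fun k => (continuous_powEnergy hp).comp_aestronglyMeasurable hgm
  · refine fun k => Filter.Eventually.of_forall fun x => ?_
    rw [Real.norm_of_nonneg (powEnergy_nonneg _ _ _)]
    exact powEnergy_le_abs_rpow k.cast_nonneg hp _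
  · refine Filter.Eventually.of_forall fun x => tendsto_const_nhds.congr' ?_
    obtain ⟨N, hN⟩ := exists_nat_ge |g x|
    filter_upwards [Filter.eventually_ge_atTop N] with k hk
    have h1 : (N : ℝ) ≤ k := by exact_mod_cast hk
    rw [powEnergy, max_eq_right (by linarith), Real.zero_rpow (by linarith)]

end EnergyBound

/-! ### From polygonal energies to weak derivatives -/

section DifferenceQuotient

/-- The forward difference quotient of `g` with step `h`. -/
noncomputable def diffQuotient (g : ℝ → ℝ) (h x : ℝ) : ℝ := h⁻¹ • (g (x + h) - g x)

variable {g Φ : ℝ → ℝ} {M : ℝ}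

theorem measurable_diffQuotient (hg : Measurable g) (h : ℝ) : Measurable (diffQuotient g h) :=
  ((hg.comp (measurable_add_const h)).sub hg).const_smul h⁻¹

theorem sum_diffQuotient_le (hT : ∀ l : List ℝ, l.Pairwise (· < ·) → polygonalEnergy Φ g l ≤ M)
    {h : ℝ} (hh : 0 < h) (n : ℕ) (x : ℝ) :
    ∑ i ∈ Finset.range n, Φ (diffQuotient g h (x + i * h)) ≤ M / h := by
  have h1 := hT _ (pairwise_map_range' (v := fun i : ℕ => x + i * h) (n := n) fun i _ j _ hij => by
    have : (i : ℝ) < j := by exact_mod_cast hij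
    simp only
    gcongr)
  rw [polygonalEnergy_map_range'] at h1
  rw [le_div_iff₀ hh, Finset.sum_mul]
  refine le_trans (le_of_eq (Finset.sum_congr rfl fun i _ => ?_)) h1
  have h2 : x + (i + 1 : ℝ) * h = x + i * h + h := by ring
  simp only [pieceEnergy, diffQuotient, zero_add, Nat.cast_add, Nat.cast_one, h2,
    add_sub_cancel_left, smul_eq_mul]
  rw [mul_comm, div_eq_inv_mul]

theorem setLIntegral_Ioc_eq_sum {q : ℝ → ℝ≥0∞} (hq : Measurable q) {h : ℝ} (hh : 0 < h) (a : ℝ)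
    (n : ℕ) : ∫⁻ x in Set.Ioc a (a + n * h), q x =
      ∫⁻ x in Set.Ioc a (a + h), ∑ i ∈ Finset.range n, q (x + i * h) := by
  induction n with
  | zero => simp
  | succ n ih =>
    simp_rw [Finset.sum_range_succ]
    have hm : Measurable fun x => ∑ i ∈ Finset.range n, q (x + i * h) :=
      Finset.measurable_fun_sum _ fun i _ => hq.comp (measurable_add_const _)
    rw [lintegral_add_left hm, ← ih]
    have h1 : a + ((n + 1 : ℕ) : ℝ) * h = a + n * h + h := by push_cast; ring
    have hn : 0 ≤ n * h := by positivity
    rw [h1, ← Set.Ioc_union_Ioc_eq_Ioc (b := a + n * h) (by linarith) (by linarith),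
      lintegral_union measurableSet_Ioc (Set.Ioc_disjoint_Ioc_of_le le_rfl)]
    congr 1
    have h2 := (measurePreserving_add_right (volume : Measure ℝ) (n * h)).setLIntegral_comp_preimage
      (s := Set.Ioc (a + n * h) (a + n * h + h)) measurableSet_Ioc hq
    rw [← h2, Set.preimage_add_const_Ioc]
    congr 2
    rw [add_sub_cancel_right, add_right_comm, add_sub_cancel_right]

/-- A long interval is folded onto one period of length `h`. Difference quotients at spacing `h`
from a common offset are slopes of one polygon, so they sum to at most `M/h`; integrate over the
offset. -/
theorem lintegral_diffQuotient_le (hg : Measurable g) (hΦm : Measurable Φ) (hΦ : ∀ s, 0 ≤ Φ s)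
    (hT : ∀ l : List ℝ, l.Pairwise (· < ·) → polygonalEnergy Φ g l ≤ M) {h : ℝ} (hh : 0 < h) :
    ∫⁻ x, ENNReal.ofReal (Φ (diffQuotient g h x)) ≤ ENNReal.ofReal M := by
  have hqm : Measurable fun x => ENNReal.ofReal (Φ (diffQuotient g h x)) :=
    (hΦm.comp (measurable_diffQuotient hg h)).ennreal_ofReal
  have hN : Filter.Tendsto (fun n : ℕ => (n : ℝ) * h) Filter.atTop Filter.atTop :=
    tendsto_natCast_atTop_atTop.atTop_mul_const hh
  have hcov : AECover (volume : Measure ℝ) Filter.atTop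
      fun n : ℕ => Set.Ioc (-(n * h)) (-(n * h) + (2 * n : ℕ) * h) := by
    refine aecover_Ioc (Filter.tendsto_neg_atTop_atBot.comp hN) ?_
    refine hN.congr fun n => ?_
    push_cast
    ring
  refine le_of_tendsto' (hcov.lintegral_tendsto_of_countably_generated hqm.aemeasurable) fun n => ?_
  rw [setLIntegral_Ioc_eq_sum hqm hh]
  calc _ ≤ ∫⁻ _ in Set.Ioc (-(n * h)) (-(n * h) + h), ENNReal.ofReal (M / h) := by
        refine lintegral_mono fun x => ?_
        rw [← ENNReal.ofReal_sum_of_nonneg fun i _ => hΦ _]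
        exact ENNReal.ofReal_le_ofReal (sum_diffQuotient_le hT hh _ x)
    _ = ENNReal.ofReal M := by
        rw [setLIntegral_const, Real.volume_Ioc, add_sub_cancel_left, ← ENNReal.ofReal_mul' hh.le,
          div_mul_cancel₀ _ hh.ne']

theorem polygonalEnergy_one_le_add {p b : ℝ} (hp : 1 ≤ p) (l : List ℝ) (a : ℝ)
    (hl : (a :: l).Pairwise (· < ·)) (hb : ∀ x ∈ a :: l, x ≤ b) :
    polygonalEnergy (powEnergy 0 1) g (a :: l) ≤
      (b - a) + polygonalEnergy (powEnergy 0 p) g (a :: l) := by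
  induction l generalizing a with
  | nil => simpa [polygonalEnergy] using hb a List.mem_cons_self
  | cons c l ih =>
    have hac : a < c := List.rel_of_pairwise_cons hl List.mem_cons_self
    have h1 := ih c (List.pairwise_cons.1 hl).2 fun x hx => hb x (List.mem_cons_of_mem _ hx)
    have h2 : pieceEnergy (powEnergy 0 1) g a c ≤ (c - a) + pieceEnergy (powEnergy 0 p) g a c := by
      simp only [pieceEnergy, powEnergy_zero_one]
      rw [← mul_one_add]
      refine mul_le_mul_of_nonneg_left ?_ (by linarith)
      simpa [powEnergy] using abs_le_one_add_rpow hp ((g c - g a) / (c - a))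
    have he (Ψ : ℝ → ℝ) : polygonalEnergy Ψ g (a :: c :: l) =
      pieceEnergy Ψ g a c + polygonalEnergy Ψ g (c :: l) := rfl
    rw [he, he]
    linarith

theorem ae_differentiableAt_of_polygonalEnergy_le {p : ℝ} (hp : 1 ≤ p)
    (hT : ∀ l : List ℝ, l.Pairwise (· < ·) → polygonalEnergy (powEnergy 0 p) g l ≤ M) :
    ∀ᵐ x, DifferentiableAt ℝ g x := by
  refine LocallyBoundedVariationOn.ae_differentiableAt fun a b _ _ => ?_
  refine ne_top_of_le_ne_top (ENNReal.ofReal_ne_top (r := |b - a| + M))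
    (eVariationOn_le_of_polygonalEnergy_le fun l hl hls => ?_)
  cases l with
  | nil =>
    have := hT [] List.Pairwise.nil
    simp only [polygonalEnergy] at this ⊢
    positivity
  | cons x l =>
    have h1 := polygonalEnergy_one_le_add (g := g) (b := b) hp l x hl fun y hy => (hls y hy).2.2
    have h2 := hT _ hl
    have h3 : a ≤ x := (hls x List.mem_cons_self).2.1
    have h4 := le_abs_self (b - a)
    linarith

theorem tendsto_diffQuotient {x : ℝ} (hx : DifferentiableAt ℝ g x) :
    Filter.Tendsto (fun n => diffQuotient g (dyadicStep n) x) Filter.atTop (nhds (deriv g x)) := by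
  have h1 := hx.hasDerivAt.tendsto_slope_zero
  refine h1.comp (tendsto_nhdsWithin_iff.2 ⟨tendsto_dyadicStep, ?_⟩)
  exact Filter.Eventually.of_forall fun n => (dyadicStep_pos n).ne'

/-- Where `|w| ≥ 2k` one has `|w| ≤ 2(|w| - k)`, and `|w| - k ≥ 1`, so the power `p` only increases
it. -/
theorem enorm_indicator_le_powEnergy {p : ℝ} (hp : 1 ≤ p) {k : ℕ} (hk : 1 ≤ k) (w : ℝ → ℝ) (x : ℝ) :
    ‖{x | ((2 * k : ℕ) : NNReal) ≤ ‖w x‖₊}.indicator w x‖ₑ ≤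
      ENNReal.ofReal (2 * powEnergy k p (w x)) := by
  by_cases hx : x ∈ {x | ((2 * k : ℕ) : NNReal) ≤ ‖w x‖₊}
  · rw [Set.indicator_of_mem hx, Real.enorm_eq_ofReal_abs]
    refine ENNReal.ofReal_le_ofReal ?_
    have h1 : (2 * k : ℝ) ≤ |w x| := by
      have h0 : ((2 * k : ℕ) : NNReal) ≤ ‖w x‖₊ := hx
      have h2 : (((2 * k : ℕ) : NNReal) : ℝ) ≤ ‖w x‖ := by exact_mod_cast h0
      simpa using h2
    have h2 : (1 : ℝ) ≤ k := by exact_mod_cast hk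
    have h3 : |w x| - k ≤ powEnergy k p (w x) := by
      rw [powEnergy, max_eq_left (by linarith)]
      exact Real.self_le_rpow_of_one_le (by linarith) hp
    linarith
  · rw [Set.indicator_of_notMem hx]
    simp

/-- Vitali's theorem. Uniform integrability comes from the energies with large `k`, uniformly in the
step; for `p = 1` this rules out a singular part of the derivative. -/
theorem tendsto_eLpNorm_diffQuotient {p : ℝ} (hp : 1 ≤ p) (hg : Measurable g) {M : ℕ → ℝ}
    (hT : ∀ (k : ℕ) (l : List ℝ), l.Pairwise (· < ·) → polygonalEnergy (powEnergy k p) g l ≤ M k)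
    (hM : Filter.Tendsto M Filter.atTop (nhds 0)) (hd : ∀ᵐ x, DifferentiableAt ℝ g x)
    (hgi : LocallyIntegrable (deriv g)) {K : Set ℝ} (hK : IsCompact K) :
    Filter.Tendsto (fun n => eLpNorm (diffQuotient g (dyadicStep n) - deriv g) 1
      (volume.restrict K)) Filter.atTop (nhds 0) := by
  have : IsFiniteMeasure ((volume : Measure ℝ).restrict K) :=
    isFiniteMeasure_restrict.2 hK.measure_ne_top
  refine tendsto_Lp_finite_of_tendsto_ae le_rfl ENNReal.one_ne_top
    (fun n => (measurable_diffQuotient hg _).aestronglyMeasurable)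
    (memLp_one_iff_integrable.2 (hgi.integrableOn_isCompact hK)) ?_ ?_
  · refine unifIntegrable_of le_rfl ENNReal.one_ne_top
      (fun n => (measurable_diffQuotient hg _).aestronglyMeasurable) fun ε hε => ?_
    have h1 := (hM.const_mul 2).eventually (gt_mem_nhds (by simpa using hε : 2 * 0 < ε))
    obtain ⟨k, hk1, hk⟩ := ((Filter.eventually_ge_atTop 1).and h1).exists
    refine ⟨((2 * k : ℕ) : NNReal), fun n => ?_⟩
    rw [eLpNorm_one_eq_lintegral_enorm]
    calc _ ≤ ∫⁻ x in K, ENNReal.ofReal (2 * powEnergy k p (diffQuotient g (dyadicStep n) x)) :=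
          lintegral_mono fun x => enorm_indicator_le_powEnergy hp hk1 _ x
      _ ≤ ∫⁻ x, ENNReal.ofReal (2 * powEnergy k p (diffQuotient g (dyadicStep n) x)) :=
          setLIntegral_le_lintegral _ _
      _ = ENNReal.ofReal 2 * ∫⁻ x, ENNReal.ofReal (powEnergy k p (diffQuotient g (dyadicStep n) x)) := by
          simp_rw [ENNReal.ofReal_mul zero_le_two]
          exact lintegral_const_mul _ ((continuous_powEnergy hp).measurable.comp
            (measurable_diffQuotient hg _)).ennreal_ofReal
      _ ≤ ENNReal.ofReal 2 * ENNReal.ofReal (M k) := by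
          gcongr
          exact lintegral_diffQuotient_le hg (continuous_powEnergy hp).measurable
            (powEnergy_nonneg _ _) (hT k) (dyadicStep_pos n)
      _ ≤ ENNReal.ofReal ε := by
          rw [← ENNReal.ofReal_mul zero_le_two]
          exact ENNReal.ofReal_le_ofReal hk.le
  · filter_upwards [ae_restrict_of_ae hd] with x hx using tendsto_diffQuotient hx

theorem integral_mul_diffQuotient {φ : ℝ → ℝ} (hφ : Continuous φ) (hφc : HasCompactSupport φ)
    (hg : LocallyIntegrable g) (h : ℝ) :
    ∫ x, φ x * diffQuotient g h x = ∫ x, (h⁻¹ • (φ (x + h • (-1)) - φ x)) * g x := by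
  have hi : Integrable fun x => φ x * g x := hg.integrable_smul_left_of_hasCompactSupport hφ hφc
  have hi1 : Integrable fun x => φ x * g (x + h) :=
    (LocallyIntegrable.comp_add_right hg h).integrable_smul_left_of_hasCompactSupport hφ hφc
  have hi2 : Integrable fun x => φ (x - h) * g x := by
    have := hi1.comp_sub_right h
    simpa using this
  have h1 : ∫ x, φ (x - h) * g x = ∫ x, φ x * g (x + h) := by
    rw [← integral_sub_right_eq_self (fun x => φ x * g (x + h)) h]
    simp
  have h2 (x : ℝ) : φ x * diffQuotient g h x = h⁻¹ * (φ x * g (x + h) - φ x * g x) := by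
    simp only [diffQuotient, smul_eq_mul]; ring
  have h3 (x : ℝ) : (h⁻¹ • (φ (x + h • (-1)) - φ x)) * g x =
      h⁻¹ * (φ (x - h) * g x - φ x * g x) := by
    simp only [smul_eq_mul, mul_neg, mul_one, ← sub_eq_add_neg]; ring
  simp_rw [h2, h3]
  rw [integral_const_mul, integral_const_mul, integral_sub hi1 hi, integral_sub hi2 hi, h1]

theorem tendsto_integral_diffQuotient_mul {φ : ℝ → ℝ} (hφ : ContDiff ℝ ∞ φ)
    (hφc : HasCompactSupport φ) (hg : LocallyIntegrable g) :
    Filter.Tendsto (fun n => ∫ x, ((dyadicStep n)⁻¹ • (φ (x + dyadicStep n • (-1)) - φ x)) * g x)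
      Filter.atTop (nhds (∫ x, fderiv ℝ φ x (-1) * g x)) := by
  obtain ⟨C, hC⟩ := hφ.lipschitzWith_of_hasCompactSupport hφc (by simp)
  -- Steps are at most `1`, so the shifted supports stay in the unit thickening, outside of which
  -- `g` may be cut off.
  set K := Metric.cthickening 1 (tsupport φ) with hK
  have hKc : IsCompact K := IsCompact.cthickening hφc
  have hgK : Integrable (K.indicator g) :=
    (hg.integrableOn_isCompact hKc).integrable_indicator hKc.isClosed.measurableSet
  have h1 := (hC.integral_inv_smul_sub_mul_tendsto_integral_lineDeriv_mul hgK (-1)).comp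
    (tendsto_nhdsWithin_iff.2 ⟨tendsto_dyadicStep, Filter.Eventually.of_forall dyadicStep_pos⟩)
  have hout : ∀ x, x ∉ K → ∀ s, |s| ≤ 1 → φ (x + s) = 0 := by
    intro x hx s hs
    by_contra hne
    refine hx (Metric.mem_cthickening_of_dist_le x (x + s) 1 _ (subset_tsupport φ hne) ?_)
    simpa [Real.dist_eq] using hs
  have hsub : tsupport φ ⊆ K := Metric.self_subset_cthickening _
  have e1 : ∫ x, lineDeriv ℝ φ x (-1) * K.indicator g x = ∫ x, fderiv ℝ φ x (-1) * g x := by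
    refine integral_congr_ae (Filter.Eventually.of_forall fun x => ?_)
    simp only
    rw [(hφ.differentiable (by simp) x).lineDeriv_eq_fderiv]
    by_cases hx : x ∈ K
    · rw [Set.indicator_of_mem hx]
    · have h0 : fderiv ℝ φ x = 0 := by
        by_contra hne
        exact hx (hsub (support_fderiv_subset ℝ hne))
      simp [h0]
  rw [e1] at h1
  refine h1.congr fun n => integral_congr_ae (Filter.Eventually.of_forall fun x => ?_)
  simp only
  by_cases hx : x ∈ K
  · rw [Set.indicator_of_mem hx]
  · have hs : |dyadicStep n • (-1 : ℝ)| ≤ 1 := by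
      simp only [smul_eq_mul, mul_neg, mul_one, abs_neg, abs_of_pos (dyadicStep_pos n)]
      exact pow_le_one₀ (by norm_num) (by norm_num)
    have h2 := hout x hx 0 (by simp)
    rw [add_zero] at h2
    rw [hout x hx _ hs, h2]
    simp

/-- A function whose polygonal energies for `(|·| - k)₊ ^ p` are bounded uniformly, with bounds
tending to zero as `k → ∞`, has its pointwise derivative as weak derivative. -/
theorem isWeakGradient_deriv_of_polygonalEnergy_le {p : ℝ} (hp : 1 ≤ p) (hg : Measurable g)
    (hgl : LocallyIntegrable g) {M : ℕ → ℝ}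
    (hT : ∀ (k : ℕ) (l : List ℝ), l.Pairwise (· < ·) → polygonalEnergy (powEnergy k p) g l ≤ M k)
    (hM : Filter.Tendsto M Filter.atTop (nhds 0)) :
    IsWeakGradient g (deriv g) ∧ ∫⁻ x, ‖deriv g x‖ₑ ^ p ≤ ENNReal.ofReal (M 0) := by
  have hT0 : ∀ l : List ℝ, l.Pairwise (· < ·) → polygonalEnergy (powEnergy 0 p) g l ≤ M 0 := by
    simpa using hT 0
  have hp0 : 0 < p := by linarith
  have hd := ae_differentiableAt_of_polygonalEnergy_le hp hT0
  have hbound : ∫⁻ x, ‖deriv g x‖ₑ ^ p ≤ ENNReal.ofReal (M 0) := by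
    have hcont := continuous_powEnergy (k := 0) hp
    -- The energy is continuous along difference quotients, so Fatou's lemma transfers their uniform
    -- bound to the derivative.
    have h1 : ∀ᵐ x, ‖deriv g x‖ₑ ^ p = Filter.liminf
        (fun n => ENNReal.ofReal (powEnergy 0 p (diffQuotient g (dyadicStep n) x))) Filter.atTop := by
      filter_upwards [hd] with x hx
      have h2 := ENNReal.tendsto_ofReal ((hcont.tendsto _).comp (tendsto_diffQuotient hx))
      simp only [Function.comp_apply] at h2
      rw [Filter.Tendsto.liminf_eq h2, Real.enorm_eq_ofReal_abs,
        ENNReal.ofReal_rpow_of_nonneg (abs_nonneg _) hp0.le]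
      simp [powEnergy]
    rw [lintegral_congr_ae h1]
    refine (lintegral_liminf_le fun n =>
      (hcont.measurable.comp (measurable_diffQuotient hg _)).ennreal_ofReal).trans ?_
    refine Filter.liminf_le_of_frequently_le' (Filter.Frequently.of_forall fun n => ?_)
    exact lintegral_diffQuotient_le hg hcont.measurable (powEnergy_nonneg _ _) hT0 (dyadicStep_pos n)
  have hmem : MemLp (deriv g) (ENNReal.ofReal p) := by
    refine ⟨(measurable_deriv g).aestronglyMeasurable, ?_⟩
    rw [eLpNorm_lt_top_iff_lintegral_rpow_enorm_lt_top (by simpa using hp0) ENNReal.ofReal_ne_top,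
      ENNReal.toReal_ofReal hp0.le]
    exact hbound.trans_lt ENNReal.ofReal_lt_top
  have hgi : LocallyIntegrable (deriv g) :=
    hmem.locallyIntegrable (by rw [ENNReal.one_le_ofReal]; exact hp)
  refine ⟨⟨hgl, hgi, fun φ hφ hφc v => ?_⟩, hbound⟩
  have hlim := tendsto_eLpNorm_diffQuotient hp hg hT hM hd hgi hφc.isCompact
  obtain ⟨C, hC⟩ := hφ.continuous.bounded_above_of_compact_support hφc
  have hdl (n : ℕ) : LocallyIntegrable (diffQuotient g (dyadicStep n)) :=
    ((LocallyIntegrable.comp_add_right hgl _).sub hgl).smul (dyadicStep n)⁻¹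
  have hlim2 : Filter.Tendsto (fun n => ∫ x, φ x * diffQuotient g (dyadicStep n) x) Filter.atTop
      (nhds (∫ x, φ x * deriv g x)) := by
    refine tendsto_integral_of_L1 _
      (hgi.integrable_smul_left_of_hasCompactSupport hφ.continuous hφc).aestronglyMeasurable
      (Filter.Eventually.of_forall fun n =>
        (hdl n).integrable_smul_left_of_hasCompactSupport hφ.continuous hφc) ?_
    have h0 : Filter.Tendsto (fun n => ENNReal.ofReal C *
        eLpNorm (diffQuotient g (dyadicStep n) - deriv g) 1 (volume.restrict (tsupport φ)))
        Filter.atTop (nhds 0) := by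
      simpa using ENNReal.Tendsto.const_mul hlim (Or.inr ENNReal.ofReal_ne_top)
    refine tendsto_of_tendsto_of_tendsto_of_le_of_le tendsto_const_nhds h0 (fun _ => bot_le)
      fun n => ?_
    simp only
    rw [eLpNorm_one_eq_lintegral_enorm, ← lintegral_const_mul' _ _ ENNReal.ofReal_ne_top,
      ← lintegral_indicator hφc.isCompact.isClosed.measurableSet]
    refine lintegral_mono fun x => ?_
    by_cases hx : x ∈ tsupport φ
    · rw [Set.indicator_of_mem hx, smul_eq_mul, ← mul_sub, enorm_mul]
      gcongr
      · rw [Real.enorm_eq_ofReal_abs]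
        exact ENNReal.ofReal_le_ofReal (hC x)
      · exact le_rfl
    · simp [image_eq_zero_of_notMem_tsupport hx]
  have h1 := tendsto_nhds_unique hlim2 ((tendsto_integral_diffQuotient_mul hφ hφc hgl).congr
    fun n => (integral_mul_diffQuotient hφ.continuous hφc hgl _).symm)
  have e1 (x : ℝ) : g x * fderiv ℝ φ x v = (-v) * (fderiv ℝ φ x (-1) * g x) := by
    have : fderiv ℝ φ x v = v * fderiv ℝ φ x 1 := by
      conv_lhs => rw [← mul_one v, ← smul_eq_mul, map_smul, smul_eq_mul]
    rw [this, map_neg]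
    ring
  have e2 (x : ℝ) : inner ℝ (deriv g x) v * φ x = v * (φ x * deriv g x) := by
    simp; ring
  simp_rw [e1, e2]
  rw [integral_const_mul, integral_const_mul, ← h1]
  ring

end DifferenceQuotient

/-! ### Assembly of the theorem -/

/-- On the line, the heat maximal function of a `W^{1,p}` function, `1 ≤ p < ∞`, is bounded and has a
weak derivative in `L^p`, of norm at most that of the weak derivative of the function. -/
theorem heatMaximal_isWeakGradient_real {p : ℝ≥0∞} (hp : 1 ≤ p) (hpt : p ≠ ⊤) {u : ℝ → ℝ}
    (hu : MemW1 p u) :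
    (∃ B : ℝ, ∀ x, heatMaximal u x ≤ ENNReal.ofReal B) ∧
      (∃ G, IsWeakGradient (fun x => (heatMaximal u x).toReal) G ∧ MemLp G p) ∧
      ∀ g₀ g : ℝ → ℝ, IsWeakGradient u g₀ →
        IsWeakGradient (fun x => (heatMaximal u x).toReal) g →
        eLpNorm g p volume ≤ eLpNorm g₀ p volume := by
  obtain ⟨hup, g₁, hw, hg₁⟩ := hu
  obtain ⟨v, hv, huv, hvg⟩ := hw.exists_primitive
  have hp0 : p ≠ 0 := (zero_lt_one.trans_le hp).ne'
  have hq : 1 ≤ p.toReal := by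
    rw [← ENNReal.toReal_one]
    exact ENNReal.toReal_mono hpt hp
  have hq0 : 0 < p.toReal := by linarith
  have hgl := hw.2.1
  have hgp : Integrable fun x => |g₁ x| ^ p.toReal := hg₁.integrable_norm_rpow hp0 hpt
  have hvp : Integrable fun x => |v x| ^ p.toReal := (hup.ae_eq huv).integrable_norm_rpow hp0 hpt
  obtain ⟨B, hB⟩ : ∃ B, ∀ x, |v x| ≤ B := ⟨_, abs_le_of_primitive hq hv hgl hvg hvp hgp⟩
  have hB' : ∀ x, |(|v x|)| ≤ B := by simpa only [abs_abs] using hB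
  have heq : heatMaximal u = heatMaximal fun x => |v x| := by
    funext x
    rw [heatMaximal_congr huv]
    simp only [heatMaximal_eq, abs_abs]
  rw [heq]
  set V := fun x => (heatMaximal (fun x => |v x|) x).toReal with hV
  have hVm : Measurable V := (measurable_heatMaximal hv.abs.measurable).ennreal_toReal
  have hle := heatMaximal_le_ofReal hB'
  have hVB : ∀ x, ‖V x‖ ≤ B := fun x => by
    rw [Real.norm_of_nonneg ENNReal.toReal_nonneg]
    exact ENNReal.toReal_le_of_le_ofReal ((abs_nonneg _).trans (hB 0)) (hle x)
  have hVl : LocallyIntegrable V :=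
    (memLp_top_of_bound hVm.aestronglyMeasurable B
      (Filter.Eventually.of_forall hVB)).locallyIntegrable le_top
  obtain ⟨hVw, hVd⟩ := isWeakGradient_deriv_of_polygonalEnergy_le hq hVm hVl
    (M := fun k => ∫ x, powEnergy k p.toReal (g₁ x)) (fun k l hl => by
      obtain ⟨L, hL, h1⟩ := exists_polygonalEnergy_heatMaximal_le hv.abs hB' (fun x => abs_nonneg _)
        (isConvexEnergy_powEnergy k.cast_nonneg hq) hl
      exact h1.trans (polygonalEnergy_abs_le_integral k.cast_nonneg hq hgl hvg hgp hL))
    (tendsto_integral_powEnergy hq hgl.aestronglyMeasurable hgp)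
  have hnorm : eLpNorm (deriv V) p volume ≤ eLpNorm g₁ p volume := by
    rw [eLpNorm_eq_lintegral_rpow_enorm_toReal hp0 hpt, eLpNorm_eq_lintegral_rpow_enorm_toReal hp0 hpt]
    refine ENNReal.rpow_le_rpow ?_ (by positivity)
    refine hVd.trans_eq ?_
    have h0 (x : ℝ) : powEnergy ((0 : ℕ) : ℝ) p.toReal (g₁ x) = |g₁ x| ^ p.toReal := by
      simp [powEnergy]
    simp_rw [h0]
    rw [ofReal_integral_eq_lintegral_ofReal hgp
      (Filter.Eventually.of_forall fun x => Real.rpow_nonneg (abs_nonneg _) _),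
      lintegral_ofReal_abs_rpow_eq _ hq0]
  refine ⟨⟨B, hle⟩, ⟨deriv V, hVw, (measurable_deriv V).aestronglyMeasurable,
    hnorm.trans_lt hg₁.2⟩, fun g₀ g hg₀ hg => ?_⟩
  rwa [eLpNorm_congr_ae (hg.ae_unique hVw), eLpNorm_congr_ae (hg₀.ae_unique hw)]

theorem theorem1 :
    -- (i) dimension one, exponent greater than one
    (∀ p : ℝ≥0∞, 1 < p → ∀ u₀ : ℝ → ℝ, MemW1 p u₀ →
      (∀ᵐ x : ℝ, heatMaximal u₀ x < ⊤) ∧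
      MemW1 p (fun x => (heatMaximal u₀ x).toReal) ∧
      ∀ g₀ g : ℝ → ℝ, IsWeakGradient u₀ g₀ →
        IsWeakGradient (fun x => (heatMaximal u₀ x).toReal) g →
        eLpNorm g p volume ≤ eLpNorm g₀ p volume) ∧
    -- (ii) dimension one, exponent one
    (∀ u₀ : ℝ → ℝ, MemW1 1 u₀ →
      (∀ᵐ x : ℝ, heatMaximal u₀ x < ⊤) ∧
      MemLp (fun x => (heatMaximal u₀ x).toReal) ⊤ volume ∧
      (∃ g : ℝ → ℝ, IsWeakGradient (fun x => (heatMaximal u₀ x).toReal) g) ∧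
      ∀ g₀ g : ℝ → ℝ, IsWeakGradient u₀ g₀ →
        IsWeakGradient (fun x => (heatMaximal u₀ x).toReal) g →
        eLpNorm g 1 volume ≤ eLpNorm g₀ 1 volume) ∧
    -- (iii) functions of bounded variation on the line
    (∀ u₀ : ℝ → ℝ, BoundedVariationOn u₀ Set.univ →
      (∀ x : ℝ, heatMaximal u₀ x < ⊤) ∧
      BoundedVariationOn (fun x => (heatMaximal u₀ x).toReal) Set.univ ∧
      eVariationOn (fun x => (heatMaximal u₀ x).toReal) Set.univ ≤
        eVariationOn u₀ Set.univ) ∧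
    -- (iv) higher dimension
    (∀ d : ℕ, 1 < d → ∀ p : ℝ≥0∞, p = 2 ∨ p = ⊤ →
      ∀ u₀ : EuclideanSpace ℝ (Fin d) → ℝ, MemW1 p u₀ →
        (∀ᵐ x : EuclideanSpace ℝ (Fin d), heatMaximal u₀ x < ⊤) ∧
        MemW1 p (fun x => (heatMaximal u₀ x).toReal) ∧
        ∀ g₀ g : EuclideanSpace ℝ (Fin d) → EuclideanSpace ℝ (Fin d),
          IsWeakGradient u₀ g₀ →
          IsWeakGradient (fun x => (heatMaximal u₀ x).toReal) g →
          eLpNorm g p volume ≤ eLpNorm g₀ p volume) := by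
  refine ⟨fun p hp u hu => ?_, fun u hu => ?_, fun u hu => heatMaximal_boundedVariation hu,
    fun d _ p hp u hu => ?_⟩
  · rcases eq_or_ne p ⊤ with rfl | hpt
    · obtain ⟨h1, h2, h3⟩ := heatMaximal_memW1_top hu
      exact ⟨Filter.Eventually.of_forall h1, h2, h3⟩
    · obtain ⟨⟨B, hB⟩, ⟨G, hG, hGp⟩, h3⟩ := heatMaximal_isWeakGradient_real hp.le hpt hu
      -- The `L^p` bound needs a measurable function; the maximal function is unaffected by the
      -- change of representative.
      have hmk := hu.1.1.ae_eq_mk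
      have heq : heatMaximal u = heatMaximal (hu.1.1.mk u) :=
        funext fun x => heatMaximal_congr hmk x
      have hmem := (memLp_heatMaximal hu.1.1.stronglyMeasurable_mk.measurable hp hpt
        (hu.1.ae_eq hmk)).2
      rw [← heq] at hmem
      exact ⟨Filter.Eventually.of_forall fun x => (hB x).trans_lt ENNReal.ofReal_lt_top,
        ⟨hmem, G, hG, hGp⟩, h3⟩
  · obtain ⟨⟨B, hB⟩, ⟨G, hG, -⟩, h3⟩ := heatMaximal_isWeakGradient_real le_rfl ENNReal.one_ne_top hu
    refine ⟨Filter.Eventually.of_forall fun x => (hB x).trans_lt ENNReal.ofReal_lt_top, ?_,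
      ⟨G, hG⟩, h3⟩
    refine memLp_top_of_bound hG.1.aestronglyMeasurable |B| (Filter.Eventually.of_forall fun x => ?_)
    rw [Real.norm_of_nonneg ENNReal.toReal_nonneg]
    exact ENNReal.toReal_le_of_le_ofReal (abs_nonneg _)
      ((hB x).trans (ENNReal.ofReal_le_ofReal (le_abs_self B)))
  · rcases hp with rfl | rfl
    · exact heatMaximal_memW1_two hu
    · obtain ⟨h1, h2, h3⟩ := heatMaximal_memW1_top hu
      exact ⟨Filter.Eventually.of_forall h1, h2, h3⟩
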